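/- Let $G_1=\langle X_1\mid R_1\rangle$ and $G_2=\langle X_2\mid R_2\rangle$ be finite groups, given by presentations with disjoint finite generating sets $X_1,X_2$. Let $A$ be a group with monomorphisms $\phi_i:A\to G_i$ ($i=1,2$), let $G=G_1*_A G_2$ be the amalgam, and put $X=X_1\cup X_2$. Elements of $G$ are represented by words over $X^{\pm}$. A word over $X^{\pm}$ is in normal form (a normal word) if it is a product $s_1\cdots s_k$ ($k\ge 0$) of subwords such that each $s_i$ is a word over $X_1^{\pm}$ or over $X_2^{\pm}$, consecutive $s_i$ are over different alphabets, $s_i\neq_G 1$ for all $i$, and $s_i\notin A$ for all $i$ if $k\ne 1$. For a subgroup $H\le G$ let $\mathrm{Cayley}(G,H)$ be the relative Cayley graph: its vertices are the right cosets $Hg$, and for each $x\in X^{\pm}$ there is an edge labelled $x$ from $Hg$ to $Hgx$. Let $(\Gamma(H),v_0)$, $v_0=H\cdot 1$, be the normal core of $\mathrm{Cayley}(G,H)$, that is, the union of all paths in $\mathrm{Cayley}(G,H)$ that are closed at $H\cdot 1$ and are labelled by a normal word (together with the inverses of their edges). Then the membership problem for finitely generated subgroups of $G$ is decidable, in the following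 way. There are an algorithm (a program of a unit-cost random access machine with addition and subtraction) and a constant $C$, both depending only on the given amalgam and its presentation (and on the choice of code numbers for the letters), such that for all words $g,h_1,\dots,h_n$ over $X^{\pm}$ ($n\ge 0$), with $H=\langle h_1,\dots,h_n\rangle$ and $m=|h_1|+\dots+|h_n|$, the algorithm on input $g,h_1,\dots,h_n$ halts after at most $C\,(m^2+|g|^2+n+1)$ elementary steps and outputs (1) the graph $(\Gamma(H),v_0)$, which in particular is finite; (2) a normal word $\overline g$ with $\overline g=_G g$; (3) an answer, "yes" or "no", which is "yes" if and only if $\overline g$ labels a path in $\Gamma(H)$ that is closed at $v_0$, and which is "yes" if and only if $g\in H$. In particular, if the words $h_1,\dots,h_n$ are non-empty (so that $n\le m$) and the input is not entirely empty, the running time is $O(m^2+|g|^2)$. -/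

import Mathlib

namespace AmalgamMembership

/-! ### A random access machine with a step count

Programs of a unit-cost random access machine, written in structured form.  The data are
natural numbers; there are registers and arrays, of which a program text mentions only finitely
many.  The arithmetic is addition and truncated subtraction. -/

/-- The memory: `reg r` is the content of register `r`, and `arr a i` is cell `i` of array `a`. -/
structure Store where
  reg : ℕ → ℕ
  arr : ℕ → ℕ → ℕ

/-- Arithmetic expressions, with indirect addressing `load a e` (cell `e` of array `a`). -/
inductive Expr where
  | const (k : ℕ)
  | reg (r : ℕ)
  | load (a : ℕ) (e : Expr)
  | add (e f : Expr)
  | sub (e f : Expr)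

def Expr.eval (σ : Store) : Expr → ℕ
  | .const k => k
  | .reg r => σ.reg r
  | .load a e => σ.arr a (e.eval σ)
  | .add e f => e.eval σ + f.eval σ
  | .sub e f => e.eval σ - f.eval σ

/-- The number of elementary operations needed to evaluate an expression. -/
def Expr.cost : Expr → ℕ
  | .const _ => 1
  | .reg _ => 1
  | .load _ e => e.cost + 1
  | .add e f => e.cost + f.cost + 1
  | .sub e f => e.cost + f.cost + 1

def Store.setReg (σ : Store) (r k : ℕ) : Store :=
  { σ with reg := Function.update σ.reg r k }

def Store.setArr (σ : Store) (a i k : ℕ) : Store :=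
  { σ with arr := Function.update σ.arr a (Function.update (σ.arr a) i k) }

inductive Prog where
  | assign (r : ℕ) (e : Expr)
  | store (a : ℕ) (i e : Expr)
  | seq (P Q : Prog)
  | ite (c : Expr) (P Q : Prog)
  | while (c : Expr) (P : Prog)

/-- `Exec P σ τ t`: started in `σ`, the program `P` halts in `τ` after exactly `t` elementary
steps.  A test `c` counts as true if its value is not `0`. -/
inductive Exec : Prog → Store → Store → ℕ → Prop where
  | assign (r : ℕ) (e : Expr) (σ : Store) :
      Exec (.assign r e) σ (σ.setReg r (e.eval σ)) (e.cost + 1)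
  | store (a : ℕ) (i e : Expr) (σ : Store) :
      Exec (.store a i e) σ (σ.setArr a (i.eval σ) (e.eval σ)) (i.cost + e.cost + 1)
  | seq {P Q : Prog} {σ τ υ : Store} {s t : ℕ} :
      Exec P σ τ s → Exec Q τ υ t → Exec (.seq P Q) σ υ (s + t)
  | ite_true {c : Expr} {P Q : Prog} {σ τ : Store} {t : ℕ} :
      c.eval σ ≠ 0 → Exec P σ τ t → Exec (.ite c P Q) σ τ (c.cost + 1 + t)
  | ite_false {c : Expr} {P Q : Prog} {σ τ : Store} {t : ℕ} :
      c.eval σ = 0 → Exec Q σ τ t → Exec (.ite c P Q) σ τ (c.cost + 1 + t)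
  | while_done {c : Expr} {P : Prog} {σ : Store} :
      c.eval σ = 0 → Exec (.while c P) σ σ (c.cost + 1)
  | while_step {c : Expr} {P : Prog} {σ τ υ : Store} {s t : ℕ} :
      c.eval σ ≠ 0 → Exec P σ τ s → Exec (.while c P) τ υ t →
        Exec (.while c P) σ υ (c.cost + 1 + s + t)

/-- The machine is deterministic: the final store and the running time are determined by the
program and the initial store. -/
theorem Exec.deterministic {P : Prog} {σ τ τ' : Store} {t t' : ℕ}
    (h : Exec P σ τ t) (h' : Exec P σ τ' t') : τ = τ' ∧ t = t' := by
  induction h generalizing τ' t' with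
  | assign r e σ => cases h'; exact ⟨rfl, rfl⟩
  | store a i e σ => cases h'; exact ⟨rfl, rfl⟩
  | seq _ _ ih₁ ih₂ =>
    cases h' with
    | seq k₁ k₂ =>
      obtain ⟨rfl, rfl⟩ := ih₁ k₁
      obtain ⟨rfl, rfl⟩ := ih₂ k₂
      exact ⟨rfl, rfl⟩
  | ite_true hc _ ih =>
    cases h' with
    | ite_true _ k => obtain ⟨rfl, rfl⟩ := ih k; exact ⟨rfl, rfl⟩
    | ite_false hc' _ => exact absurd hc' hc
  | ite_false hc _ ih =>
    cases h' with
    | ite_true hc' _ => exact absurd hc hc'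
    | ite_false _ k => obtain ⟨rfl, rfl⟩ := ih k; exact ⟨rfl, rfl⟩
  | while_done hc =>
    cases h' with
    | while_done _ => exact ⟨rfl, rfl⟩
    | while_step hc' _ _ => exact absurd hc hc'
  | while_step hc _ _ ih₁ ih₂ =>
    cases h' with
    | while_done hc' => exact absurd hc' hc
    | while_step _ k₁ k₂ =>
      obtain ⟨rfl, rfl⟩ := ih₁ k₁
      obtain ⟨rfl, rfl⟩ := ih₂ k₂
      exact ⟨rfl, rfl⟩

/-! ### Labelled graphs -/

/-- The formal inverse of a letter of `X^±`; `(x, true)` is `x` and `(x, false)` is `x⁻¹`. -/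
def letterInv {α : Type*} (x : α × Bool) : α × Bool := (x.1, !x.2)

/-- A pointed graph labelled with `α^±` with at most one edge of each label between two given
vertices: `edge v x w` says that there is an edge from `v` to `w` with label `x`. -/
structure LabGraph (α : Type*) (V : Type*) where
  verts : Set V
  edge : V → α × Bool → V → Prop
  base : V
  base_mem : base ∈ verts
  edge_mem : ∀ {v x w}, edge v x w → v ∈ verts
  edge_inv : ∀ {v x w}, edge v x w → edge w (letterInv x) v

/-- `Γ.Reads v u w`: there is a path in `Γ` from `v` to `w` with label `u`. -/
def LabGraph.Reads {α V : Type*} (Γ : LabGraph α V) (v : V) : List (α × Bool) → V → Prop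
  | [], w => v ∈ Γ.verts ∧ v = w
  | x :: u, w => ∃ v', Γ.edge v x v' ∧ Γ.Reads v' u w

/-- The word `u` labels a path of `Γ` that is closed at the basepoint. -/
def LabGraph.LabelsLoop {α V : Type*} (Γ : LabGraph α V) (u : List (α × Bool)) : Prop :=
  Γ.Reads Γ.base u Γ.base

/-! ### Amalgams of two presented groups

The factors are `G i = gp⟨X i | R i⟩` for `i : Fin 2`, and `G` is the pushout of the two maps
`φ i : A →* G i`.  The generating set of `G` is the disjoint union of `X 0` and `X 1`. -/

/-- The letters of `X^±`, where `X` is the disjoint union of `X 0` and `X 1`. -/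
abbrev Letter (X : Fin 2 → Type*) := (Σ i, X i) × Bool

section Amalgam

variable {X : Fin 2 → Type*} {R : ∀ i, Set (FreeGroup (X i))} {A : Type*} [Group A]
  (φ : ∀ i, A →* PresentedGroup (R i))

/-- The element of `G` given by a letter: the image of a generator or of its inverse. -/
def letterVal (x : Letter X) : Monoid.PushoutI φ :=
  let y : Monoid.PushoutI φ := Monoid.PushoutI.of x.1.1 (PresentedGroup.of x.1.2)
  if x.2 then y else y⁻¹

/-- The element of `G` given by a word. -/
def wordVal (u : List (Letter X)) : Monoid.PushoutI φ :=
  (u.map (letterVal φ)).prod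

/-- The subgroup of `G` generated by the words in a list. -/
def generated (hs : List (List (Letter X))) : Subgroup (Monoid.PushoutI φ) :=
  Subgroup.closure {y | ∃ h ∈ hs, wordVal φ h = y}

/-- The word `u` is in normal form: it is a product of syllables, each a word in the letters of a
single factor, such that consecutive syllables belong to different factors, no syllable is
trivial in `G` and, unless there is exactly one syllable, no syllable lies in `A`. -/
def IsNormalWord (u : List (Letter X)) : Prop :=
  ∃ s : List (List (Letter X)), s.flatten = u ∧
    (∀ y ∈ s, ∃ i : Fin 2, ∀ x ∈ y, x.1.1 = i) ∧
    s.IsChain (fun y z => ∀ x ∈ y, ∀ x' ∈ z, x.1.1 ≠ x'.1.1) ∧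
    (∀ y ∈ s, wordVal φ y ≠ 1) ∧
    (s.length ≠ 1 → ∀ y ∈ s, wordVal φ y ∉ (Monoid.PushoutI.base φ).range)

theorem letterVal_letterInv (x : Letter X) :
    letterVal φ (letterInv x) = (letterVal φ x)⁻¹ := by
  obtain ⟨a, _ | _⟩ := x <;> simp [letterVal, letterInv] <;> rfl

/-- The vertex `H g` of the relative Cayley graph. -/
abbrev coset (H : Subgroup (Monoid.PushoutI φ)) (g : Monoid.PushoutI φ) :
    Quotient (QuotientGroup.rightRel H) := Quotient.mk _ g

/-- The relative Cayley graph `Cayley(G, H)`: the vertices are the right cosets `H g`, and for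
every letter `x` there is an edge from `H g` to `H g x` with label `x`. -/
def relCayley (H : Subgroup (Monoid.PushoutI φ)) :
    LabGraph (Σ i, X i) (Quotient (QuotientGroup.rightRel H)) where
  verts := Set.univ
  edge v x w := ∃ g, v = coset φ H g ∧ w = coset φ H (g * letterVal φ x)
  base := coset φ H 1
  base_mem := Set.mem_univ _
  edge_mem _ := Set.mem_univ _
  edge_inv := by
    rintro _ x _ ⟨g, rfl, rfl⟩
    exact ⟨g * letterVal φ x, rfl, by rw [letterVal_letterInv, mul_inv_cancel_right]⟩

/-- Some normal path of `Cayley(G, H)` that is closed at `H 1` goes through the vertex `v`. -/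
def Essential (H : Subgroup (Monoid.PushoutI φ))
    (v : Quotient (QuotientGroup.rightRel H)) : Prop :=
  ∃ p q, IsNormalWord φ (p ++ q) ∧
    (relCayley φ H).Reads (relCayley φ H).base p v ∧
    (relCayley φ H).Reads v q (relCayley φ H).base

/-- Some normal path of `Cayley(G, H)` that is closed at `H 1` traverses the edge from `v` to `w`
with label `x`. -/
def Traversed (H : Subgroup (Monoid.PushoutI φ))
    (v : Quotient (QuotientGroup.rightRel H)) (x : Letter X)
    (w : Quotient (QuotientGroup.rightRel H)) : Prop :=
  ∃ p q, IsNormalWord φ (p ++ x :: q) ∧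
    (relCayley φ H).Reads (relCayley φ H).base p v ∧ (relCayley φ H).edge v x w ∧
    (relCayley φ H).Reads w q (relCayley φ H).base

theorem reads_append {α V : Type*} (Γ : LabGraph α V) (u u' : List (α × Bool)) (v w w' : V)
    (h : Γ.Reads v u w) (h' : Γ.Reads w u' w') : Γ.Reads v (u ++ u') w' := by
  induction u generalizing v with
  | nil => obtain ⟨_, rfl⟩ := h; exact h'
  | cons x u ih => obtain ⟨v', e, k⟩ := h; exact ⟨v', e, ih v' k⟩

/-- The graph `Γ(H)`, that is, the normal core of `Cayley(G, H)`: the union of all normal paths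
of `Cayley(G, H)` that are closed at the basepoint `H 1`, with the inverse edges. -/
def normalCore (H : Subgroup (Monoid.PushoutI φ)) :
    LabGraph (Σ i, X i) (Quotient (QuotientGroup.rightRel H)) where
  verts := {v | Essential φ H v}
  edge v x w := Traversed φ H v x w ∨ Traversed φ H w (letterInv x) v
  base := (relCayley φ H).base
  base_mem := ⟨[], [], ⟨[], by simp⟩, ⟨Set.mem_univ _, rfl⟩, ⟨Set.mem_univ _, rfl⟩⟩
  edge_mem := by
    rintro v x w (⟨p, q, hn, hp, he, hq⟩ | ⟨p, q, hn, hp, he, hq⟩)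
    · exact ⟨p, x :: q, hn, hp, w, he, hq⟩
    · exact ⟨p ++ [letterInv x], q, by simpa using hn,
        reads_append _ _ _ _ _ _ hp ⟨v, he, Set.mem_univ _, rfl⟩, hq⟩
  edge_inv := by
    rintro v x w h
    have hx : letterInv (letterInv x) = x := by simp [letterInv]
    rw [hx]
    exact h.symm

end Amalgam

/-! ### Input and output -/

section InputOutput

variable {X : Fin 2 → Type*}

/-- Cell `i` of the array that holds the list `l`, followed by zeros. -/
def cells (l : List ℕ) (i : ℕ) : ℕ := l.getD i 0

/-- The initial store for the words `g, h₁, …, hₙ`, letters being represented by their code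
numbers: register `0` holds `|g|` and array `0` the word `g`; register `1` holds `n`, array `1`
the lengths `|h₁|, …, |hₙ|`, and array `2` the words `h₁, …, hₙ` one after the other.  Everything
else is `0`. -/
def inputStore (code : Letter X → ℕ) (g : List (Letter X)) (hs : List (List (Letter X))) :
    Store where
  reg r := if r = 0 then g.length else if r = 1 then hs.length else 0
  arr a := if a = 0 then cells (g.map code) else
    if a = 1 then cells (hs.map List.length) else
    if a = 2 then cells (hs.flatten.map code) else fun _ => 0

/-- The store holds the word `u`: its length in register `2`, its letters in array `0`. -/
def Store.HoldsWord (σ : Store) (code : Letter X → ℕ) (u : List (Letter X)) : Prop :=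
  σ.reg 2 = u.length ∧ ∀ i (hi : i < u.length), σ.arr 0 i = code u[i]

/-- The store holds a copy of the well-labelled graph `Γ`: register `1` holds the number `N` of
vertices, the vertices are numbered from `0` to `N - 1`, the basepoint is vertex `0`, and cell `i`
of the array with number `3 + code x` is `j + 1` if `Γ` has an edge with label `x` from vertex `i`
to vertex `j`, and `0` if `Γ` has no edge with label `x` that starts at vertex `i`. -/
def Store.HoldsGraph {V : Type*} (σ : Store) (code : Letter X → ℕ)
    (Γ : LabGraph (Σ i, X i) V) : Prop :=
  ∃ ν : ℕ → V, Set.BijOn ν (Set.Iio (σ.reg 1)) Γ.verts ∧ ν 0 = Γ.base ∧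
    ∀ i < σ.reg 1, ∀ x : Letter X,
      σ.arr (3 + code x) i ≤ σ.reg 1 ∧
      ∀ j < σ.reg 1, (σ.arr (3 + code x) i = j + 1 ↔ Γ.edge (ν i) x (ν j))

end InputOutput

end AmalgamMembership

/-! The relative Cayley graph is infinite in general, but a finite piece of it carries all that is
needed. Call a set of vertices a precover if each factor acts on a subset of it and the two actions
agree on A where both are defined (`IsPrecover`). The reduction process of amalgams can be carried
out inside a precover: adjacent syllables of one factor are multiplied, and a syllable in A is
absorbed by its neighbour, without moving the ends of a path. So every path can be replaced by one
with the same ends, the same value, and a label that is reduced or a single element of A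
(`IsPrecover.exists_red`). With the normal form theorem it follows that a path of trivial value is
closed, and that reduced words of equal value label the same paths (`IsPrecover.path_of_isRed`). If
the precover is also connected to a basepoint, maps compatibly to the cosets of H, and has loops at
the basepoint with the values of the generators of H (`IsCoreModel`), then different vertices are
different cosets, and every reduced word with value in H labels a loop at the basepoint.

A normal word spells a reduced word in the elements of the factors, or one non-trivial element.
Hence all closed normal paths run inside such a precover. The spelling of a syllable is free, so
once a syllable of a closed normal path lies in an orbit of its factor, the core contains all edges
of that factor on the orbit. This describes Γ(H) as a union of orbits (`Marked`). An orbit of the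
factor j belongs to it in two cases. In the first, it contains a step by an element outside A, both
ends of which are reached from the basepoint by reduced paths that are empty or end in the other
factor; one of these paths, the step, and the inverse of the other path form a reduced loop. In the
second, it contains the basepoint, and a non-trivial element of the factor, possibly in A, fixes the
basepoint; this accounts for normal words with one syllable. The basepoint is always a vertex. See
`IsCoreModel.edge_iff` and `IsCoreModel.mem_verts_iff`.

The precover is constructed by folding. For every prefix of the product of the generators, and for
every factor, there is one copy of the factor; the copies are glued along A, along the letters, and
at the ends of complete generators, and vertices are identified until the edges labelled by elements
of the factors and of A are deterministic. Since the factors are finite, the number N of nodes is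
linear in m + 1. Only nodes of the same coset are ever identified (`IsSound`). A round takes time
O(N) and every round but the last makes one identification, so that the folding is quadratic. The
vertices reached by reduced paths are found by a similar iteration with at most 2N + 1 rounds.

The normal form of g is computed in linear time, with a stack that holds a reduced word and a
register that holds an element of A. Finally, a normal word labels a loop of Γ(H) if and only if its
value lies in H, since the path that it labels is one of those whose union is Γ(H)
(`normalCore_labelsLoop_iff`). The program therefore answers by reading the normal form in the
computed graph. -/

namespace AmalgamMembership

/-! ### Words in the elements of the factors -/

section ElementWords

variable {ι : Type*} {F : ι → Type*} [∀ i, Group (F i)] {A : Type*} [Group A]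
  (φ : ∀ i, A →* F i)

/-- The element of the amalgam given by a word in the elements of the factors. -/
def lval (l : List (Σ i, F i)) : Monoid.PushoutI φ :=
  (l.map fun s => Monoid.PushoutI.of s.1 s.2).prod

@[simp] theorem lval_nil : lval φ [] = 1 := rfl

@[simp] theorem lval_cons (s : Σ i, F i) (l : List (Σ i, F i)) :
    lval φ (s :: l) = Monoid.PushoutI.of s.1 s.2 * lval φ l := by
  simp [lval]

@[simp] theorem lval_append (l l' : List (Σ i, F i)) :
    lval φ (l ++ l') = lval φ l * lval φ l' := by
  simp [lval]

/-- The word is reduced: consecutive entries come from different factors, and no entry lies in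
the amalgamated subgroup. -/
def IsRed (l : List (Σ i, F i)) : Prop :=
  l.IsChain (fun s t => s.1 ≠ t.1) ∧ ∀ s ∈ l, s.2 ∉ (φ s.1).range

/-- The formal inverse of a word in the elements of the factors. -/
def linv (l : List (Σ i, F i)) : List (Σ i, F i) :=
  (l.map fun s => ⟨s.1, s.2⁻¹⟩).reverse

@[simp] theorem lval_linv (l : List (Σ i, F i)) : lval φ (linv l) = (lval φ l)⁻¹ := by
  induction l with
  | nil => simp [linv]
  | cons s l ih =>
    have : linv (s :: l) = linv l ++ [⟨s.1, s.2⁻¹⟩] := by simp [linv]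
    rw [this, lval_append, ih]
    simp

variable {φ}

theorem IsRed.nil : IsRed φ [] := ⟨List.isChain_nil, by simp⟩

theorem IsRed.tail {s : Σ i, F i} {l : List (Σ i, F i)} (h : IsRed φ (s :: l)) : IsRed φ l :=
  ⟨h.1.tail, fun t ht => h.2 t (List.mem_cons_of_mem _ ht)⟩

theorem isRed_append {l l' : List (Σ i, F i)} : IsRed φ (l ++ l') ↔ IsRed φ l ∧ IsRed φ l' ∧
    ∀ s ∈ l.getLast?, ∀ t ∈ l'.head?, s.1 ≠ t.1 := by
  simp only [IsRed, List.isChain_append, List.mem_append]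
  constructor
  · rintro ⟨⟨h1, h2, h3⟩, h4⟩
    exact ⟨⟨h1, fun s hs => h4 s (.inl hs)⟩, ⟨h2, fun s hs => h4 s (.inr hs)⟩, h3⟩
  · rintro ⟨⟨h1, h4⟩, ⟨h2, h5⟩, h3⟩
    exact ⟨⟨h1, h2, h3⟩, fun s hs => hs.elim (h4 s) (h5 s)⟩

theorem IsRed.linv {l : List (Σ i, F i)} (h : IsRed φ l) : IsRed φ (linv l) := by
  refine ⟨?_, ?_⟩
  · rw [AmalgamMembership.linv, List.isChain_reverse, List.isChain_map]
    exact h.1.imp fun _ _ h => h.symm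
  · intro s hs
    simp only [AmalgamMembership.linv, List.mem_reverse, List.mem_map] at hs
    obtain ⟨t, ht, rfl⟩ := hs
    simpa using h.2 t ht

/-- Replacing the head of a reduced word by an element of the same factor. -/
theorem IsRed.replace {s t : Σ i, F i} {l : List (Σ i, F i)} (h : IsRed φ (s :: l))
    (hst : s.1 = t.1) (ht : t.2 ∉ (φ t.1).range) : IsRed φ (t :: l) := by
  refine ⟨?_, ?_⟩
  · have := h.1
    rw [List.isChain_cons] at this ⊢
    exact ⟨fun y hy => hst ▸ this.1 y hy, this.2⟩
  · intro u hu
    rcases List.mem_cons.1 hu with rfl | hu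
    · exact ht
    · exact h.2 u (List.mem_cons_of_mem _ hu)

theorem isRed_singleton {s : Σ i, F i} (h : s.2 ∉ (φ s.1).range) : IsRed φ [s] :=
  ⟨List.isChain_singleton _, by simpa using h⟩

/-- The normal form theorem for amalgams. -/
theorem IsRed.eq_nil (hφ : ∀ i, Function.Injective (φ i)) {l : List (Σ i, F i)}
    (h : IsRed φ l) (hl : lval φ l ∈ (Monoid.PushoutI.base φ).range) : l = [] := by
  let w : Monoid.CoprodI.Word F := ⟨l, fun s hs hs1 => h.2 s hs (hs1 ▸ one_mem _), h.1⟩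
  have hw : Monoid.PushoutI.Reduced φ w := h.2
  have hv : Monoid.PushoutI.ofCoprodI w.prod = lval φ l := by
    simp [w, Monoid.CoprodI.Word.prod, lval, map_list_prod, Function.comp_def]
  have := hw.eq_empty_of_mem_range hφ (hv ▸ hl)
  simpa [w, Monoid.CoprodI.Word.empty] using congrArg Monoid.CoprodI.Word.toList this

theorem of_mem_base_range (hφ : ∀ i, Function.Injective (φ i)) {i : ι} {g : F i} :
    (Monoid.PushoutI.of i g : Monoid.PushoutI φ) ∈ (Monoid.PushoutI.base φ).range ↔
      g ∈ (φ i).range := by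
  constructor
  · rintro ⟨a, ha⟩
    refine ⟨a, ?_⟩
    rw [← Monoid.PushoutI.of_apply_eq_base φ i] at ha
    exact Monoid.PushoutI.of_injective hφ i ha
  · rintro ⟨a, rfl⟩
    exact ⟨a, (Monoid.PushoutI.of_apply_eq_base φ i a).symm⟩

/-! ### Partial actions of the two factors -/

/-- `Step v ⟨i, g⟩ w` is a partial right action of the factors on `V`: the domain of every factor
is a set on which it acts, and the actions agree on the amalgamated subgroup where both are
defined. -/
structure IsPrecover (φ : ∀ i, A →* F i) {V : Type*} (Step : V → (Σ i, F i) → V → Prop) :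
    Prop where
  det : ∀ {v s w w'}, Step v s w → Step v s w' → w = w'
  one : ∀ {v i g w}, Step v ⟨i, g⟩ w → Step v ⟨i, 1⟩ v
  total : ∀ {v i g w}, Step v ⟨i, g⟩ w → ∀ k, ∃ u, Step v ⟨i, k⟩ u
  mul : ∀ {v i g w k u}, Step v ⟨i, g⟩ w → Step w ⟨i, k⟩ u → Step v ⟨i, g * k⟩ u
  inv : ∀ {v i g w}, Step v ⟨i, g⟩ w → Step w ⟨i, g⁻¹⟩ v
  amalg : ∀ {v i j a w w'}, Step v ⟨i, φ i a⟩ w → Step v ⟨j, φ j a⟩ w' → w = w'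

/-- The paths of a partial action. -/
def Path {V S : Type*} (Step : V → S → V → Prop) : V → List S → V → Prop
  | v, [], w => v = w
  | v, s :: l, w => ∃ u, Step v s u ∧ Path Step u l w

theorem path_append {V S : Type*} {Step : V → S → V → Prop} {l l' : List S} {v w : V} :
    Path Step v (l ++ l') w ↔ ∃ u, Path Step v l u ∧ Path Step u l' w := by
  induction l generalizing v with
  | nil => simp [Path]
  | cons s l ih =>
    simp only [List.cons_append, Path, ih]
    constructor
    · rintro ⟨u, h, u', h', h''⟩; exact ⟨u', ⟨u, h, h'⟩, h''⟩
    · rintro ⟨u', ⟨u, h, h'⟩, h''⟩; exact ⟨u, h, u', h', h''⟩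

@[simp] theorem path_singleton {V S : Type*} {Step : V → S → V → Prop} {s : S} {v w : V} :
    Path Step v [s] w ↔ Step v s w := by
  simp [Path]

namespace IsPrecover

variable {V : Type*} {Step : V → (Σ i, F i) → V → Prop} (hS : IsPrecover φ Step)
include hS

theorem path_linv {l : List (Σ i, F i)} {v w : V} (h : Path Step v l w) :
    Path Step w (AmalgamMembership.linv l) v := by
  induction l generalizing v with
  | nil => exact Eq.symm h
  | cons s l ih =>
    obtain ⟨u, h, h'⟩ := h
    have : AmalgamMembership.linv (s :: l) = AmalgamMembership.linv l ++ [⟨s.1, s.2⁻¹⟩] := by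
      simp [AmalgamMembership.linv]
    rw [this, path_append]
    exact ⟨u, ih h', path_singleton.2 (hS.inv h)⟩

/-- Where the factor `j` acts, the action of `A` through any factor is that through `j`. -/
theorem transfer {v w : V} {i j : ι} {a : A} {k : F j} {u : V} (h : Step v ⟨i, φ i a⟩ w)
    (hv : Step v ⟨j, k⟩ u) : Step v ⟨j, φ j a⟩ w := by
  obtain ⟨w', hw'⟩ := hS.total hv (φ j a)
  rwa [hS.amalg h hw']

/-- Here the factor j is known to act at the end of the step instead of its start; `transfer` is
applied to the reversed step. -/
theorem transfer' {v w : V} {i j : ι} {a : A} {k : F j} {u : V} (h : Step v ⟨i, φ i a⟩ w)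
    (hw : Step w ⟨j, k⟩ u) : Step v ⟨j, φ j a⟩ w := by
  have h1 := hS.inv h
  rw [← map_inv] at h1
  have h2 := hS.inv (hS.transfer h1 hw)
  rwa [map_inv, inv_inv] at h2

/-- Compatibility on A lets an element of A move into the following syllable, whatever factor its
own step was taken in. -/
theorem absorb {v w u : V} {i j : ι} {a : A} {k : F j} (h : Step v ⟨i, φ i a⟩ w)
    (hw : Step w ⟨j, k⟩ u) : Step v ⟨j, φ j a * k⟩ u :=
  hS.mul (hS.transfer' h hw) hw

theorem absorb' {v w u : V} {i j : ι} {a : A} {k : F j} (h : Step v ⟨j, k⟩ w)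
    (hw : Step w ⟨i, φ i a⟩ u) : Step v ⟨j, k * φ j a⟩ u :=
  hS.mul h (hS.transfer hw (hS.inv h))

omit hS in
theorem mul_mem_range_iff {i : ι} {a : A} {g : F i} :
    φ i a * g ∈ (φ i).range ↔ g ∈ (φ i).range :=
  Subgroup.mul_mem_cancel_left _ ⟨a, rfl⟩

/-- A path whose label starts with an element of `A` and is reduced otherwise. -/
theorem exists_red_cons_base {v u w : V} {i : ι} {a : A} {t : List (Σ i, F i)}
    (h : Step v ⟨i, φ i a⟩ u) (ht : Path Step u t w) (hr : IsRed φ t) :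
    ∃ l', Path Step v l' w ∧ lval φ l' = Monoid.PushoutI.of i (φ i a) * lval φ t ∧
      (IsRed φ l' ∨ ∃ i a, l' = [⟨i, φ i a⟩]) := by
  match t, ht, hr with
  | [], ht, _ =>
    obtain rfl : u = w := ht
    exact ⟨[⟨i, φ i a⟩], path_singleton.2 h, by simp, .inr ⟨i, a, rfl⟩⟩
  | ⟨j, k⟩ :: t, ht, hr =>
    obtain ⟨u', h1, h2⟩ := ht
    refine ⟨⟨j, φ j a * k⟩ :: t, ⟨u', hS.absorb h h1, h2⟩, ?_, .inl (hr.replace rfl ?_)⟩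
    · simp [Monoid.PushoutI.of_apply_eq_base, mul_assoc]
    · exact fun hm => hr.2 ⟨j, k⟩ (by simp) (mul_mem_range_iff.1 hm)

/-- The word is rebuilt from its end. A new front syllable in A is absorbed by its successor; one in
the factor of its successor is multiplied with it, and if the product falls into A, it is absorbed
by the next syllable, which stays outside A; otherwise it is prepended. An element of A with nothing
left to absorb it is the exceptional case of the conclusion. -/
theorem exists_red {l : List (Σ i, F i)} {v w : V} (h : Path Step v l w) :
    ∃ l', Path Step v l' w ∧ lval φ l' = lval φ l ∧
      (IsRed φ l' ∨ ∃ i a, l' = [⟨i, φ i a⟩]) := by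
  induction l generalizing v with
  | nil => exact ⟨[], h, rfl, .inl .nil⟩
  | cons s l ih =>
    obtain ⟨u, hs, hl⟩ := h
    obtain ⟨t, ht, hv, hr⟩ := ih hl
    obtain ⟨i, g⟩ := s
    rw [lval_cons, ← hv]
    have single : ∀ {g' : F i}, Step v ⟨i, g'⟩ w → ∃ l', Path Step v l' w ∧
        lval φ l' = Monoid.PushoutI.of i g' ∧ (IsRed φ l' ∨ ∃ i a, l' = [⟨i, φ i a⟩]) := by
      intro g' hg'
      refine ⟨[⟨i, g'⟩], path_singleton.2 hg', by simp, ?_⟩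
      by_cases hA : g' ∈ (φ i).range
      · obtain ⟨a, rfl⟩ := hA
        exact .inr ⟨i, a, rfl⟩
      · exact .inl (isRed_singleton hA)
    rcases hr with hr | ⟨j, a, rfl⟩
    · by_cases hA : g ∈ (φ i).range
      · obtain ⟨a, rfl⟩ := hA
        exact hS.exists_red_cons_base hs ht hr
      match t, ht, hr with
      | [], ht, _ =>
        obtain rfl : u = w := ht
        simpa using single hs
      | ⟨j, k⟩ :: t, ht, hr =>
        obtain ⟨u', h1, h2⟩ := ht
        by_cases hij : i = j
        · subst hij
          have h3 := hS.mul hs h1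
          by_cases hB : g * k ∈ (φ i).range
          · obtain ⟨a, ha⟩ := hB
            rw [← ha] at h3
            obtain ⟨l', p1, p2, p3⟩ := hS.exists_red_cons_base h3 h2 hr.tail
            exact ⟨l', p1, by rw [p2, ha]; simp [mul_assoc], p3⟩
          · exact ⟨⟨i, g * k⟩ :: t, ⟨u', h3, h2⟩, by simp [mul_assoc],
              .inl (hr.replace rfl hB)⟩
        · refine ⟨⟨i, g⟩ :: ⟨j, k⟩ :: t, ⟨u, hs, u', h1, h2⟩, by simp, .inl ⟨?_, ?_⟩⟩
          · exact List.isChain_cons_cons.2 ⟨hij, hr.1⟩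
          · intro s hs
            rcases List.mem_cons.1 hs with rfl | hs
            · exact hA
            · exact hr.2 s hs
    · obtain ⟨l', p1, p2, p3⟩ := single (hS.absorb' hs (path_singleton.1 ht))
      exact ⟨l', p1, by rw [p2]; simp [Monoid.PushoutI.of_apply_eq_base], p3⟩

/-- A path whose label is trivial in the amalgam is closed. -/
theorem eq_of_lval_eq_one (hφ : ∀ i, Function.Injective (φ i)) {l : List (Σ i, F i)} {v w : V}
    (h : Path Step v l w) (hl : lval φ l = 1) : v = w := by
  obtain ⟨l', p1, p2, p3⟩ := hS.exists_red h
  rw [hl] at p2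
  rcases p3 with hr | ⟨i, a, rfl⟩
  · obtain rfl := hr.eq_nil hφ (p2 ▸ one_mem _)
    exact p1
  · have ha : φ i a = 1 := by
      apply Monoid.PushoutI.of_injective hφ i
      simpa using p2
    rw [path_singleton, ha] at p1
    exact hS.det (hS.one p1) p1

/-- Reduced words with the same value label the same paths. -/
theorem path_of_isRed (hφ : ∀ i, Function.Injective (φ i)) {l l' : List (Σ i, F i)} {v w : V}
    (h : Path Step v l' w) (hl : IsRed φ l) (hl' : IsRed φ l') (hv : lval φ l = lval φ l') :
    Path Step v l w := by
  induction l generalizing v l' with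
  | nil =>
    obtain rfl := hl'.eq_nil hφ (by rw [← hv]; exact one_mem _)
    exact h
  | cons s l ih =>
    obtain ⟨i, g⟩ := s
    match l', h, hl' with
    | [], h, hl' => exact absurd (hl.eq_nil hφ (by rw [hv]; exact one_mem _)) (by simp)
    | ⟨j, k⟩ :: l', h, hl' =>
      obtain ⟨u, h1, h2⟩ := h
      have hfst : ∀ {x : Σ i, F i}, x ∈ (AmalgamMembership.linv l).getLast? → i ≠ x.1 := by
        intro x hx
        have := hl.1
        rw [List.isChain_cons] at this
        simp only [AmalgamMembership.linv, List.getLast?_reverse, List.head?_map,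
          Option.mem_def, Option.map_eq_some_iff] at hx
        obtain ⟨y, hy, rfl⟩ := hx
        exact this.1 y hy
      have hval : lval φ (AmalgamMembership.linv l) =
          (lval φ (⟨j, k⟩ :: l'))⁻¹ * Monoid.PushoutI.of i g := by
        rw [lval_linv, ← hv, lval_cons]; simp
      -- If the first syllables lie in different factors, or if they differ by an element outside A,
      -- then the inverse of one word followed by the other can be written as a non-empty reduced
      -- word of trivial value, against the normal form theorem.
      by_cases hij : i = j
      swap
      · have hc : IsRed φ (AmalgamMembership.linv (⟨i, g⟩ :: l) ++ ⟨j, k⟩ :: l') := by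
          refine isRed_append.2 ⟨hl.linv, hl', ?_⟩
          simp [AmalgamMembership.linv, hij]
        have := hc.eq_nil hφ (by rw [lval_append, lval_linv, hv, inv_mul_cancel]; exact one_mem _)
        simp at this
      subst hij
      by_cases hA : g⁻¹ * k ∈ (φ i).range
      swap
      · have hc : IsRed φ (AmalgamMembership.linv l ++ ⟨i, g⁻¹ * k⟩ :: l') := by
          refine isRed_append.2 ⟨hl.tail.linv, hl'.replace rfl hA, ?_⟩
          intro s hs t ht
          simp only [List.head?_cons, Option.mem_def, Option.some.injEq] at ht
          subst ht
          exact (hfst hs).symm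
        have := hc.eq_nil hφ (by
          rw [lval_append, hval, lval_cons, lval_cons]
          have : (1 : Monoid.PushoutI φ) ∈ (Monoid.PushoutI.base φ).range := one_mem _
          convert this using 1
          simp only [map_mul, map_inv]
          group)
        simp at this
      -- Now k is g times an element of A. That element is moved into the second syllable of the
      -- other word, which leaves the same problem for the tails, starting at `v'`.
      obtain ⟨a, ha⟩ := hA
      obtain ⟨v', hv'⟩ := hS.total h1 g
      have hstep : Step v' ⟨i, φ i a⟩ u := by
        have := hS.mul (hS.inv hv') h1
        rwa [← ha] at this
      refine ⟨v', hv', ?_⟩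
      have hvl : lval φ l = Monoid.PushoutI.of i (φ i a) * lval φ l' := by
        have : lval φ l = (Monoid.PushoutI.of i g)⁻¹ * (lval φ (⟨i, g⟩ :: l)) := by simp
        rw [this, hv, ha]; simp [mul_assoc]
      match l', h2, hl', hvl with
      | [], h2, _, hvl =>
        obtain rfl : u = w := h2
        obtain rfl := hl.tail.eq_nil hφ (by
          rw [hvl, Monoid.PushoutI.of_apply_eq_base]; simp)
        have ha1 : φ i a = 1 := by
          apply Monoid.PushoutI.of_injective hφ i
          simpa using hvl.symm
        rw [ha1] at hstep
        exact hS.det (hS.one hstep) hstep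
      | ⟨j, k'⟩ :: l', h2, hl', hvl =>
        obtain ⟨u', h3, h4⟩ := h2
        refine ih (l' := ⟨j, φ j a * k'⟩ :: l') ⟨u', hS.absorb hstep h3, h4⟩ hl.tail
          (hl'.tail.replace rfl ?_) ?_
        · exact fun hm => hl'.2 ⟨j, k'⟩ (by simp) (mul_mem_range_iff.1 hm)
        · rw [hvl]; simp [Monoid.PushoutI.of_apply_eq_base, mul_assoc]

end IsPrecover

end ElementWords

end AmalgamMembership

namespace AmalgamMembership

/-! ### Normal words and their syllables -/

section NormalWords

variable {X : Fin 2 → Type*} {R : ∀ i, Set (FreeGroup (X i))} {A : Type*} [Group A]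
  (φ : ∀ i, A →* PresentedGroup (R i))

/-- The element of a factor that is given by a letter. -/
def letterG (R : ∀ i, Set (FreeGroup (X i))) (x : Letter X) : PresentedGroup (R x.1.1) :=
  if x.2 then PresentedGroup.of x.1.2 else (PresentedGroup.of x.1.2)⁻¹

/-- The element of a factor that is given by a letter, together with the factor. -/
abbrev letterElt (R : ∀ i, Set (FreeGroup (X i))) (x : Letter X) : Σ i, PresentedGroup (R i) :=
  ⟨x.1.1, letterG R x⟩

theorem letterVal_eq (x : Letter X) :
    letterVal φ x = Monoid.PushoutI.of x.1.1 (letterG R x) := by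
  obtain ⟨⟨i, y⟩, _ | _⟩ := x <;> simp [letterVal, letterG]

theorem letterElt_letterInv (x : Letter X) :
    letterElt R (letterInv x) = ⟨x.1.1, (letterG R x)⁻¹⟩ := by
  obtain ⟨⟨i, y⟩, _ | _⟩ := x <;> simp [letterG, letterInv]

@[simp] theorem wordVal_nil : wordVal φ ([] : List (Letter X)) = 1 := rfl

@[simp] theorem wordVal_cons (x : Letter X) (u : List (Letter X)) :
    wordVal φ (x :: u) = letterVal φ x * wordVal φ u := by
  simp [wordVal]

@[simp] theorem wordVal_append (u v : List (Letter X)) :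
    wordVal φ (u ++ v) = wordVal φ u * wordVal φ v := by
  simp [wordVal]

/-- The word `u` is over the alphabet of the factor of `s`, and its value is `s`. -/
def Spells (u : List (Letter X)) (s : Σ i, PresentedGroup (R i)) : Prop :=
  (∀ x ∈ u, x.1.1 = s.1) ∧ wordVal φ u = Monoid.PushoutI.of s.1 s.2

variable {φ}

theorem Spells.append {u v : List (Letter X)} {i : Fin 2} {g k : PresentedGroup (R i)}
    (hu : Spells φ u ⟨i, g⟩) (hv : Spells φ v ⟨i, k⟩) : Spells φ (u ++ v) ⟨i, g * k⟩ := by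
  refine ⟨fun x hx => ?_, by rw [wordVal_append, hu.2, hv.2]; simp⟩
  rcases List.mem_append.1 hx with hx | hx
  exacts [hu.1 x hx, hv.1 x hx]

theorem spells_nil (i : Fin 2) : Spells φ [] ⟨i, 1⟩ := ⟨by simp, by simp⟩

theorem spells_letter (x : Letter X) : Spells φ [x] (letterElt R x) :=
  ⟨by simp, by simp [letterVal_eq]⟩

theorem exists_spells_of_forall {u : List (Letter X)} {i : Fin 2} (h : ∀ x ∈ u, x.1.1 = i) :
    ∃ g, Spells φ u ⟨i, g⟩ := by
  induction u with
  | nil => exact ⟨1, spells_nil i⟩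
  | cons x u ih =>
    obtain ⟨g, hg⟩ := ih fun y hy => h y (List.mem_cons_of_mem _ hy)
    obtain rfl : x.1.1 = i := h x (by simp)
    exact ⟨_, (spells_letter x).append hg⟩

-- The elements that can be spelled form a subgroup that contains the generators.
variable (φ) in
theorem exists_spells (s : Σ i, PresentedGroup (R i)) : ∃ u, Spells φ u s := by
  obtain ⟨i, g⟩ := s
  let K : Subgroup (PresentedGroup (R i)) :=
    { carrier := {g | ∃ u, Spells φ u ⟨i, g⟩}
      one_mem' := ⟨[], spells_nil i⟩
      mul_mem' := by
        rintro g k ⟨u, hu⟩ ⟨v, hv⟩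
        exact ⟨u ++ v, hu.append hv⟩
      inv_mem' := by
        rintro g ⟨u, hu⟩
        refine ⟨(u.map letterInv).reverse, ?_, ?_⟩
        · simp only [List.mem_reverse, List.mem_map, forall_exists_index, and_imp,
            forall_apply_eq_imp_iff₂]
          exact hu.1
        · have : ∀ u : List (Letter X), wordVal φ (u.map letterInv).reverse =
              (wordVal φ u)⁻¹ := by
            intro u
            induction u with
            | nil => simp
            | cons x u ih => simp [ih, letterVal_letterInv]
          rw [this, hu.2]
          simp }
  exact PresentedGroup.generated_by (R i) K
    (fun x => ⟨[(⟨i, x⟩, true)], by simp, by simp [letterVal]⟩) g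

variable (φ) in
/-- A chosen word for an element of a factor. -/
noncomputable def spell (s : Σ i, PresentedGroup (R i)) : List (Letter X) :=
  (exists_spells φ s).choose

theorem spells_spell (s : Σ i, PresentedGroup (R i)) : Spells φ (spell φ s) s :=
  (exists_spells φ s).choose_spec

theorem wordVal_flatten_spell (l : List (Σ i, PresentedGroup (R i))) :
    wordVal φ (l.map (spell φ)).flatten = lval φ l := by
  induction l with
  | nil => rfl
  | cons s l ih => simp [ih, (spells_spell s).2]

/-- Words in normal form are the products of words that spell the entries of a reduced word, or
that of a single non-trivial element. -/
theorem isNormalWord_iff (hφ : ∀ i, Function.Injective (φ i)) {u : List (Letter X)} :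
    IsNormalWord φ u ↔ ∃ z : List (List (Letter X) × Σ i, PresentedGroup (R i)),
      (z.map Prod.fst).flatten = u ∧ (∀ p ∈ z, Spells φ p.1 p.2) ∧
      (IsRed φ (z.map Prod.snd) ∨ ∃ p, z = [p] ∧ p.2.2 ≠ 1) := by
  constructor
  · rintro ⟨s, rfl, h1, h2, h3, h4⟩
    have : ∀ y ∈ s, ∃ t, Spells φ y t := fun y hy => by
      obtain ⟨i, hi⟩ := h1 y hy
      obtain ⟨g, hg⟩ := exists_spells_of_forall (φ := φ) hi
      exact ⟨_, hg⟩
    choose! f hf using this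
    refine ⟨s.map fun y => (y, f y), by simp [Function.comp_def], by simpa using hf, ?_⟩
    by_cases hs : s.length = 1
    · right
      obtain ⟨y, rfl⟩ := List.length_eq_one_iff.1 hs
      refine ⟨(y, f y), rfl, fun h => h3 y (by simp) ?_⟩
      have h' : (f y).2 = 1 := h
      rw [(hf y (by simp)).2, h', map_one]
    · left
      refine ⟨?_, ?_⟩
      · rw [List.map_map, List.isChain_map]
        refine List.IsChain.imp_of_mem_imp (fun y z hy hz hyz => ?_) h2
        -- Syllables are non-trivial and hence non-empty, so that their letters determine the
        -- factor; for an empty syllable the condition on alphabets would be void.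
        have hne : ∀ y ∈ s, ∃ x, x ∈ y := fun y hy => by
          refine List.exists_mem_of_ne_nil y ?_
          rintro rfl
          exact h3 [] hy rfl
        obtain ⟨x, hx⟩ := hne y hy
        obtain ⟨x', hx'⟩ := hne z hz
        have := hyz x hx x' hx'
        rwa [(hf y hy).1 x hx, (hf z hz).1 x' hx'] at this
      · simp only [List.map_map, List.mem_map, Function.comp_apply, forall_exists_index, and_imp,
          forall_apply_eq_imp_iff₂]
        intro y hy hA
        refine h4 hs y hy ?_
        rw [(hf y hy).2]
        exact (of_mem_base_range hφ).2 hA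
  · rintro ⟨z, rfl, h1, h2⟩
    refine ⟨z.map Prod.fst, rfl, ?_, ?_, ?_, ?_⟩
    · simp only [List.mem_map, forall_exists_index, and_imp, forall_apply_eq_imp_iff₂]
      exact fun p hp => ⟨_, (h1 p hp).1⟩
    · rcases h2 with h2 | ⟨p, rfl, -⟩
      · have := h2.1
        rw [List.isChain_map] at this ⊢
        refine List.IsChain.imp_of_mem_imp (fun p q hp hq hpq x hx x' hx' => ?_) this
        rwa [(h1 p hp).1 x hx, (h1 q hq).1 x' hx']
      · simp
    · simp only [List.mem_map, forall_exists_index, and_imp, forall_apply_eq_imp_iff₂]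
      intro p hp hval
      rw [(h1 p hp).2] at hval
      have hp1 : p.2.2 = 1 := Monoid.PushoutI.of_injective hφ p.2.1 (by rw [hval, map_one])
      rcases h2 with h2 | ⟨p', rfl, h2⟩
      · exact h2.2 p.2 (List.mem_map_of_mem hp) (hp1 ▸ one_mem _)
      · obtain rfl : p = p' := by simpa using hp
        exact h2 hp1
    · simp only [List.mem_map, forall_exists_index, and_imp, forall_apply_eq_imp_iff₂,
        List.length_map]
      intro hz p hp hA
      rcases h2 with h2 | ⟨p', rfl, h2⟩
      · rw [(h1 p hp).2, of_mem_base_range hφ] at hA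
        exact h2.2 p.2 (List.mem_map_of_mem hp) hA
      · simp at hz

/-- A normal word around one of its letters. -/
theorem IsNormalWord.split (hφ : ∀ i, Function.Injective (φ i)) {p q : List (Letter X)}
    {x : Letter X} (h : IsNormalWord φ (p ++ x :: q)) :
    ∃ (l₁ l₂ : List (Σ i, PresentedGroup (R i))) (g₁ g₂ : PresentedGroup (R x.1.1)),
      wordVal φ p = lval φ l₁ * Monoid.PushoutI.of x.1.1 g₁ ∧
      wordVal φ q = Monoid.PushoutI.of x.1.1 g₂ * lval φ l₂ ∧
      (IsRed φ (l₁ ++ ⟨x.1.1, g₁ * letterG R x * g₂⟩ :: l₂) ∨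
        l₁ = [] ∧ l₂ = [] ∧ g₁ * letterG R x * g₂ ≠ 1) := by
  obtain ⟨z, hz, h1, h2⟩ := (isNormalWord_iff hφ).1 h
  -- Locates the syllable that contains the given occurrence of x.
  have key : ∀ z : List (List (Letter X) × Σ i, PresentedGroup (R i)), ∀ p,
      (z.map Prod.fst).flatten = p ++ x :: q →
      ∃ z₁ y₁ y₂ s z₂, z = z₁ ++ (y₁ ++ x :: y₂, s) :: z₂ ∧
        p = (z₁.map Prod.fst).flatten ++ y₁ ∧ q = y₂ ++ (z₂.map Prod.fst).flatten := by
    intro z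
    induction z with
    | nil => intro p hp; simp at hp
    | cons a z ih =>
      intro p hp
      obtain ⟨y, s⟩ := a
      rw [List.map_cons, List.flatten_cons, List.append_eq_append_iff] at hp
      rcases hp with ⟨p', rfl, hp⟩ | ⟨y', hy, hp⟩
      · obtain ⟨z₁, y₁, y₂, s', z₂, rfl, rfl, h⟩ := ih p' hp
        exact ⟨(y, s) :: z₁, y₁, y₂, s', z₂, rfl, by simp, h⟩
      · dsimp only at hy
        match y', hy, hp with
        -- The current syllable ends immediately before x, so x belongs to a later one.
        | [], hy, hp =>
          obtain ⟨z₁, y₁, y₂, s', z₂, rfl, h', h⟩ := ih [] hp.symm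
          refine ⟨(y, s) :: z₁, y₁, y₂, s', z₂, rfl, ?_, h⟩
          obtain ⟨h3, rfl⟩ := List.append_eq_nil_iff.1 h'.symm
          simp only [List.append_nil] at hy
          simp [h3, hy]
        | x' :: y', hy, hp =>
          simp only [List.cons_append, List.cons.injEq] at hp
          obtain ⟨rfl, rfl⟩ := hp
          exact ⟨[], p, y', s, z, by simp [hy], by simp, rfl⟩
  obtain ⟨z₁, y₁, y₂, s, z₂, rfl, rfl, rfl⟩ := key z p hz
  have hs := h1 (y₁ ++ x :: y₂, s) (by simp)
  obtain ⟨i, g⟩ := s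
  obtain rfl : x.1.1 = i := hs.1 x (by simp)
  obtain ⟨g₁, hg₁⟩ := exists_spells_of_forall (φ := φ) (u := y₁) (i := x.1.1)
    fun x' hx' => hs.1 x' (by simp [hx'])
  obtain ⟨g₂, hg₂⟩ := exists_spells_of_forall (φ := φ) (u := y₂) (i := x.1.1)
    fun x' hx' => hs.1 x' (by simp [hx'])
  have hg : g = g₁ * letterG R x * g₂ := by
    apply Monoid.PushoutI.of_injective hφ x.1.1
    have := hs.2
    simp only [wordVal_append, wordVal_cons, hg₁.2, hg₂.2, letterVal_eq] at this
    rw [← this]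
    simp [mul_assoc]
  have hval : ∀ z : List (List (Letter X) × Σ i, PresentedGroup (R i)),
      (∀ p ∈ z, Spells φ p.1 p.2) →
        wordVal φ (z.map Prod.fst).flatten = lval φ (z.map Prod.snd) := by
    intro z
    induction z with
    | nil => simp
    | cons p z ih =>
      intro hz
      simp [(hz p (by simp)).2, ih fun q hq => hz q (by simp [hq])]
  refine ⟨z₁.map Prod.snd, z₂.map Prod.snd, g₁, g₂, ?_, ?_, ?_⟩
  · rw [wordVal_append, hg₁.2, hval z₁ fun p hp => h1 p (by simp [hp])]
  · rw [wordVal_append, hg₂.2, hval z₂ fun p hp => h1 p (by simp [hp])]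
  · rw [← hg]
    refine h2.imp (fun h => by simpa using h) ?_
    rintro ⟨p, hp, hp1⟩
    rw [List.append_eq_singleton_iff] at hp
    rcases hp with ⟨rfl, hp⟩ | ⟨-, hp⟩
    · rw [List.cons.injEq] at hp
      obtain ⟨rfl, rfl⟩ := hp
      exact ⟨rfl, rfl, hp1⟩
    · simp at hp

/-- Normal words with a prescribed word for one of the syllables. -/
theorem isNormalWord_of_isRed (hφ : ∀ i, Function.Injective (φ i))
    {l₁ l₂ : List (Σ i, PresentedGroup (R i))} {s : Σ i, PresentedGroup (R i)}
    {u : List (Letter X)} (hu : Spells φ u s)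
    (h : IsRed φ (l₁ ++ s :: l₂) ∨ l₁ = [] ∧ l₂ = [] ∧ s.2 ≠ 1) :
    IsNormalWord φ ((l₁.map (spell φ)).flatten ++ u ++ (l₂.map (spell φ)).flatten) := by
  refine (isNormalWord_iff hφ).2 ⟨l₁.map (fun s => (spell φ s, s)) ++ (u, s) ::
    l₂.map (fun s => (spell φ s, s)), ?_, ?_, ?_⟩
  · simp [Function.comp_def]
  · intro p hp
    simp only [List.mem_append, List.mem_map, List.mem_cons] at hp
    rcases hp with ⟨t, -, rfl⟩ | rfl | ⟨t, -, rfl⟩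
    exacts [spells_spell t, hu, spells_spell t]
  · refine h.imp (fun h => by simpa [Function.comp_def] using h) ?_
    rintro ⟨rfl, rfl, hs⟩
    exact ⟨(u, s), rfl, hs⟩

theorem isNormalWord_nil : IsNormalWord φ ([] : List (Letter X)) := ⟨[], by simp⟩

theorem isNormalWord_flatten (hφ : ∀ i, Function.Injective (φ i))
    {l : List (Σ i, PresentedGroup (R i))} (h : IsRed φ l ∨ ∃ s, l = [s] ∧ s.2 ≠ 1) :
    IsNormalWord φ (l.map (spell φ)).flatten := by
  match l, h with
  | [], _ => exact isNormalWord_nil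
  | s :: l, h =>
    refine isNormalWord_of_isRed (l₁ := []) hφ (spells_spell s) (h.imp id ?_)
    rintro ⟨t, ht, ht1⟩
    rw [List.cons.injEq] at ht
    obtain ⟨rfl, rfl⟩ := ht
    exact ⟨rfl, rfl, ht1⟩

/-! ### Cosets and paths of the relative Cayley graph -/

variable {hs : List (List (Letter X))} {H : Subgroup (Monoid.PushoutI φ)}

theorem coset_eq_iff {g k : Monoid.PushoutI φ} : coset φ H g = coset φ H k ↔ k * g⁻¹ ∈ H := by
  rw [coset, coset, Quotient.eq, QuotientGroup.rightRel_apply]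

theorem coset_mul_congr {g k : Monoid.PushoutI φ} (h : coset φ H g = coset φ H k)
    (y : Monoid.PushoutI φ) : coset φ H (g * y) = coset φ H (k * y) := by
  rw [coset_eq_iff] at h ⊢
  simpa [mul_assoc] using h

theorem coset_eq_one_iff {g : Monoid.PushoutI φ} : coset φ H g = coset φ H 1 ↔ g ∈ H := by
  rw [coset_eq_iff]; simp

theorem relCayley_edge_coset {g : Monoid.PushoutI φ} {x : Letter X}
    {w : Quotient (QuotientGroup.rightRel H)} :
    (relCayley φ H).edge (coset φ H g) x w ↔ w = coset φ H (g * letterVal φ x) := by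
  constructor
  · rintro ⟨k, hk, rfl⟩
    exact coset_mul_congr hk.symm _
  · rintro rfl
    exact ⟨g, rfl, rfl⟩

theorem relCayley_reads_coset {g : Monoid.PushoutI φ} {u : List (Letter X)}
    {w : Quotient (QuotientGroup.rightRel H)} :
    (relCayley φ H).Reads (coset φ H g) u w ↔ w = coset φ H (g * wordVal φ u) := by
  induction u generalizing g with
  | nil => simpa [LabGraph.Reads, relCayley] using eq_comm
  | cons x u ih =>
    simp only [LabGraph.Reads, relCayley_edge_coset, exists_eq_left, ih, wordVal_cons, mul_assoc]

theorem traversed_iff {v w : Quotient (QuotientGroup.rightRel H)} {x : Letter X} :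
    Traversed φ H v x w ↔ ∃ p q, IsNormalWord φ (p ++ x :: q) ∧ v = coset φ H (wordVal φ p) ∧
      w = coset φ H (wordVal φ p * letterVal φ x) ∧ wordVal φ (p ++ x :: q) ∈ H := by
  have hb : (relCayley φ H).base = coset φ H 1 := rfl
  simp only [Traversed, hb, relCayley_reads_coset, one_mul]
  constructor
  · rintro ⟨p, q, hn, rfl, he, hq⟩
    rw [relCayley_edge_coset] at he
    subst he
    rw [relCayley_reads_coset, eq_comm, coset_eq_one_iff] at hq
    exact ⟨p, q, hn, rfl, rfl, by simpa [mul_assoc] using hq⟩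
  · rintro ⟨p, q, hn, rfl, rfl, hq⟩
    refine ⟨p, q, hn, rfl, relCayley_edge_coset.2 rfl, ?_⟩
    rw [relCayley_reads_coset, eq_comm, coset_eq_one_iff]
    simpa [mul_assoc] using hq

theorem essential_iff {v : Quotient (QuotientGroup.rightRel H)} :
    Essential φ H v ↔ ∃ p q, IsNormalWord φ (p ++ q) ∧ v = coset φ H (wordVal φ p) ∧
      wordVal φ (p ++ q) ∈ H := by
  have hb : (relCayley φ H).base = coset φ H 1 := rfl
  simp only [Essential, hb, relCayley_reads_coset, one_mul]
  constructor
  · rintro ⟨p, q, hn, rfl, hq⟩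
    rw [relCayley_reads_coset, eq_comm, coset_eq_one_iff] at hq
    exact ⟨p, q, hn, rfl, by simpa using hq⟩
  · rintro ⟨p, q, hn, rfl, hq⟩
    refine ⟨p, q, hn, rfl, ?_⟩
    rw [relCayley_reads_coset, eq_comm, coset_eq_one_iff]
    simpa using hq

/-- Every vertex of the normal core except the basepoint is an end of an edge. -/
theorem essential_cases {v : Quotient (QuotientGroup.rightRel H)} (h : Essential φ H v) :
    v = coset φ H 1 ∨ ∃ x w, Traversed φ H v x w ∨ Traversed φ H w x v := by
  obtain ⟨p, q, hn, rfl, hq⟩ := essential_iff.1 h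
  match q, hn, hq with
  | x :: q, hn, hq => exact .inr ⟨x, _, .inl (traversed_iff.2 ⟨p, q, hn, rfl, rfl, hq⟩)⟩
  | [], hn, hq =>
    rcases List.eq_nil_or_concat p with rfl | ⟨p, x, rfl⟩
    · exact .inl rfl
    · refine .inr ⟨x, coset φ H (wordVal φ p), .inr (traversed_iff.2 ⟨p, [], ?_, rfl, ?_, ?_⟩)⟩
      · simpa using hn
      · simp
      · simpa using hq

/-- A normal word labels a loop of the normal core if and only if its value lies in `H`. -/
theorem normalCore_labelsLoop_iff {u : List (Letter X)} (hu : IsNormalWord φ u) :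
    (normalCore φ H).LabelsLoop u ↔ wordVal φ u ∈ H := by
  have hb : (normalCore φ H).base = coset φ H 1 := rfl
  have hedge : ∀ {v x w}, Traversed φ H v x w → (relCayley φ H).edge v x w := by
    rintro v x w ⟨-, -, -, -, h, -⟩; exact h
  constructor
  · intro h
    have : ∀ (u : List (Letter X)) v w, (normalCore φ H).Reads v u w →
        (relCayley φ H).Reads v u w := by
      intro u
      induction u with
      | nil => rintro v w ⟨-, rfl⟩; exact ⟨Set.mem_univ _, rfl⟩
      | cons x u ih =>
        rintro v w ⟨v', he, h⟩
        refine ⟨v', ?_, ih _ _ h⟩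
        rcases he with he | he
        · exact hedge he
        · have := (relCayley φ H).edge_inv (hedge he)
          simpa [letterInv] using this
    have := this _ _ _ h
    rw [hb, relCayley_reads_coset, eq_comm, one_mul, coset_eq_one_iff] at this
    exact this
  · intro h
    -- The word u is itself the witness for each edge on its path: it is normal, and the path is
    -- closed because its value lies in H.
    have : ∀ (q p : List (Letter X)), p ++ q = u →
        (normalCore φ H).Reads (coset φ H (wordVal φ p)) q (coset φ H 1) := by
      intro q
      induction q with
      | nil =>
        intro p hp
        simp only [List.append_nil] at hp
        subst hp
        rw [coset_eq_one_iff.2 h]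
        exact ⟨(normalCore φ H).base_mem, rfl⟩
      | cons x q ih =>
        intro p hp
        refine ⟨coset φ H (wordVal φ p * letterVal φ x), .inl (traversed_iff.2
          ⟨p, q, hp ▸ hu, rfl, rfl, hp ▸ h⟩), ?_⟩
        have := ih (p ++ [x]) (by simpa using hp)
        simpa using this
    exact this u [] rfl

end NormalWords

end AmalgamMembership

namespace AmalgamMembership

/-! ### The normal core inside a finite piece of the relative Cayley graph -/

section Core

variable {X : Fin 2 → Type*} {R : ∀ i, Set (FreeGroup (X i))} {A : Type*} [Group A]
  {φ : ∀ i, A →* PresentedGroup (R i)}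

/-- `Step` is the partial action of the factors on a set of cosets that contains the basepoint
and loops for the generators of the subgroup. -/
structure IsCoreModel (φ : ∀ i, A →* PresentedGroup (R i)) (hs : List (List (Letter X)))
    {V : Type*} (Step : V → (Σ i, PresentedGroup (R i)) → V → Prop) (base : V)
    (cos : V → Quotient (QuotientGroup.rightRel (generated φ hs))) : Prop
    extends IsPrecover φ Step where
  base_live : ∀ i, Step base ⟨i, 1⟩ base
  cos_base : cos base = coset φ _ 1
  cos_step : ∀ {v s w g}, Step v s w → cos v = coset φ _ g →
    cos w = coset φ _ (g * Monoid.PushoutI.of s.1 s.2)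
  conn : ∀ {v s w}, Step v s w → ∃ l, Path Step base l v
  gen : ∀ h ∈ hs, ∃ l, Path Step base l base ∧ lval φ l = wordVal φ h

/-- `FromBase φ Step base j v`: the vertex `v` is reached from the basepoint by a non-empty
reduced path with last entry in the factor `j`. -/
inductive FromBase (φ : ∀ i, A →* PresentedGroup (R i)) {V : Type*}
    (Step : V → (Σ i, PresentedGroup (R i)) → V → Prop) (base : V) : Fin 2 → V → Prop
  | start {j g v} : Step base ⟨j, g⟩ v → g ∉ (φ j).range → FromBase φ Step base j v
  | step {j g v w} : FromBase φ Step base (j + 1) v → Step v ⟨j, g⟩ w → g ∉ (φ j).range →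
      FromBase φ Step base j w

/-- A reduced path that starts at the basepoint and ends in `v` can be continued in the
factor `j`. -/
def Enters (φ : ∀ i, A →* PresentedGroup (R i)) {V : Type*}
    (Step : V → (Σ i, PresentedGroup (R i)) → V → Prop) (base : V) (j : Fin 2) (v : V) : Prop :=
  v = base ∨ FromBase φ Step base (j + 1) v

/-- The orbit of `v` under the factor `j` lies in the normal core. -/
def Marked (φ : ∀ i, A →* PresentedGroup (R i)) {V : Type*}
    (Step : V → (Σ i, PresentedGroup (R i)) → V → Prop) (base : V) (j : Fin 2) (v : V) : Prop :=
  (∃ k g d d', Step v ⟨j, k⟩ d ∧ Step d ⟨j, g⟩ d' ∧ g ∉ (φ j).range ∧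
    Enters φ Step base j d ∧ Enters φ Step base j d') ∨
  ∃ k g, Step v ⟨j, k⟩ base ∧ Step base ⟨j, g⟩ base ∧ g ≠ 1

theorem fin_two_eq_add_one : ∀ i j : Fin 2, i ≠ j → i = j + 1 := by decide

theorem fin_two_add_one_ne : ∀ j : Fin 2, j + 1 ≠ j := by decide

theorem FromBase.of_enters {V : Type*} {Step : V → (Σ i, PresentedGroup (R i)) → V → Prop}
    {base v w : V} {j : Fin 2} {g : PresentedGroup (R j)} (h : Enters φ Step base j v)
    (hs : Step v ⟨j, g⟩ w) (hg : g ∉ (φ j).range) : FromBase φ Step base j w := by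
  rcases h with rfl | h
  exacts [.start hs hg, .step h hs hg]

/-- With only two factors, a last syllable outside the factor j lies in the factor j + 1, which is
the index that `Enters` asks for. The induction removes syllables from the end. -/
theorem enters_of_path {V : Type*} {Step : V → (Σ i, PresentedGroup (R i)) → V → Prop}
    {base v : V} {l : List (Σ i, PresentedGroup (R i))} {j : Fin 2} (h : Path Step base l v)
    (hl : IsRed φ l) (hj : ∀ s ∈ l.getLast?, s.1 ≠ j) : Enters φ Step base j v := by
  induction l using List.reverseRecOn generalizing v j with
  | nil => exact .inl (Eq.symm h)
  | append_singleton l s ih =>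
    obtain ⟨u, h1, h2⟩ := path_append.1 h
    rw [isRed_append] at hl
    obtain ⟨i, g⟩ := s
    have := ih (j := i) h1 hl.1 fun s hs => hl.2.2 s hs ⟨i, g⟩ rfl
    have hij : i = j + 1 := fin_two_eq_add_one i j (hj ⟨i, g⟩ (by simp))
    subst hij
    exact .inr (.of_enters this (path_singleton.1 h2) (hl.2.1.2 ⟨_, g⟩ (by simp)))

theorem FromBase.exists_path {V : Type*} {Step : V → (Σ i, PresentedGroup (R i)) → V → Prop}
    {base v : V} {j : Fin 2} (h : FromBase φ Step base j v) :
    ∃ l, Path Step base l v ∧ IsRed φ l ∧ ∀ s ∈ l.getLast?, s.1 = j := by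
  induction h with
  | @start j g v h hg =>
    exact ⟨[⟨j, g⟩], path_singleton.2 h, isRed_singleton hg, by simp⟩
  | @step j g v w _ h hg ih =>
    obtain ⟨l, h1, h2, h3⟩ := ih
    refine ⟨l ++ [⟨j, g⟩], path_append.2 ⟨v, h1, path_singleton.2 h⟩,
      isRed_append.2 ⟨h2, isRed_singleton hg, fun s hs t ht => ?_⟩, by simp⟩
    simp only [List.head?_cons, Option.mem_def, Option.some.injEq] at ht
    subst ht
    rw [h3 s hs]
    exact fin_two_add_one_ne j

theorem Enters.exists_path {V : Type*} {Step : V → (Σ i, PresentedGroup (R i)) → V → Prop}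
    {base v : V} {j : Fin 2} (h : Enters φ Step base j v) :
    ∃ l, Path Step base l v ∧ IsRed φ l ∧ ∀ s ∈ l.getLast?, s.1 ≠ j := by
  rcases h with rfl | h
  · exact ⟨[], rfl, .nil, by simp⟩
  · obtain ⟨l, h1, h2, h3⟩ := h.exists_path
    refine ⟨l, h1, h2, fun s hs => ?_⟩
    rw [h3 s hs]
    exact fin_two_add_one_ne j

/-! ### The normal core as a union of marked orbits -/

namespace IsCoreModel

variable {hs : List (List (Letter X))} {V : Type*}
  {Step : V → (Σ i, PresentedGroup (R i)) → V → Prop} {base : V}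
  {cos : V → Quotient (QuotientGroup.rightRel (generated φ hs))}
  (M : IsCoreModel φ hs Step base cos)
include M

/-- `Marked` speaks of an arbitrary first step in the factor j, so it is constant on the orbits of
that factor. -/
theorem marked_step {j : Fin 2} {k : PresentedGroup (R j)} {v w : V}
    (h : Marked φ Step base j v) (hk : Step v ⟨j, k⟩ w) : Marked φ Step base j w := by
  have hk' := M.inv hk
  rcases h with ⟨k', g, d, d', h1, h⟩ | ⟨k', g, h1, h⟩
  · exact .inl ⟨_, g, d, d', M.mul hk' h1, h⟩
  · exact .inr ⟨_, g, M.mul hk' h1, h⟩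

theorem cos_path {l : List (Σ i, PresentedGroup (R i))} {v w : V} {g : Monoid.PushoutI φ}
    (h : Path Step v l w) (hv : cos v = coset φ _ g) : cos w = coset φ _ (g * lval φ l) := by
  induction l generalizing v g with
  | nil => obtain rfl : v = w := h; simpa using hv
  | cons s l ih =>
    obtain ⟨u, h1, h2⟩ := h
    have := ih h2 (M.cos_step h1 hv)
    rwa [lval_cons, ← mul_assoc]

theorem cos_path_base {l : List (Σ i, PresentedGroup (R i))} {w : V}
    (h : Path Step base l w) : cos w = coset φ _ (lval φ l) := by
  simpa using M.cos_path h M.cos_base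

theorem exists_loop {y : Monoid.PushoutI φ} (hy : y ∈ generated φ hs) :
    ∃ l, Path Step base l base ∧ lval φ l = y := by
  induction hy using Subgroup.closure_induction with
  | mem y hy =>
    obtain ⟨h, hh, rfl⟩ := hy
    exact M.gen h hh
  | one => exact ⟨[], rfl, rfl⟩
  | mul y z _ _ hy hz =>
    obtain ⟨l, h1, rfl⟩ := hy
    obtain ⟨l', h2, rfl⟩ := hz
    exact ⟨l ++ l', path_append.2 ⟨base, h1, h2⟩, lval_append ..⟩
  | inv y _ hy =>
    obtain ⟨l, h1, rfl⟩ := hy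
    exact ⟨linv l, M.path_linv h1, lval_linv ..⟩

/-- Two representatives of one coset differ by an element of H, which is the value of a loop at the
basepoint. Back from v to the basepoint, around this loop and on to w is a path of trivial value,
hence closed. -/
theorem eq_of_path_of_cos_eq (hφ : ∀ i, Function.Injective (φ i))
    {l l' : List (Σ i, PresentedGroup (R i))} {v w : V} (hv : Path Step base l v)
    (hw : Path Step base l' w) (h : cos v = cos w) : v = w := by
  rw [M.cos_path_base hv, M.cos_path_base hw, eq_comm, coset_eq_iff] at h
  obtain ⟨l₀, h1, h2⟩ := M.exists_loop h
  refine M.eq_of_lval_eq_one hφ (l := linv l ++ (l₀ ++ l'))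
    (path_append.2 ⟨base, M.path_linv hv, path_append.2 ⟨base, h1, hw⟩⟩) ?_
  simp [h2]

/-- Different vertices are different cosets. -/
theorem cos_injective (hφ : ∀ i, Function.Injective (φ i))
    {s t : Σ i, PresentedGroup (R i)} {v v' w w' : V} (hv : Step v s v') (hw : Step w t w')
    (h : cos v = cos w) : v = w := by
  obtain ⟨l, hl⟩ := M.conn hv
  obtain ⟨l', hl'⟩ := M.conn hw
  exact M.eq_of_path_of_cos_eq hφ hl hl' h

/-- Every reduced word whose value lies in the subgroup labels a loop. -/
theorem path_of_mem (hφ : ∀ i, Function.Injective (φ i))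
    {l : List (Σ i, PresentedGroup (R i))}
    (hl : IsRed φ l ∨ ∃ s, l = [s]) (h : lval φ l ∈ generated φ hs) :
    Path Step base l base := by
  -- A single syllable may lie in A, where reduced words give nothing. Both factors act at the
  -- basepoint, so the step exists, and its end has the coset of the basepoint.
  have single : ∀ s, lval φ [s] ∈ generated φ hs → Path Step base [s] base := by
    rintro ⟨i, g⟩ hs
    obtain ⟨v, hv⟩ := M.total (M.base_live i) g
    have hv' := path_singleton.2 hv
    have : base = v := M.eq_of_path_of_cos_eq hφ (l := []) rfl hv'
      (by rw [M.cos_path_base hv', M.cos_base, eq_comm, coset_eq_one_iff]; exact hs)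
    rwa [← this] at hv'
  rcases hl with hl | ⟨s, rfl⟩
  · obtain ⟨l₀, h1, h2⟩ := M.exists_loop h
    obtain ⟨l', p1, p2, p3⟩ := M.exists_red h1
    rcases p3 with hr | ⟨i, a, rfl⟩
    · exact M.path_of_isRed hφ p1 hl hr (by rw [p2, h2])
    · obtain rfl := hl.eq_nil hφ (by
        rw [← h2, ← p2]; simp [Monoid.PushoutI.of_apply_eq_base])
      rfl
  · exact single s h

/-- The edges of normal paths lie in the marked orbits. -/
theorem marked_of_traversed (hφ : ∀ i, Function.Injective (φ i))
    {v w : Quotient (QuotientGroup.rightRel (generated φ hs))} {x : Letter X}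
    (h : Traversed φ _ v x w) : ∃ c d, v = cos c ∧ w = cos d ∧ Step c (letterElt R x) d ∧
      Marked φ Step base x.1.1 c := by
  obtain ⟨p, q, hn, rfl, rfl, hH⟩ := traversed_iff.1 h
  obtain ⟨l₁, l₂, g₁, g₂, hp, hq, hr⟩ := hn.split hφ
  have hval : wordVal φ (p ++ x :: q) =
      lval φ (l₁ ++ ⟨x.1.1, g₁ * letterG R x * g₂⟩ :: l₂) := by
    rw [wordVal_append, wordVal_cons, hp, hq, letterVal_eq]
    simp [mul_assoc]
  rw [hval] at hH
  have hpath := M.path_of_mem hφ (hr.imp id (by rintro ⟨rfl, rfl, -⟩; exact ⟨_, rfl⟩)) hH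
  obtain ⟨d, h1, d', h2, h3⟩ := path_append.1 hpath
  -- The letter x sits inside a syllable with value `g₁ * letterG R x * g₂`. The factor acts on the
  -- whole orbit of d, so the vertex c at which x starts belongs to the model.
  obtain ⟨c, hc⟩ := M.total h2 g₁
  have hc' := M.inv hc
  obtain ⟨c', hx⟩ := M.total hc' (letterG R x)
  have hcc : cos c = coset φ _ (wordVal φ p) := by
    rw [M.cos_step hc (M.cos_path_base h1), hp]
  refine ⟨c, c', hcc.symm, ?_, hx, ?_⟩
  · rw [M.cos_step hx hcc, letterVal_eq]
  rcases hr with hr | ⟨rfl, rfl, hne⟩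
  -- The part of the loop after the syllable, read backwards, is a reduced path from the basepoint
  -- to `d'`.
  · rw [isRed_append] at hr
    refine .inl ⟨_, _, d, d', hc', h2, hr.2.1.2 ⟨_, _⟩ (by simp),
      enters_of_path h1 hr.1 fun s hs => hr.2.2 s hs _ rfl,
      enters_of_path (M.path_linv h3) hr.2.1.tail.linv fun s hs => ?_⟩
    have := hr.2.1.1
    rw [List.isChain_cons] at this
    simp only [linv, List.getLast?_reverse, List.head?_map, Option.mem_def,
      Option.map_eq_some_iff] at hs
    obtain ⟨y, hy, rfl⟩ := hs
    exact (this.1 y hy).symm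
  · obtain rfl : base = d := h1
    obtain rfl : d' = base := h3
    exact .inr ⟨_, _, hc', h2, hne⟩

/-- The marked orbits are covered by normal paths, in which a subword in the letters of the
factor can be prescribed. -/
theorem exists_normal_of_marked (hφ : ∀ i, Function.Injective (φ i)) {c : V} {j : Fin 2}
    (h : Marked φ Step base j c) {u : List (Letter X)} (hu : ∀ x ∈ u, x.1.1 = j) :
    ∃ p q, IsNormalWord φ (p ++ u ++ q) ∧ cos c = coset φ _ (wordVal φ p) ∧
      wordVal φ (p ++ u ++ q) ∈ generated φ hs := by
  obtain ⟨r, hr⟩ := exists_spells_of_forall (φ := φ) hu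
  -- Both kinds of marks give a loop through the orbit: a path to d, the syllable g, and the inverse
  -- of a path to `d'`. For a mark by a loop at the basepoint the two paths are empty.
  obtain ⟨k, g, l₁, l₂, d, d', h1, h2, h3, h4, hred⟩ : ∃ k g l₁ l₂ d d',
      Path Step base l₁ d ∧ Step c ⟨j, k⟩ d ∧ Step d ⟨j, g⟩ d' ∧ Path Step d' l₂ base ∧
      (IsRed φ (l₁ ++ ⟨j, g⟩ :: l₂) ∨ l₁ = [] ∧ l₂ = [] ∧ g ≠ 1) := by
    rcases h with ⟨k, g, d, d', h1, h2, hg, h3, h4⟩ | ⟨k, g, h1, h2, hg⟩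
    · obtain ⟨l₁, p1, r1, e1⟩ := h3.exists_path
      obtain ⟨l₂, p2, r2, e2⟩ := h4.exists_path
      refine ⟨k, g, l₁, linv l₂, d, d', p1, h1, h2, M.path_linv p2, .inl ?_⟩
      refine isRed_append.2 ⟨r1, ⟨r2.linv.1.cons fun y hy => ?_, ?_⟩, by simpa using e1⟩
      · simp only [linv, List.head?_reverse, List.getLast?_map, Option.mem_def,
          Option.map_eq_some_iff] at hy
        obtain ⟨z, hz, rfl⟩ := hy
        exact (e2 z hz).symm
      · intro s hs
        rcases List.mem_cons.1 hs with rfl | hs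
        exacts [hg, r2.linv.2 s hs]
    · exact ⟨k, g, [], [], base, base, rfl, h1, h2, rfl, .inr ⟨rfl, rfl, hg⟩⟩
  -- The syllable g is spelled as a detour that goes from d to c by the inverse of k, then reads u
  -- with value r, and then returns so that the total value is g.
  obtain ⟨y₁, hy₁⟩ := exists_spells φ ⟨j, k⁻¹⟩
  obtain ⟨y₂, hy₂⟩ := exists_spells φ ⟨j, r⁻¹ * k * g⟩
  have hsp : Spells φ (y₁ ++ u ++ y₂) ⟨j, g⟩ := by
    have := (hy₁.append hr).append hy₂
    convert this using 2
    group
  refine ⟨(l₁.map (spell φ)).flatten ++ y₁, y₂ ++ (l₂.map (spell φ)).flatten, ?_, ?_, ?_⟩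
  · have := isNormalWord_of_isRed hφ hsp hred
    simpa using this
  · rw [wordVal_append, wordVal_flatten_spell, hy₁.2]
    exact M.cos_step (M.inv h2) (M.cos_path_base h1)
  · have : wordVal φ ((l₁.map (spell φ)).flatten ++ y₁ ++ u ++
        (y₂ ++ (l₂.map (spell φ)).flatten)) = lval φ (l₁ ++ ⟨j, g⟩ :: l₂) := by
      have hv := hsp.2
      simp only [wordVal_append] at hv
      simp only [wordVal_append, wordVal_flatten_spell, lval_append, lval_cons, ← hv, mul_assoc]
    rw [this, ← coset_eq_one_iff, ← M.cos_path_base (l := l₁ ++ ⟨j, g⟩ :: l₂)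
      (path_append.2 ⟨d, h1, d', h3, h4⟩), M.cos_base]

theorem traversed_of_marked (hφ : ∀ i, Function.Injective (φ i)) {c d : V} {x : Letter X}
    (h : Marked φ Step base x.1.1 c) (hx : Step c (letterElt R x) d) :
    Traversed φ _ (cos c) x (cos d) := by
  obtain ⟨p, q, h1, h2, h3⟩ := M.exists_normal_of_marked hφ h (u := [x]) (by simp)
  refine traversed_iff.2 ⟨p, q, by simpa using h1, h2, ?_, by simpa using h3⟩
  rw [M.cos_step hx h2, letterVal_eq]

/-- The inverse edges that the definition of the core adds need no separate description, because
marks are constant on orbits and steps are invertible. -/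
theorem edge_iff (hφ : ∀ i, Function.Injective (φ i))
    {v w : Quotient (QuotientGroup.rightRel (generated φ hs))} {x : Letter X} :
    (normalCore φ (generated φ hs)).edge v x w ↔ ∃ c d, v = cos c ∧ w = cos d ∧
      Step c (letterElt R x) d ∧ Marked φ Step base x.1.1 c := by
  constructor
  · rintro (h | h)
    · exact M.marked_of_traversed hφ h
    · obtain ⟨c, d, rfl, rfl, h1, h2⟩ := M.marked_of_traversed hφ h
      rw [letterElt_letterInv] at h1
      refine ⟨d, c, rfl, rfl, ?_, M.marked_step h2 h1⟩
      have := M.inv h1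
      rwa [inv_inv] at this
  · rintro ⟨c, d, rfl, rfl, h1, h2⟩
    exact .inl (M.traversed_of_marked hφ h2 h1)

theorem mem_verts_iff (hφ : ∀ i, Function.Injective (φ i))
    {v : Quotient (QuotientGroup.rightRel (generated φ hs))} :
    v ∈ (normalCore φ (generated φ hs)).verts ↔
      ∃ c, v = cos c ∧ (c = base ∨ ∃ j, Marked φ Step base j c) := by
  constructor
  · intro h
    rcases essential_cases h with rfl | ⟨x, w, h | h⟩
    · exact ⟨base, M.cos_base.symm, .inl rfl⟩
    · obtain ⟨c, d, rfl, -, -, h⟩ := M.marked_of_traversed hφ h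
      exact ⟨c, rfl, .inr ⟨_, h⟩⟩
    · obtain ⟨c, d, -, rfl, h1, h⟩ := M.marked_of_traversed hφ h
      exact ⟨d, rfl, .inr ⟨_, M.marked_step h h1⟩⟩
  · rintro ⟨c, rfl, rfl | ⟨j, h⟩⟩
    · rw [M.cos_base]
      exact (normalCore φ (generated φ hs)).base_mem
    · obtain ⟨p, q, h1, h2, h3⟩ := M.exists_normal_of_marked hφ h (u := []) (by simp)
      exact essential_iff.2 ⟨p, q, by simpa using h1, h2, by simpa using h3⟩

end IsCoreModel

end Core

end AmalgamMembership

namespace AmalgamMembership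

/-! ### Folding -/

section Folding

variable {X : Fin 2 → Type*} {R : ∀ i, Set (FreeGroup (X i))} {A : Type*} [Group A]
  (φ : ∀ i, A →* PresentedGroup (R i))

/-- The labels of the edges that are folded: the elements of the factors and those of `A`. -/
abbrev FoldLabel (R : ∀ i, Set (FreeGroup (X i))) (A : Type*) := (Σ i, PresentedGroup (R i)) ⊕ A

/-- An edge pattern: a source `g` in a factor and the element by which it is multiplied. -/
abbrev Pattern (R : ∀ i, Set (FreeGroup (X i))) (A : Type*) :=
  Σ i, PresentedGroup (R i) × (PresentedGroup (R i) ⊕ A)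

/-- The source of an edge pattern. -/
def Pattern.src (r : Pattern R A) : Σ i, PresentedGroup (R i) := ⟨r.1, r.2.1⟩

/-- The label of an edge pattern. -/
def Pattern.lbl (r : Pattern R A) : FoldLabel R A := r.2.2.map (fun k => ⟨r.1, k⟩) id

/-- The target of an edge pattern. -/
def Pattern.tgt (r : Pattern R A) : Σ i, PresentedGroup (R i) :=
  ⟨r.1, r.2.1 * r.2.2.elim id (φ r.1)⟩

/-- The element of the amalgam given by a label. -/
def lblVal : FoldLabel R A → Monoid.PushoutI φ :=
  Sum.elim (fun s => Monoid.PushoutI.of s.1 s.2) (Monoid.PushoutI.base φ)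

theorem Pattern.of_tgt (r : Pattern R A) :
    (Monoid.PushoutI.of (r.tgt φ).1 (r.tgt φ).2 : Monoid.PushoutI φ) =
      Monoid.PushoutI.of r.src.1 r.src.2 * lblVal φ r.lbl := by
  obtain ⟨i, g, k | a⟩ := r
  · exact map_mul (Monoid.PushoutI.of (φ := φ) i) g k
  · exact (map_mul (Monoid.PushoutI.of (φ := φ) i) g (φ i a)).trans
      (congrArg _ (Monoid.PushoutI.of_apply_eq_base φ i a))

/-- A prefix of the product of the words `hs` that consists of complete words has length `t`. -/
def IsBoundary (hs : List (List (Letter X))) (t : ℕ) : Prop :=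
  ∃ pre post, hs = pre ++ post ∧ t = pre.flatten.length

/-- The coset that belongs to the element `s` of a factor over the prefix of length `t` of the
product of the words `hs`. -/
def nodeVal (hs : List (List (Letter X))) (t : ℕ) (s : Σ i, PresentedGroup (R i)) :
    Quotient (QuotientGroup.rightRel (generated φ hs)) :=
  coset φ _ (wordVal φ (hs.flatten.take t) * Monoid.PushoutI.of s.1 s.2)

variable {φ} {hs : List (List (Letter X))}

theorem nodeVal_base (t : ℕ) (i j : Fin 2) (a : A) :
    nodeVal φ hs t ⟨i, φ i a⟩ = nodeVal φ hs t ⟨j, φ j a⟩ := by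
  simp [nodeVal, Monoid.PushoutI.of_apply_eq_base]

theorem wordVal_take_succ {u : List (Letter X)} {t : ℕ} (ht : t < u.length) :
    wordVal φ (u.take (t + 1)) = wordVal φ (u.take t) * letterVal φ u[t] := by
  rw [List.take_add_one, wordVal_append, List.getElem?_eq_getElem ht]
  simp

theorem nodeVal_letter {t : ℕ} (ht : t < hs.flatten.length) (i : Fin 2) :
    nodeVal φ hs t (letterElt R hs.flatten[t]) = nodeVal φ hs (t + 1) ⟨i, 1⟩ := by
  simp only [nodeVal, wordVal_take_succ ht, letterVal_eq, map_one, mul_one]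

theorem wordVal_flatten_mem : ∀ {pre : List (List (Letter X))}, (∀ h ∈ pre, h ∈ hs) →
    wordVal φ pre.flatten ∈ generated φ hs := by
  intro pre
  induction pre with
  | nil => exact fun _ => one_mem _
  | cons h pre ih =>
    intro hp
    rw [List.flatten_cons, wordVal_append]
    exact mul_mem (Subgroup.subset_closure ⟨h, hp h (by simp), rfl⟩)
      (ih fun h' hh' => hp h' (by simp [hh']))

/-- The prefix is a product of complete generators, so its value lies in H. -/
theorem nodeVal_boundary {t : ℕ} (ht : IsBoundary hs t) (i j : Fin 2) :
    nodeVal φ hs t ⟨i, 1⟩ = nodeVal φ hs 0 ⟨j, 1⟩ := by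
  obtain ⟨pre, post, h, rfl⟩ := ht
  have : hs.flatten.take pre.flatten.length = pre.flatten := by
    rw [h, List.flatten_append, List.take_left']
    rfl
  simp only [nodeVal, this, map_one, mul_one, List.take_zero, wordVal_nil]
  rw [coset_eq_one_iff]
  exact wordVal_flatten_mem fun h' hh' => h ▸ List.mem_append_left _ hh'

theorem nodeVal_tgt {t t' : ℕ} {r r' : Pattern R A} (hr : r.lbl = r'.lbl)
    (h : nodeVal φ hs t r.src = nodeVal φ hs t' r'.src) :
    nodeVal φ hs t (r.tgt φ) = nodeVal φ hs t' (r'.tgt φ) := by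
  simp only [nodeVal, Pattern.of_tgt, hr, ← mul_assoc]
  exact coset_mul_congr h _

variable (φ hs) in
/-- Only nodes that belong to the same coset have the same label. -/
def IsSound (lab : ℕ → (Σ i, PresentedGroup (R i)) → ℕ) : Prop :=
  ∀ t ≤ hs.flatten.length, ∀ t' ≤ hs.flatten.length, ∀ s s', lab t s = lab t' s' →
    nodeVal φ hs t s = nodeVal φ hs t' s'

variable (φ hs) in
/-- The label `b` can be replaced by the label `c`. -/
def Mergeable (lab : ℕ → (Σ i, PresentedGroup (R i)) → ℕ) (b c : ℕ) : Prop :=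
  ∃ t ≤ hs.flatten.length, ∃ t' ≤ hs.flatten.length, ∃ s s', lab t s = b ∧ lab t' s' = c ∧
    nodeVal φ hs t s = nodeVal φ hs t' s'

/-- A merge joins two classes of nodes. Each class lies over a single coset, and one node of each is
known to lie over the same coset. -/
theorem IsSound.merge {lab : ℕ → (Σ i, PresentedGroup (R i)) → ℕ} {b c : ℕ}
    (h : IsSound φ hs lab) (hbc : Mergeable φ hs lab b c) :
    IsSound φ hs fun t s => if lab t s = b then c else lab t s := by
  obtain ⟨t₁, h₁, t₂, h₂, s₁, s₂, rfl, rfl, he⟩ := hbc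
  intro t ht t' ht' s s' hss
  dsimp only at hss
  split_ifs at hss with h3 h4 h4
  · exact h t ht t' ht' s s' (by rw [h3, h4])
  · rw [h t ht t₁ h₁ s s₁ h3, he, h t₂ h₂ t' ht' _ _ hss]
  · rw [h t ht t₂ h₂ _ _ hss, ← he, h t₁ h₁ t' ht' _ _ h4.symm]
  · exact h t ht t' ht' s s' hss

variable (φ hs) in
/-- The labels of the nodes are those of a folded graph. -/
structure IsFolded (lab : ℕ → (Σ i, PresentedGroup (R i)) → ℕ) : Prop where
  sound : IsSound φ hs lab
  base_eq : ∀ t ≤ hs.flatten.length, ∀ a, lab t ⟨0, φ 0 a⟩ = lab t ⟨1, φ 1 a⟩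
  letter_eq : ∀ t, ∀ ht : t < hs.flatten.length,
    lab t (letterElt R hs.flatten[t]) = lab (t + 1) ⟨0, 1⟩
  boundary_eq : ∀ t, IsBoundary hs t → lab t ⟨0, 1⟩ = lab 0 ⟨0, 1⟩
  det : ∀ t ≤ hs.flatten.length, ∀ t' ≤ hs.flatten.length, ∀ r r' : Pattern R A,
    r.lbl = r'.lbl → lab t r.src = lab t' r'.src → lab t (r.tgt φ) = lab t' (r'.tgt φ)

/-- The partial action of the factors on the labels. -/
def LabStep (hs : List (List (Letter X))) (lab : ℕ → (Σ i, PresentedGroup (R i)) → ℕ)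
    (c : ℕ) (s : Σ i, PresentedGroup (R i)) (d : ℕ) : Prop :=
  ∃ t ≤ hs.flatten.length, ∃ g, lab t ⟨s.1, g⟩ = c ∧ lab t ⟨s.1, g * s.2⟩ = d

open Classical in
variable (φ hs) in
/-- The coset that belongs to a label. -/
noncomputable def labCoset (lab : ℕ → (Σ i, PresentedGroup (R i)) → ℕ) (c : ℕ) :
    Quotient (QuotientGroup.rightRel (generated φ hs)) :=
  if h : ∃ p : ℕ × Σ i, PresentedGroup (R i), p.1 ≤ hs.flatten.length ∧ lab p.1 p.2 = c then
    nodeVal φ hs h.choose.1 h.choose.2 else coset φ _ 1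

/-! ### The partial action given by a folded labelling -/

namespace IsFolded

variable {lab : ℕ → (Σ i, PresentedGroup (R i)) → ℕ} (h : IsFolded φ hs lab)
include h

theorem labCoset_lab {t : ℕ} (ht : t ≤ hs.flatten.length) (s : Σ i, PresentedGroup (R i)) :
    labCoset φ hs lab (lab t s) = nodeVal φ hs t s := by
  have he : ∃ p : ℕ × Σ i, PresentedGroup (R i), p.1 ≤ hs.flatten.length ∧
      lab p.1 p.2 = lab t s := ⟨(t, s), ht, rfl⟩
  rw [labCoset, dif_pos he]
  exact h.sound _ he.choose_spec.1 t ht _ _ he.choose_spec.2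

theorem lab_base_eq {t : ℕ} (ht : t ≤ hs.flatten.length) (i j : Fin 2) (a : A) :
    lab t ⟨i, φ i a⟩ = lab t ⟨j, φ j a⟩ := by
  have : ∀ i, lab t ⟨i, φ i a⟩ = lab t ⟨0, φ 0 a⟩ := by
    intro i
    match i with
    | 0 => rfl
    | 1 => exact (h.base_eq t ht a).symm
  rw [this i, this j]

theorem lab_one_eq {t : ℕ} (ht : t ≤ hs.flatten.length) (i j : Fin 2) :
    lab t ⟨i, 1⟩ = lab t ⟨j, 1⟩ := by
  simpa using h.lab_base_eq ht i j 1

theorem det_mul {t t' : ℕ} (ht : t ≤ hs.flatten.length) (ht' : t' ≤ hs.flatten.length) {i : Fin 2}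
    {g g' : PresentedGroup (R i)} (he : lab t ⟨i, g⟩ = lab t' ⟨i, g'⟩) (k : PresentedGroup (R i)) :
    lab t ⟨i, g * k⟩ = lab t' ⟨i, g' * k⟩ :=
  h.det t ht t' ht' ⟨i, g, .inl k⟩ ⟨i, g', .inl k⟩ rfl he

/-- A node comes with a full copy of its factor, which gives totality and inverses. Determinism of
labels from a factor makes the steps well defined on labels. Compatibility on A is determinism for
the labels from A, which do not remember the factor. -/
theorem isPrecover : IsPrecover φ (LabStep hs lab) where
  det := by
    rintro _ ⟨i, k⟩ _ _ ⟨t, ht, g, rfl, rfl⟩ ⟨t', ht', g', he, rfl⟩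
    exact h.det_mul ht ht' he.symm k
  one := by
    rintro _ i k _ ⟨t, ht, g, rfl, rfl⟩
    exact ⟨t, ht, g, rfl, by simp⟩
  total := by
    rintro _ i k _ ⟨t, ht, g, rfl, rfl⟩ k'
    exact ⟨_, t, ht, g, rfl, rfl⟩
  mul := by
    rintro _ i k _ k' _ ⟨t, ht, g, rfl, rfl⟩ ⟨t', ht', g', he, rfl⟩
    refine ⟨t, ht, g, rfl, ?_⟩
    dsimp only at he ⊢
    rw [← mul_assoc]
    exact h.det_mul ht ht' he.symm k'
  inv := by
    rintro _ i k _ ⟨t, ht, g, rfl, rfl⟩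
    exact ⟨t, ht, g * k, rfl, by simp⟩
  amalg := by
    rintro _ i j a _ _ ⟨t, ht, g, rfl, rfl⟩ ⟨t', ht', g', he, rfl⟩
    exact h.det t ht t' ht' ⟨i, g, .inr a⟩ ⟨j, g', .inr a⟩ rfl he.symm

theorem exists_path {t : ℕ} (ht : t ≤ hs.flatten.length) :
    ∃ l, Path (LabStep hs lab) (lab 0 ⟨0, 1⟩) l (lab t ⟨0, 1⟩) ∧
      lval φ l = wordVal φ (hs.flatten.take t) := by
  induction t with
  | zero => exact ⟨[], rfl, rfl⟩
  | succ t ih =>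
    obtain ⟨l, h1, h2⟩ := ih (Nat.le_of_succ_le ht)
    refine ⟨l ++ [letterElt R hs.flatten[t]], path_append.2 ⟨_, h1, path_singleton.2 ?_⟩, ?_⟩
    · refine ⟨t, Nat.le_of_succ_le ht, 1, h.lab_one_eq (Nat.le_of_succ_le ht) _ _, ?_⟩
      rw [one_mul]
      exact h.letter_eq t ht
    · rw [wordVal_take_succ ht, lval_append, h2, letterVal_eq]
      simp

theorem isCoreModel :
    IsCoreModel φ hs (LabStep hs lab) (lab 0 ⟨0, 1⟩) (labCoset φ hs lab) where
  toIsPrecover := h.isPrecover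
  base_live i := by
    have := h.lab_one_eq (Nat.zero_le _) i 0
    exact ⟨0, Nat.zero_le _, 1, this, by simpa using this⟩
  cos_base := by
    rw [h.labCoset_lab (Nat.zero_le _)]
    simp [nodeVal]
  cos_step := by
    rintro _ ⟨i, k⟩ _ g ⟨t, ht, g', rfl, rfl⟩ hc
    rw [h.labCoset_lab ht] at hc ⊢
    have := coset_mul_congr hc (Monoid.PushoutI.of i k)
    simpa [nodeVal, mul_assoc] using this
  conn := by
    rintro _ ⟨i, k⟩ _ ⟨t, ht, g, rfl, rfl⟩
    obtain ⟨l, h1, -⟩ := h.exists_path ht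
    refine ⟨l ++ [⟨i, g⟩], path_append.2 ⟨_, h1, path_singleton.2 ?_⟩⟩
    exact ⟨t, ht, 1, h.lab_one_eq ht _ _, by simp⟩
  gen := by
    intro u hu
    obtain ⟨pre, post, hp⟩ := List.append_of_mem hu
    -- The path along a product of complete generators is closed. A generator is the quotient of two
    -- consecutive such products.
    have key : ∀ pre post, hs = pre ++ post →
        ∃ l, Path (LabStep hs lab) (lab 0 ⟨0, 1⟩) l (lab 0 ⟨0, 1⟩) ∧
          lval φ l = wordVal φ pre.flatten := by
      intro pre post hp
      have hlen : pre.flatten.length ≤ hs.flatten.length := by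
        rw [hp, List.flatten_append, List.length_append]; exact Nat.le_add_right _ _
      obtain ⟨l, h1, h2⟩ := h.exists_path hlen
      rw [h.boundary_eq _ ⟨pre, post, hp, rfl⟩] at h1
      refine ⟨l, h1, ?_⟩
      rw [h2]
      congr 1
      rw [hp, List.flatten_append, List.take_left']
      rfl
    obtain ⟨l, h1, h2⟩ := key pre _ hp
    obtain ⟨l', h3, h4⟩ := key (pre ++ [u]) post (by simpa using hp)
    refine ⟨linv l ++ l', path_append.2 ⟨_, h.isPrecover.path_linv h1, h3⟩, ?_⟩
    simp [h2, h4]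

end IsFolded

end Folding

end AmalgamMembership

namespace AmalgamMembership

/-! ### Reasoning about programs -/

@[simp] theorem Store.reg_setReg (σ : Store) (r k r' : ℕ) :
    (σ.setReg r k).reg r' = if r' = r then k else σ.reg r' := by
  simp [Store.setReg, Function.update_apply]

@[simp] theorem Store.arr_setReg (σ : Store) (r k : ℕ) : (σ.setReg r k).arr = σ.arr := rfl

@[simp] theorem Store.reg_setArr (σ : Store) (a i k : ℕ) : (σ.setArr a i k).reg = σ.reg := rfl

theorem Store.arr_setArr (σ : Store) (a i k a' : ℕ) :
    (σ.setArr a i k).arr a' = if a' = a then Function.update (σ.arr a) i k else σ.arr a' := by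
  simp [Store.setArr, Function.update_apply]

@[simp] theorem Store.arr_setArr_self (σ : Store) (a i k : ℕ) :
    (σ.setArr a i k).arr a = Function.update (σ.arr a) i k := by
  simp [Store.arr_setArr]

theorem Store.arr_setArr_of_ne (σ : Store) {a a' : ℕ} (h : a' ≠ a) (i k : ℕ) :
    (σ.setArr a i k).arr a' = σ.arr a' := by
  simp [Store.arr_setArr, h]

theorem Store.arr_setArr_apply (σ : Store) (a i k a' j : ℕ) :
    (σ.setArr a i k).arr a' j = if a' = a ∧ j = i then k else σ.arr a' j := by
  by_cases h : a' = a
  · subst h; simp [Function.update_apply]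
  · simp [Store.arr_setArr_of_ne, h]

attribute [simp] Expr.eval

/-- A test for inequality. -/
def neq (e f : Expr) : Expr := .add (.sub e f) (.sub f e)

@[simp] theorem eval_neq (σ : Store) (e f : Expr) :
    (neq e f).eval σ = 0 ↔ e.eval σ = f.eval σ := by
  simp only [neq, Expr.eval]
  omega

namespace Prog

/-- The program that does nothing. -/
def skip : Prog := .assign 0 (.reg 0)

/-- The program does not change register `r`. -/
def KeepsReg : Prog → ℕ → Prop
  | .assign r' e, r => r' ≠ r ∨ e = .reg r'
  | .store _ _ _, _ => True
  | .seq P Q, r => P.KeepsReg r ∧ Q.KeepsReg r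
  | .ite _ P Q, r => P.KeepsReg r ∧ Q.KeepsReg r
  | .while _ P, r => P.KeepsReg r

/-- The program does not write into array `a`. -/
def KeepsArr : Prog → ℕ → Prop
  | .assign _ _, _ => True
  | .store a' _ _, a => a' ≠ a
  | .seq P Q, a => P.KeepsArr a ∧ Q.KeepsArr a
  | .ite _ P Q, a => P.KeepsArr a ∧ Q.KeepsArr a
  | .while _ P, a => P.KeepsArr a

def LoopFree : Prog → Prop
  | .assign _ _ => True
  | .store _ _ _ => True
  | .seq P Q => P.LoopFree ∧ Q.LoopFree
  | .ite _ P Q => P.LoopFree ∧ Q.LoopFree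
  | .while _ _ => False

/-- The effect of a program without loops. -/
def run : Prog → Store → Store
  | .assign r e, σ => σ.setReg r (e.eval σ)
  | .store a i e, σ => σ.setArr a (i.eval σ) (e.eval σ)
  | .seq P Q, σ => Q.run (P.run σ)
  | .ite c P Q, σ => if c.eval σ = 0 then Q.run σ else P.run σ
  | .while _ _, σ => σ

/-- A bound for the running time of a program without loops. -/
def bound : Prog → ℕ
  | .assign _ e => e.cost + 1
  | .store _ i e => i.cost + e.cost + 1
  | .seq P Q => P.bound + Q.bound
  | .ite c P Q => c.cost + 1 + (P.bound + Q.bound)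
  | .while _ _ => 0

theorem LoopFree.exec {P : Prog} (h : P.LoopFree) (σ : Store) :
    ∃ t ≤ P.bound, Exec P σ (P.run σ) t := by
  induction P generalizing σ with
  | assign r e => exact ⟨_, le_rfl, .assign r e σ⟩
  | store a i e => exact ⟨_, le_rfl, .store a i e σ⟩
  | seq P Q ihP ihQ =>
    obtain ⟨s, hs, h1⟩ := ihP h.1 σ
    obtain ⟨t, ht, h2⟩ := ihQ h.2 (P.run σ)
    exact ⟨s + t, Nat.add_le_add hs ht, h1.seq h2⟩
  | ite c P Q ihP ihQ =>
    by_cases hc : c.eval σ = 0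
    · obtain ⟨t, ht, h2⟩ := ihQ h.2 σ
      refine ⟨c.cost + 1 + t, by simp only [bound]; omega, ?_⟩
      simpa [run, hc] using Exec.ite_false hc h2
    · obtain ⟨t, ht, h2⟩ := ihP h.1 σ
      refine ⟨c.cost + 1 + t, by simp only [bound]; omega, ?_⟩
      simpa [run, hc] using Exec.ite_true hc h2
  | _ => exact h.elim

/-- The stores agree on the registers and arrays that are not changed by `P`. -/
structure Frame (P : Prog) (σ τ : Store) : Prop where
  reg : ∀ r, P.KeepsReg r → τ.reg r = σ.reg r
  arr : ∀ a, P.KeepsArr a → τ.arr a = σ.arr a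

theorem Frame.refl (P : Prog) (σ : Store) : P.Frame σ σ := ⟨fun _ _ => rfl, fun _ _ => rfl⟩

theorem Frame.trans {P : Prog} {σ τ υ : Store} (h : P.Frame σ τ) (h' : P.Frame τ υ) :
    P.Frame σ υ :=
  ⟨fun r hr => (h'.reg r hr).trans (h.reg r hr), fun a ha => (h'.arr a ha).trans (h.arr a ha)⟩

theorem Frame.of_imp {P Q : Prog} {σ τ : Store} (h : P.Frame σ τ)
    (hr : ∀ r, Q.KeepsReg r → P.KeepsReg r) (ha : ∀ a, Q.KeepsArr a → P.KeepsArr a) :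
    Q.Frame σ τ :=
  ⟨fun r h' => h.reg r (hr r h'), fun a h' => h.arr a (ha a h')⟩

theorem frame_run (P : Prog) (σ : Store) : P.Frame σ (P.run σ) := by
  induction P generalizing σ with
  | assign r e =>
    refine ⟨?_, fun _ _ => rfl⟩
    rintro r' (h | rfl)
    · simp [run, h.symm]
    · simp +contextual [run]
  | store a i e =>
    exact ⟨fun _ _ => rfl, fun a' h => Store.arr_setArr_of_ne _ (Ne.symm h) _ _⟩
  | seq P Q ihP ihQ =>
    exact ((ihP σ).of_imp (Q := .seq P Q) (fun _ h => h.1) fun _ h => h.1).trans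
      ((ihQ _).of_imp (fun _ h => h.2) fun _ h => h.2)
  | ite c P Q ihP ihQ =>
    by_cases hc : c.eval σ = 0
    · simpa [run, hc] using (ihQ σ).of_imp (Q := .ite c P Q) (fun _ h => h.2) fun _ h => h.2
    · simpa [run, hc] using (ihP σ).of_imp (Q := .ite c P Q) (fun _ h => h.1) fun _ h => h.1
  | _ => exact .refl _ _

/-- What a program can change is read off from its text, loops included. Later claims that data
survive a phase thereby reduce to a check of the program text. -/
theorem _root_.AmalgamMembership.Exec.frame {P : Prog} {σ τ : Store} {t : ℕ}
    (h : Exec P σ τ t) : P.Frame σ τ := by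
  induction h with
  | assign r e σ => exact frame_run (.assign r e) σ
  | store a i e σ => exact frame_run (.store a i e) σ
  | @seq P Q _ _ _ _ _ _ _ ih₁ ih₂ =>
    exact (ih₁.of_imp (Q := .seq P Q) (fun _ h => h.1) fun _ h => h.1).trans
      (ih₂.of_imp (fun _ h => h.2) fun _ h => h.2)
  | ite_true _ _ ih => exact ih.of_imp (fun _ h => h.1) fun _ h => h.1
  | ite_false _ _ ih => exact ih.of_imp (fun _ h => h.2) fun _ h => h.2
  | while_done _ => exact .refl _ _
  | @while_step c P _ _ _ _ _ _ _ _ ih₁ ih₂ =>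
    exact (ih₁.of_imp (Q := .while c P) (fun _ h => h) fun _ h => h).trans ih₂

theorem run_reg {P : Prog} {r : ℕ} (h : P.KeepsReg r) (σ : Store) :
    (P.run σ).reg r = σ.reg r := (frame_run P σ).reg r h

theorem run_arr {P : Prog} {a : ℕ} (h : P.KeepsArr a) (σ : Store) :
    (P.run σ).arr a = σ.arr a := (frame_run P σ).arr a h

attribute [simp] LoopFree KeepsReg KeepsArr

@[simp] theorem run_assign (r : ℕ) (e : Expr) (σ : Store) :
    (Prog.assign r e).run σ = σ.setReg r (e.eval σ) := rfl

@[simp] theorem run_store (a : ℕ) (i e : Expr) (σ : Store) :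
    (Prog.store a i e).run σ = σ.setArr a (i.eval σ) (e.eval σ) := rfl

@[simp] theorem run_seq (P Q : Prog) (σ : Store) : (Prog.seq P Q).run σ = Q.run (P.run σ) := rfl

theorem run_ite (c : Expr) (P Q : Prog) (σ : Store) :
    (Prog.ite c P Q).run σ = if c.eval σ = 0 then Q.run σ else P.run σ := rfl

@[simp] theorem run_skip (σ : Store) : skip.run σ = σ := by
  obtain ⟨r, a⟩ := σ
  simp [skip, Store.setReg]

@[simp] theorem loopFree_skip : skip.LoopFree := trivial

@[simp] theorem keepsReg_skip (r : ℕ) : skip.KeepsReg r := .inr rfl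

@[simp] theorem keepsArr_skip (a : ℕ) : skip.KeepsArr a := trivial

/-- One program after the other. -/
def seqL : List Prog → Prog
  | [] => skip
  | P :: l => .seq P (seqL l)

@[simp] theorem loopFree_seqL_map {T : Type*} {l : List T} {f : T → Prog} :
    (seqL (l.map f)).LoopFree ↔ ∀ x ∈ l, (f x).LoopFree := by
  induction l with
  | nil => simp [seqL]
  | cons x l ih => simp [seqL, ih]

@[simp] theorem keepsReg_seqL_map {T : Type*} {l : List T} {f : T → Prog} {r : ℕ} :
    (seqL (l.map f)).KeepsReg r ↔ ∀ x ∈ l, (f x).KeepsReg r := by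
  induction l with
  | nil => simp [seqL]
  | cons x l ih => simp [seqL, ih]

@[simp] theorem keepsArr_seqL_map {T : Type*} {l : List T} {f : T → Prog} {a : ℕ} :
    (seqL (l.map f)).KeepsArr a ↔ ∀ x ∈ l, (f x).KeepsArr a := by
  induction l with
  | nil => simp [seqL]
  | cons x l ih => simp [seqL, ih]

/-- The effect of a family of programs that are run one after the other: an invariant `I`, and
properties `D x` that are established by the program with index `x` and kept by the others. -/
theorem run_seqL_map {T : Type*} {l : List T} {f : T → Prog} {σ : Store} (I : Store → Prop)
    (D : T → Store → Prop) (h0 : I σ)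
    (hI : ∀ x ∈ l, ∀ τ, I τ → I ((f x).run τ) ∧ D x ((f x).run τ))
    (hD : ∀ x ∈ l, ∀ y ∈ l, ∀ τ, I τ → D y τ → D y ((f x).run τ)) :
    I ((seqL (l.map f)).run σ) ∧ ∀ x ∈ l, D x ((seqL (l.map f)).run σ) := by
  have key : ∀ (l₁ l₂ : List T), l = l₁ ++ l₂ → ∀ τ, I τ → (∀ x ∈ l₁, D x τ) →
      I ((seqL (l₂.map f)).run τ) ∧ ∀ x ∈ l, D x ((seqL (l₂.map f)).run τ) := by
    intro l₁ l₂
    induction l₂ generalizing l₁ with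
    | nil =>
      rintro rfl τ hτ hD'
      simpa [seqL] using ⟨hτ, hD'⟩
    | cons x l₂ ih =>
      intro hl τ hτ hD'
      have hx : x ∈ l := by simp [hl]
      obtain ⟨h1, h2⟩ := hI x hx τ hτ
      refine ih (l₁ ++ [x]) (by simp [hl]) _ h1 ?_
      intro y hy
      rcases List.mem_append.1 hy with hy | hy
      · exact hD x hx y (by simp [hl, hy]) τ hτ (hD' y hy)
      · rw [List.mem_singleton.1 hy]
        exact h2
  exact key [] l rfl σ h0 (by simp)

/-- Selection of a program by the value of an expression. -/
def switch {T : Type*} (e : Expr) (enc : T → ℕ) (f : T → Prog) : List T → Prog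
  | [] => skip
  | x :: l => .ite (neq e (.const (enc x))) (switch e enc f l) (f x)

theorem run_switch {T : Type*} {e : Expr} {enc : T → ℕ} (henc : Function.Injective enc)
    {f : T → Prog} {l : List T} {σ : Store} {x : T} (hx : x ∈ l) (h : e.eval σ = enc x) :
    (switch e enc f l).run σ = (f x).run σ := by
  induction l with
  | nil => simp at hx
  | cons y l ih =>
    rw [switch, run_ite]
    simp only [eval_neq, Expr.eval, h]
    by_cases hxy : x = y
    · subst hxy; simp
    · rw [if_neg fun h => hxy (henc h)]
      exact ih (List.mem_of_ne_of_mem hxy hx)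

@[simp] theorem loopFree_switch {T : Type*} {e : Expr} {enc : T → ℕ} {f : T → Prog}
    {l : List T} : (switch e enc f l).LoopFree ↔ ∀ x ∈ l, (f x).LoopFree := by
  induction l with
  | nil => simp [switch]
  | cons y l ih => simp [switch, ih, and_comm]

@[simp] theorem keepsReg_switch {T : Type*} {e : Expr} {enc : T → ℕ} {f : T → Prog}
    {l : List T} {r : ℕ} : (switch e enc f l).KeepsReg r ↔ ∀ x ∈ l, (f x).KeepsReg r := by
  induction l with
  | nil => simp [switch]
  | cons y l ih => simp [switch, ih, and_comm]

@[simp] theorem keepsArr_switch {T : Type*} {e : Expr} {enc : T → ℕ} {f : T → Prog}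
    {l : List T} {a : ℕ} : (switch e enc f l).KeepsArr a ↔ ∀ x ∈ l, (f x).KeepsArr a := by
  induction l with
  | nil => simp [switch]
  | cons y l ih => simp [switch, ih, and_comm]

/-- The loop that runs `P` for the values `0, 1, …` of register `r` below that of register
`lim`. -/
def forLoop (r lim : ℕ) (P : Prog) : Prog :=
  .seq (.assign r (.const 0)) (.while (.sub (.reg lim) (.reg r))
    (.seq P (.assign r (.add (.reg r) (.const 1)))))

@[simp] theorem keepsReg_forLoop {r lim x : ℕ} {P : Prog} :
    (forLoop r lim P).KeepsReg x ↔ r ≠ x ∧ P.KeepsReg x := by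
  simp [forLoop, and_comm]

@[simp] theorem keepsArr_forLoop {r lim a : ℕ} {P : Prog} :
    (forLoop r lim P).KeepsArr a ↔ P.KeepsArr a := by
  simp [forLoop]

end Prog

/-! ### Total correctness with running times -/

open Prog

/-- Started in `σ`, the program halts after at most `T` steps in a store with property `Q`. -/
def Runs (P : Prog) (σ : Store) (T : ℕ) (Q : Store → Prop) : Prop :=
  ∃ τ t, Exec P σ τ t ∧ t ≤ T ∧ Q τ

namespace Runs

variable {P P' : Prog} {σ : Store} {T T' : ℕ} {Q Q' : Store → Prop}

theorem imp (h : Runs P σ T Q) (hT : T ≤ T') (hQ : ∀ τ, P.Frame σ τ → Q τ → Q' τ) :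
    Runs P σ T' Q' := by
  obtain ⟨τ, t, h1, h2, h3⟩ := h
  exact ⟨τ, t, h1, h2.trans hT, hQ τ h1.frame h3⟩

theorem of_run (h : P.LoopFree) (hQ : Q (P.run σ)) : Runs P σ P.bound Q := by
  obtain ⟨t, h1, h2⟩ := h.exec σ
  exact ⟨_, t, h2, h1, hQ⟩

theorem seq (h : Runs P σ T Q') (h' : ∀ τ, P.Frame σ τ → Q' τ → Runs P' τ T' Q) :
    Runs (.seq P P') σ (T + T') Q := by
  obtain ⟨τ, t, h1, h2, h3⟩ := h
  obtain ⟨υ, s, h4, h5, h6⟩ := h' τ h1.frame h3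
  exact ⟨υ, t + s, h1.seq h4, Nat.add_le_add h2 h5, h6⟩

/-- The index k is a measure that drops strictly in every round. So there are at most k rounds and k
+ 1 tests. -/
theorem whileLoop {c : Expr} {k : ℕ} (I : ℕ → Store → Prop) (h0 : I k σ)
    (hI : ∀ k τ, (Prog.while c P).Frame σ τ → I k τ → c.eval τ ≠ 0 →
      Runs P τ T fun υ => ∃ k' < k, I k' υ) :
    Runs (.while c P) σ ((k + 1) * (T + c.cost + 1)) fun τ => c.eval τ = 0 ∧ ∃ k', I k' τ := by
  have key : ∀ k τ, (Prog.while c P).Frame σ τ → I k τ →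
      Runs (.while c P) τ ((k + 1) * (T + c.cost + 1)) fun τ => c.eval τ = 0 ∧ ∃ k', I k' τ := by
    intro k
    induction k using Nat.strong_induction_on with
    | _ k ih =>
      intro τ hF hτ
      by_cases hc : c.eval τ = 0
      · exact ⟨τ, _, .while_done hc, by nlinarith, hc, k, hτ⟩
      · obtain ⟨υ, t, h1, h2, k', hk', h3⟩ := hI k τ hF hτ hc
        obtain ⟨ω, s, h4, h5, h6⟩ := ih k' hk' υ
          (hF.trans (h1.frame.of_imp (fun _ h => h) fun _ h => h)) h3
        refine ⟨ω, _, .while_step hc h1 h4, ?_, h6⟩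
        calc c.cost + 1 + t + s ≤ c.cost + 1 + T + (k' + 1) * (T + c.cost + 1) := by omega
          _ = (k' + 1 + 1) * (T + c.cost + 1) := by ring
          _ ≤ _ := Nat.mul_le_mul_right _ (by omega)
  exact key k σ (.refl _ _) h0

theorem forLoop {r lim n : ℕ} (hP : P.LoopFree) (hr : P.KeepsReg r) (hl : P.KeepsReg lim)
    (hne : lim ≠ r) (hn : σ.reg lim = n) (I : ℕ → Store → Prop) (h0 : I 0 (σ.setReg r 0))
    (hI : ∀ k < n, ∀ τ, (Prog.forLoop r lim P).Frame σ τ → τ.reg r = k → I k τ →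
      I (k + 1) ((P.run τ).setReg r (k + 1))) :
    Runs (Prog.forLoop r lim P) σ ((n + 1) * (P.bound + 10)) fun τ => I n τ := by
  have hF0 : (Prog.forLoop r lim P).Frame σ (σ.setReg r 0) :=
    (frame_run (.assign r (.const 0)) σ).of_imp (fun _ h => h.1) fun _ h => h.1
  -- The measure counts the rounds that are left, whereas I is indexed by the rounds that are done.
  let J : ℕ → Store → Prop := fun k τ => k ≤ n ∧ τ.reg r = n - k ∧ τ.reg lim = n ∧ I (n - k) τ
  have hw := whileLoop (c := .sub (.reg lim) (.reg r)) (T := P.bound + 4) (k := n)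
    (P := .seq P (.assign r (.add (.reg r) (.const 1)))) (σ := σ.setReg r 0) J
    ⟨le_rfl, by simp, by simp [hne, hn], by simpa using h0⟩ (by
      rintro k τ hF ⟨hk, h1, h2, h3⟩ hc
      simp only [Expr.eval, h1, h2] at hc
      have := (of_run (P := .seq P (.assign r (.add (.reg r) (.const 1)))) (σ := τ)
        (Q := fun υ => ∃ k' < k, J k' υ) ⟨hP, trivial⟩ ?_)
      · exact this
      have hrun : (Prog.seq P (.assign r (.add (.reg r) (.const 1)))).run τ =
          (P.run τ).setReg r (n - k + 1) := by
        simp [run_reg hr, h1]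
      rw [hrun]
      have hstep := hI (n - k) (by omega) τ
        (hF0.trans (hF.of_imp (fun _ h => h.2) fun _ h => h.2)) h1 h3
      refine ⟨k - 1, by omega, by omega, ?_, ?_, ?_⟩
      · simp only [Store.reg_setReg, if_true]; omega
      · simp [hne, run_reg hl, h2]
      · rwa [show n - (k - 1) = n - k + 1 by omega])
  obtain ⟨τ, t, h1, h2, hc, k, h3, h4, h5, h6⟩ := hw
  refine ⟨τ, _, (Exec.assign r (.const 0) σ).seq h1, ?_, ?_⟩
  -- The summand 10 per round consists of 4 for the increment, 4 for the test, and 2 that pay for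
  -- the initial assignment.
  · simp only [Expr.cost] at h2 ⊢
    nlinarith
  · simp only [Expr.eval, h4, h5] at hc
    rwa [show n - k = n by omega] at h6

end Runs

/-- A list of the elements of a finite type. -/
noncomputable def elems (T : Type*) [Finite T] : List T :=
  (@Finset.univ T (Fintype.ofFinite T)).toList

@[simp] theorem mem_elems {T : Type*} [Finite T] (x : T) : x ∈ elems T := by
  simp [elems]

/-- A numbering of a finite type. -/
noncomputable def enum {T : Type*} [Finite T] (x : T) : ℕ := Finite.equivFin T x

theorem enum_injective {T : Type*} [Finite T] : Function.Injective (enum : T → ℕ) :=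
  fun _ _ h => (Finite.equivFin T).injective (Fin.ext h)

theorem enum_lt {T : Type*} [Finite T] (x : T) : enum x < Nat.card T :=
  (Finite.equivFin T x).2

end AmalgamMembership

namespace AmalgamMembership

open Prog

/-! ### The initial part of the algorithm

From array `b` on, the arrays are used as follows: `b` for the labels of the nodes, `b + 1` for the
boundaries between the words, `b + 2 + j` and `b + 4 + j` for the vertices that are reached by
reduced paths and for the orbits of the normal core, `b + 6` and `b + 7` for the numbering of the
vertices of the normal core, `b + 8` for the syllables of a normal form, and `b + 9 + enum l` for
the edges with label `l`. -/

section Init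

variable {X : Fin 2 → Type*}

/-- The number of letters of the words, and the boundaries between them. -/
def boundaryProg (b : ℕ) : Prog :=
  forLoop 5 1 (.seq (.assign 3 (.add (.reg 3) (.load 1 (.reg 5))))
    (.store (b + 1) (.reg 3) (.const 1)))

/-- The program records the ends of words only, so the empty prefix, always a boundary, need not be
recorded. This is harmless, since its identification with the basepoint is trivial. -/
theorem boundaryProg_runs {b : ℕ} (hb : 3 ≤ b) (hs : List (List (Letter X))) {σ : Store}
    (h1 : σ.reg 1 = hs.length) (h3 : σ.reg 3 = 0)
    (ha1 : σ.arr 1 = cells (hs.map List.length)) (hab : ∀ t, σ.arr (b + 1) t = 0) :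
    Runs (boundaryProg b) σ ((hs.length + 1) * 20) fun τ =>
      τ.reg 3 = hs.flatten.length ∧ (∀ t, τ.arr (b + 1) t ≠ 0 → IsBoundary hs t) ∧
      ∀ t, IsBoundary hs t → t = 0 ∨ τ.arr (b + 1) t ≠ 0 := by
  refine (Runs.forLoop (n := hs.length) (by simp) (by simp) (by simp) (by simp) h1
    (fun k τ => τ.reg 3 = (hs.take k).flatten.length ∧
      ∀ t, τ.arr (b + 1) t ≠ 0 ↔ ∃ j < k, t = (hs.take (j + 1)).flatten.length) ?_ ?_).imp
      (by simp [bound, Expr.cost]) ?_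
  · simp [h3, hab]
  · rintro k hk τ hF h5 ⟨h3, hB⟩
    have h1 : τ.arr 1 = cells (hs.map List.length) := by
      rw [hF.arr 1 (by simp; omega), ha1]
    have hlen : (hs.take (k + 1)).flatten.length =
        (hs.take k).flatten.length + (hs[k]).length := by
      rw [List.take_add_one, List.getElem?_eq_getElem hk]
      simp only [Option.toList_some, List.flatten_append, List.flatten_singleton,
        List.length_append]
    have hcell : cells (hs.map List.length) k = (hs[k]).length := by
      simp [cells, hk]
    refine ⟨by simp [h3, h5, h1, hcell, hlen], fun t => ?_⟩
    have : (τ.setReg 3 (hs.take (k + 1)).flatten.length).reg 3 =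
      (hs.take (k + 1)).flatten.length := by simp
    simp only [run_seq, run_assign, run_store, Expr.eval, h3, h5, h1, hcell, ← hlen, this,
      Store.arr_setReg, Store.arr_setArr_self, Function.update_apply]
    split_ifs with ht
    · simp only [ne_eq, one_ne_zero, not_false_eq_true, true_iff]
      exact ⟨k, by omega, ht⟩
    · rw [hB]
      constructor
      · rintro ⟨j, hj, h⟩; exact ⟨j, by omega, h⟩
      · rintro ⟨j, hj, rfl⟩
        refine ⟨j, ?_, rfl⟩
        rcases Nat.lt_succ_iff_lt_or_eq.1 hj with hj | rfl
        exacts [hj, absurd rfl ht]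
  · rintro τ - ⟨h3, hB⟩
    refine ⟨by simpa using h3, fun t ht => ?_, ?_⟩
    · obtain ⟨j, hj, rfl⟩ := (hB t).1 ht
      exact ⟨hs.take (j + 1), hs.drop (j + 1), (List.take_append_drop _ _).symm, rfl⟩
    · rintro t ⟨pre, post, h, rfl⟩
      rcases Nat.eq_zero_or_pos pre.length with h0 | h0
      · left; simp [List.length_eq_zero_iff.1 h0]
      · refine .inr ((hB _).2 ⟨pre.length - 1, ?_, ?_⟩)
        · rw [h, List.length_append]; omega
        · rw [h, Nat.sub_add_cancel h0, List.take_left']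
          rfl

/-- The number of the nodes, which are then labelled by their own numbers. -/
def nodesProg (b S : ℕ) : Prog :=
  .seq (.assign 11 (.add (.reg 3) (.const 1)))
    (.seq (forLoop 5 11 (.assign 4 (.add (.reg 4) (.const S))))
      (forLoop 5 4 (.store b (.reg 5) (.reg 5))))

/-- The machine has no multiplication, so the number of nodes is found by repeated addition.
Initially each node is a class of its own. -/
theorem nodesProg_runs {b S m : ℕ} {σ : Store} (h3 : σ.reg 3 = m) (h4 : σ.reg 4 = 0) :
    Runs (nodesProg b S) σ ((S + 3) * 40 * (m + 1)) fun τ =>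
      τ.reg 11 = m + 1 ∧ τ.reg 4 = (m + 1) * S ∧ ∀ p < (m + 1) * S, τ.arr b p = p := by
  obtain ⟨τ₁, t₁, e₁, l₁, h11, h4⟩ := Runs.of_run (P := .assign 11 (.add (.reg 3) (.const 1)))
    (σ := σ) (Q := fun τ => τ.reg 11 = m + 1 ∧ τ.reg 4 = 0) (by simp) (by simp [h3, h4])
  obtain ⟨τ₂, t₂, e₂, l₂, h4⟩ := Runs.forLoop (P := .assign 4 (.add (.reg 4) (.const S)))
    (r := 5) (lim := 11) (by simp) (by simp) (by simp) (by simp) h11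
    (fun k τ => τ.reg 4 = k * S) (by simp [h4]) (by
      rintro k - υ - - hυ
      simp [hυ, add_mul])
  obtain ⟨τ₃, t₃, e₃, l₃, hL⟩ := Runs.forLoop (P := .store b (.reg 5) (.reg 5))
    (r := 5) (lim := 4) (by simp) (by simp) (by simp) (by simp) h4
    (fun k τ => ∀ p < k, τ.arr b p = p) (by simp) (by
      rintro k - υ - h5 hυ p hp
      simp only [run_store, Expr.eval, Store.arr_setReg, Store.arr_setArr_self, h5,
        Function.update_apply]
      split_ifs with hpk
      · exact hpk.symm
      · exact hυ p (by omega))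
  refine ⟨τ₃, _, e₁.seq (e₂.seq e₃), ?_, ?_, ?_, hL⟩
  · simp only [bound, Expr.cost] at l₁ l₂ l₃
    nlinarith [Nat.zero_le (m * S)]
  · rw [e₃.frame.reg 11 (by simp), e₂.frame.reg 11 (by simp), h11]
  · rw [e₃.frame.reg 4 (by simp), h4]

end Init

end AmalgamMembership

namespace AmalgamMembership

open Prog

/-! ### The folding algorithm -/

/-- If the values of two expressions are different, then they are recorded. -/
def check (e f : Expr) : Prog := .ite (neq e f) (.seq (.assign 8 e) (.assign 9 f)) skip

/-- The labels in register `8` are replaced by that in register `9`. -/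
def relabelProg (b : ℕ) : Prog :=
  forLoop 5 4 (.ite (neq (.load b (.reg 5)) (.reg 8)) skip (.store b (.reg 5) (.reg 9)))

theorem relabelProg_runs {b N : ℕ} {σ : Store} (h4 : σ.reg 4 = N) :
    Runs (relabelProg b) σ ((N + 1) * 30) fun τ =>
      (∀ p < N, τ.arr b p = if σ.arr b p = σ.reg 8 then σ.reg 9 else σ.arr b p) ∧
        ∀ p, N ≤ p → τ.arr b p = σ.arr b p := by
  refine (Runs.forLoop (n := N) (by simp) (by simp) (by simp) (by simp) h4
    (fun k τ => (∀ p < k, τ.arr b p = if σ.arr b p = σ.reg 8 then σ.reg 9 else σ.arr b p) ∧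
      ∀ p, k ≤ p → τ.arr b p = σ.arr b p) ⟨by simp, by simp⟩ ?_).imp ?_
      fun τ _ h => h
  · rintro k hk τ hF h5 ⟨h1, h2⟩
    have h8 : τ.reg 8 = σ.reg 8 := hF.reg 8 (by simp)
    have h9 : τ.reg 9 = σ.reg 9 := hF.reg 9 (by simp)
    simp only [run_ite, eval_neq, Expr.eval, h5, h8, h9, run_skip, run_store, Store.arr_setReg]
    have hk' := h2 k le_rfl
    split_ifs with hc
    · simp only [Store.arr_setArr_self, Function.update_apply]
      refine ⟨fun p hp => ?_, fun p hp => ?_⟩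
      · split_ifs with h h' h'
        · rfl
        · rw [h, ← hk'] at h'; exact absurd hc h'
        · rw [h1 p (by omega), if_pos h']
        · rw [h1 p (by omega), if_neg h']
      · rw [if_neg (by omega), h2 p (by omega)]
    · refine ⟨fun p hp => ?_, fun p hp => h2 p (by omega)⟩
      rcases Nat.lt_succ_iff_lt_or_eq.1 hp with hp | rfl
      · exact h1 p hp
      · rw [hk'] at hc ⊢
        rw [if_neg hc]
  · simp [bound, neq, Expr.cost, skip]

section Fold

variable {X : Fin 2 → Type*} [∀ i, Finite (X i)] {R : ∀ i, Set (FreeGroup (X i))}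
  [∀ i, Finite (PresentedGroup (R i))] {A : Type*} [Group A] [Finite A]

/-- All edges are removed. -/
noncomputable def clearProg (R : ∀ i, Set (FreeGroup (X i))) [∀ i, Finite (PresentedGroup (R i))]
    (A : Type*) [Finite A] (b : ℕ) : Prog :=
  forLoop 5 4 (seqL ((elems (FoldLabel R A)).map fun l =>
    .store (b + 9 + enum l) (.reg 5) (.const 0)))

-- Labels stay below N, so edges are never stored at cells from N on, and only the first N cells
-- have to be cleared.
omit [∀ i, Finite (X i)] [Group A] in
theorem clearProg_runs {b N : ℕ} {σ : Store} (h4 : σ.reg 4 = N)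
    (hσ : ∀ (l : FoldLabel R A) c, N ≤ c → σ.arr (b + 9 + enum l) c = 0) :
    Runs (clearProg R A b) σ ((N + 1) * ((seqL ((elems (FoldLabel R A)).map fun l =>
      .store (b + 9 + enum l) (.reg 5) (.const 0))).bound + 10)) fun τ =>
        ∀ (l : FoldLabel R A) c, τ.arr (b + 9 + enum l) c = 0 := by
  refine (Runs.forLoop (n := N) (by simp) (by simp) (by simp) (by simp) h4
    (fun k τ => ∀ (l : FoldLabel R A) c, c < k ∨ N ≤ c → τ.arr (b + 9 + enum l) c = 0)
    (by simpa using hσ) ?_).imp le_rfl fun τ _ h l c => h l c (Nat.lt_or_ge c N)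
  rintro k hk τ hF h5 hτ
  obtain ⟨⟨h1, h2⟩, h3⟩ := run_seqL_map (l := elems (FoldLabel R A)) (σ := τ)
    (f := fun l => .store (b + 9 + enum l) (.reg 5) (.const 0))
    (fun υ => υ.reg 5 = k ∧
      ∀ (l : FoldLabel R A) c, c < k ∨ N ≤ c → υ.arr (b + 9 + enum l) c = 0)
    (fun l υ => υ.arr (b + 9 + enum l) k = 0) ⟨h5, hτ⟩
    (by
      rintro l - υ ⟨h5, hυ⟩
      refine ⟨⟨by simpa using h5, fun l' c hc => ?_⟩, by simp [h5]⟩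
      simp only [run_store, Expr.eval, Store.arr_setArr_apply]
      split_ifs
      · rfl
      · exact hυ l' c hc)
    (by
      rintro l - l' - υ ⟨h5, hυ⟩ h
      simp only [run_store, Expr.eval, Store.arr_setArr_apply]
      split_ifs
      · rfl
      · exact h)
  intro l c hc
  rw [Store.arr_setReg]
  by_cases hck : c = k
  · subst hck
    exact h3 l (by simp)
  · exact h2 l c (by omega)

/-- The labels of the nodes as they are stored in an array. -/
noncomputable def labOf (R : ∀ i, Set (FreeGroup (X i))) [∀ i, Finite (PresentedGroup (R i))]
    (L : ℕ → ℕ) (t : ℕ) (s : Σ i, PresentedGroup (R i)) : ℕ :=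
  L (t * Nat.card (Σ i, PresentedGroup (R i)) + enum s)

omit [∀ i, Finite (X i)] in
theorem node_lt {m t : ℕ} (ht : t ≤ m) (s : Σ i, PresentedGroup (R i)) :
    t * Nat.card (Σ i, PresentedGroup (R i)) + enum s <
      (m + 1) * Nat.card (Σ i, PresentedGroup (R i)) := by
  have := enum_lt s
  have := Nat.mul_le_mul_right (Nat.card (Σ i, PresentedGroup (R i))) ht
  rw [add_mul, one_mul]
  omega

/-- The label of the node over the current prefix. -/
noncomputable def nodeExpr (b : ℕ) (s : Σ i, PresentedGroup (R i)) : Expr :=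
  .load b (.add (.reg 7) (.const (enum s)))

variable (φ : ∀ i, A →* PresentedGroup (R i)) (b : ℕ) (code : Letter X → ℕ)

/-- The edge with a given pattern over the current prefix is inserted, or compared with an edge
that is already there. -/
noncomputable def patternProg (r : Pattern R A) : Prog :=
  .ite (.load (b + 9 + enum r.lbl) (nodeExpr b r.src))
    (check (.sub (.load (b + 9 + enum r.lbl) (nodeExpr b r.src)) (.const 1))
      (nodeExpr b (r.tgt φ)))
    (.store (b + 9 + enum r.lbl) (nodeExpr b r.src) (.add (nodeExpr b (r.tgt φ)) (.const 1)))

/-- The identification of the end of the current letter. -/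
noncomputable def letterProg (R : ∀ i, Set (FreeGroup (X i)))
    [∀ i, Finite (PresentedGroup (R i))] : Prog :=
  .ite (.sub (.reg 3) (.reg 5))
    (switch (.load 2 (.reg 5)) code (fun x => check (nodeExpr b (letterElt R x))
      (.load b (.add (.reg 7) (.const (Nat.card (Σ i, PresentedGroup (R i)) +
        enum (⟨0, 1⟩ : Σ i, PresentedGroup (R i))))))) (elems (Letter X))) skip

/-- The identification of the current prefix with the basepoint. -/
noncomputable def bdProg (R : ∀ i, Set (FreeGroup (X i)))
    [∀ i, Finite (PresentedGroup (R i))] : Prog :=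
  .ite (.load (b + 1) (.reg 5))
    (check (nodeExpr b (⟨0, 1⟩ : Σ i, PresentedGroup (R i)))
      (.load b (.const (enum (⟨0, 1⟩ : Σ i, PresentedGroup (R i)))))) skip

/-- The identifications and the edges over the current prefix. -/
noncomputable def scanPieces : Prog :=
  .seq (seqL ((elems A).map fun a => check (nodeExpr b ⟨0, φ 0 a⟩) (nodeExpr b ⟨1, φ 1 a⟩)))
    (.seq (letterProg b code R) (.seq (bdProg b R)
      (seqL ((elems (Pattern R A)).map (patternProg φ b)))))

variable (hs : List (List (Letter X)))

/-- The state of the scan at the prefix of length `t`. -/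
structure ScanInv (L : ℕ → ℕ) (t : ℕ) (τ : Store) : Prop where
  arr_lab : τ.arr b = L
  arr_word : τ.arr 2 = cells (hs.flatten.map code)
  boundary : ∀ t, τ.arr (b + 1) t ≠ 0 → IsBoundary hs t
  boundary' : ∀ t, IsBoundary hs t → t = 0 ∨ τ.arr (b + 1) t ≠ 0
  reg_len : τ.reg 3 = hs.flatten.length
  reg_pos : τ.reg 5 = t
  reg_off : τ.reg 7 = t * Nat.card (Σ i, PresentedGroup (R i))
  pair : τ.reg 8 = τ.reg 9 ∨ Mergeable φ hs (labOf R L) (τ.reg 8) (τ.reg 9)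
  act : ∀ (l : FoldLabel R A) c d, τ.arr (b + 9 + enum l) c = d + 1 →
    ∃ t ≤ hs.flatten.length, ∃ r : Pattern R A, r.lbl = l ∧ labOf R L t r.src = c ∧
      labOf R L t (r.tgt φ) = d

/-- What is found during the scan is not forgotten. -/
structure ScanExt (R : ∀ i, Set (FreeGroup (X i))) [∀ i, Finite (PresentedGroup (R i))]
    (A : Type*) [Finite A] (b : ℕ) (τ υ : Store) : Prop where
  viol : τ.reg 8 ≠ τ.reg 9 → υ.reg 8 ≠ υ.reg 9
  act : ∀ (l : FoldLabel R A) c, τ.arr (b + 9 + enum l) c ≠ 0 →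
    υ.arr (b + 9 + enum l) c = τ.arr (b + 9 + enum l) c

omit [∀ i, Finite (X i)] [Group A] in
theorem ScanExt.refl (τ : Store) : ScanExt R A b τ τ := ⟨id, fun _ _ _ => rfl⟩

omit [∀ i, Finite (X i)] [Group A] in
variable {b} in
theorem ScanExt.trans {τ υ ω : Store} (h : ScanExt R A b τ υ) (h' : ScanExt R A b υ ω) :
    ScanExt R A b τ ω :=
  ⟨fun hv => h'.viol (h.viol hv), fun l c hc => by
    have := h.act l c hc
    rw [h'.act l c (by rwa [this]), this]⟩

/-- A part of the scan that ensures `D`, unless a violation is found. -/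
def ScanPiece (L : ℕ → ℕ) (t : ℕ) (P : Prog) (D : Store → Prop) : Prop :=
  ∀ τ, ScanInv φ b code hs L t τ → ScanInv φ b code hs L t (P.run τ) ∧
    ScanExt R A b τ (P.run τ) ∧ ((P.run τ).reg 8 ≠ (P.run τ).reg 9 ∨ D (P.run τ))

variable {φ b code hs} {L : ℕ → ℕ} {t : ℕ} {P Q : Prog} {D D' : Store → Prop}

-- A violation, once found, persists to the end of the scan, and so does what has been verified. It
-- is therefore enough that each part ensures its property or reports a violation.
omit [∀ i, Finite (X i)] in
theorem ScanPiece.seq (hP : ScanPiece φ b code hs L t P D)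
    (hQ : ScanPiece φ b code hs L t Q D')
    (hD : ∀ τ υ, ScanExt R A b τ υ → D τ → D υ) :
    ScanPiece φ b code hs L t (.seq P Q) fun τ => D τ ∧ D' τ := by
  intro τ hτ
  obtain ⟨h1, h2, h3⟩ := hP τ hτ
  obtain ⟨h4, h5, h6⟩ := hQ _ h1
  refine ⟨h4, h2.trans h5, ?_⟩
  rcases h3 with h3 | h3
  · exact .inl (h5.viol h3)
  · exact h6.imp id fun h6 => ⟨hD _ _ h5 h3, h6⟩

omit [∀ i, Finite (X i)] in
theorem ScanPiece.seqL {T : Type*} {l : List T} {f : T → Prog} {D : T → Store → Prop}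
    (hf : ∀ x ∈ l, ScanPiece φ b code hs L t (f x) (D x))
    (hD : ∀ x τ υ, ScanExt R A b τ υ → D x τ → D x υ) :
    ScanPiece φ b code hs L t (Prog.seqL (l.map f)) fun τ => ∀ x ∈ l, D x τ := by
  intro τ hτ
  obtain ⟨⟨h1, h2⟩, h3⟩ := run_seqL_map (l := l) (f := f) (σ := τ)
    (fun υ => ScanInv φ b code hs L t υ ∧ ScanExt R A b τ υ)
    (fun x υ => υ.reg 8 ≠ υ.reg 9 ∨ D x υ) ⟨hτ, .refl b τ⟩
    (by
      rintro x hx υ ⟨h1, h2⟩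
      obtain ⟨h3, h4, h5⟩ := hf x hx υ h1
      exact ⟨⟨h3, h2.trans h4⟩, h5⟩)
    (by
      rintro x hx y - υ ⟨h1, h2⟩ h
      obtain ⟨h3, h4, h5⟩ := hf x hx υ h1
      exact h.imp h4.viol (hD y _ _ h4))
  refine ⟨h1, h2, ?_⟩
  by_cases hv : ((Prog.seqL (l.map f)).run τ).reg 8 = ((Prog.seqL (l.map f)).run τ).reg 9
  · exact .inr fun x hx => (h3 x hx).resolve_left (not_not_intro hv)
  · exact .inl hv

-- `check` evaluates f again after register 8 has been overwritten; this is the reason for the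
-- second half of the assumption on f.
omit [∀ i, Finite (X i)] in
theorem scanPiece_check {e f : Expr} {x y : ℕ}
    (he : ∀ τ, ScanInv φ b code hs L t τ → e.eval τ = x)
    (hf : ∀ τ v, ScanInv φ b code hs L t τ → f.eval τ = y ∧ f.eval (τ.setReg 8 v) = y)
    (hm : Mergeable φ hs (labOf R L) x y) :
    ScanPiece φ b code hs L t (check e f) fun _ => x = y := by
  intro τ hτ
  rw [check, run_ite]
  simp only [eval_neq, he τ hτ, (hf τ 0 hτ).1]
  split_ifs with h
  · rw [run_skip]
    exact ⟨hτ, .refl b τ, .inr h⟩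
  · simp only [run_seq, run_assign, he τ hτ, (hf τ x hτ).2]
    exact ⟨⟨hτ.1, hτ.2, hτ.3, hτ.4, by simpa using hτ.5, by simpa using hτ.6,
      by simpa using hτ.7, .inr (by simpa using hm), hτ.9⟩, ⟨fun _ => by simpa using h,
      fun _ _ _ => rfl⟩, .inl (by simpa using h)⟩

omit [∀ i, Finite (X i)] in
theorem eval_nodeExpr {τ : Store} (h : ScanInv φ b code hs L t τ)
    (s : Σ i, PresentedGroup (R i)) : (nodeExpr b s).eval τ = labOf R L t s := by
  simp [nodeExpr, labOf, h.arr_lab, h.reg_off]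

omit [∀ i, Finite (X i)] in
theorem eval_nodeExpr_setReg {τ : Store} (h : ScanInv φ b code hs L t τ) (v : ℕ)
    (s : Σ i, PresentedGroup (R i)) :
    (nodeExpr b s).eval (τ.setReg 8 v) = labOf R L t s := by
  simp [nodeExpr, labOf, h.arr_lab, h.reg_off]

omit [∀ i, Finite (X i)] in
theorem scanPiece_base (ht : t ≤ hs.flatten.length) (a : A) :
    ScanPiece φ b code hs L t (check (nodeExpr b ⟨0, φ 0 a⟩) (nodeExpr b ⟨1, φ 1 a⟩))
      fun _ => labOf R L t ⟨0, φ 0 a⟩ = labOf R L t ⟨1, φ 1 a⟩ :=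
  scanPiece_check (fun _ h => eval_nodeExpr h _)
    (fun _ v h => ⟨eval_nodeExpr h _, eval_nodeExpr_setReg h v _⟩)
    ⟨t, ht, t, ht, _, _, rfl, rfl, nodeVal_base t 0 1 a⟩

/-- Register 7 holds the offset of the nodes over the current prefix; adding the size of one block
leads to the nodes over the next prefix. -/
theorem scanPiece_letter (hcode : Function.Injective code) :
    ScanPiece φ b code hs L t (letterProg b code R) fun _ => ∀ ht : t < hs.flatten.length,
      labOf R L t (letterElt R hs.flatten[t]) = labOf R L (t + 1) ⟨0, 1⟩ := by
  by_cases ht : t < hs.flatten.length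
  · have key := scanPiece_check (φ := φ) (b := b) (code := code) (hs := hs) (L := L) (t := t)
      (e := nodeExpr b (letterElt R hs.flatten[t]))
      (f := .load b (.add (.reg 7) (.const (Nat.card (Σ i, PresentedGroup (R i)) +
        enum (⟨0, 1⟩ : Σ i, PresentedGroup (R i))))))
      (y := labOf R L (t + 1) ⟨0, 1⟩) (fun _ h => eval_nodeExpr h _)
      (fun τ v h => by simp [labOf, h.arr_lab, h.reg_off, add_mul, add_assoc])
      ⟨t, ht.le, t + 1, ht, _, _, rfl, rfl, nodeVal_letter ht 0⟩
    intro τ hτ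
    have h1 : (letterProg b code R).run τ =
        (check (nodeExpr b (letterElt R hs.flatten[t])) (.load b (.add (.reg 7)
          (.const (Nat.card (Σ i, PresentedGroup (R i)) +
            enum (⟨0, 1⟩ : Σ i, PresentedGroup (R i))))))).run τ := by
      rw [letterProg, run_ite, if_neg (by simp only [Expr.eval, hτ.reg_len, hτ.reg_pos]; omega)]
      refine run_switch hcode (x := hs.flatten[t]) (by simp) ?_
      simp only [Expr.eval, hτ.arr_word, hτ.reg_pos, cells]
      rw [List.getD_eq_getElem _ _ (by rwa [List.length_map]), List.getElem_map]
    rw [h1]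
    obtain ⟨h2, h3, h4⟩ := key τ hτ
    exact ⟨h2, h3, h4.imp id fun h _ => h⟩
  · intro τ hτ
    have h1 : (letterProg b code R).run τ = τ := by
      rw [letterProg, run_ite, if_pos (by simp only [Expr.eval, hτ.reg_len, hτ.reg_pos]; omega), run_skip]
    rw [h1]
    exact ⟨hτ, .refl b τ, .inr fun h => absurd h ht⟩

omit [∀ i, Finite (X i)] in
theorem scanPiece_boundary (ht : t ≤ hs.flatten.length) :
    ScanPiece φ b code hs L t (bdProg b R) fun _ => IsBoundary hs t →
      labOf R L t ⟨0, 1⟩ = labOf R L 0 ⟨0, 1⟩ := by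
  intro τ hτ
  rw [bdProg, run_ite]
  simp only [Expr.eval, hτ.reg_pos]
  split_ifs with h
  · rw [run_skip]
    refine ⟨hτ, .refl b τ, .inr fun hbd => ?_⟩
    rcases hτ.boundary' t hbd with rfl | h'
    exacts [rfl, absurd h h']
  · obtain ⟨h2, h3, h4⟩ := scanPiece_check (φ := φ) (b := b) (code := code) (hs := hs) (L := L)
      (t := t) (e := nodeExpr b (⟨0, 1⟩ : Σ i, PresentedGroup (R i)))
      (f := .load b (.const (enum (⟨0, 1⟩ : Σ i, PresentedGroup (R i)))))
      (y := labOf R L 0 ⟨0, 1⟩) (fun _ h => eval_nodeExpr h _)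
      (fun τ v h => by simp [labOf, h.arr_lab])
      ⟨t, ht, 0, Nat.zero_le _, _, _, rfl, rfl, nodeVal_boundary (hτ.boundary t h) 0 0⟩ τ hτ
    exact ⟨h2, h3, h4.imp id fun h _ => h⟩

-- A cell holds the target plus one, so 0 means that there is no edge yet. If the cell is occupied,
-- its edge comes from a node with the same source label. By soundness the two sources lie over one
-- coset, so the targets do as well, and different targets are a legitimate pair to merge.
omit [∀ i, Finite (X i)] in
theorem scanPiece_pattern (hb : 3 ≤ b) (ht : t ≤ hs.flatten.length) (hL : IsSound φ hs (labOf R L))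
    (r : Pattern R A) :
    ScanPiece φ b code hs L t (patternProg φ b r) fun τ =>
      τ.arr (b + 9 + enum r.lbl) (labOf R L t r.src) = labOf R L t (r.tgt φ) + 1 := by
  intro τ hτ
  rw [patternProg, run_ite]
  simp only [Expr.eval, eval_nodeExpr hτ]
  split_ifs with h
  · simp only [run_store, Expr.eval, eval_nodeExpr hτ]
    refine ⟨⟨?_, ?_, ?_, ?_, hτ.reg_len, hτ.reg_pos, hτ.reg_off, hτ.pair, ?_⟩, ⟨id, ?_⟩,
      .inr (by simp)⟩
    · rw [Store.arr_setArr_of_ne _ (by omega), hτ.arr_lab]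
    · rw [Store.arr_setArr_of_ne _ (by omega), hτ.arr_word]
    · rw [Store.arr_setArr_of_ne _ (by omega)]; exact hτ.boundary
    · rw [Store.arr_setArr_of_ne _ (by omega)]; exact hτ.boundary'
    · intro l c d
      rw [Store.arr_setArr_apply]
      split_ifs with hc
      · intro hd
        have hl : enum l = enum r.lbl := by omega
        exact ⟨t, ht, r, (enum_injective hl).symm, hc.2.symm, by omega⟩
      · exact hτ.act l c d
    · intro l c hc
      rw [Store.arr_setArr_apply, if_neg]
      rintro ⟨h1, rfl⟩
      rw [h1] at hc
      exact hc h
  · obtain ⟨d, hd⟩ := Nat.exists_eq_succ_of_ne_zero h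
    obtain ⟨t', ht', r', hr, h1, h2⟩ := hτ.act _ _ _ hd
    have key := scanPiece_check (φ := φ) (b := b) (code := code) (hs := hs) (L := L) (t := t)
      (e := .const d) (x := d) (f := nodeExpr b (r.tgt φ)) (fun _ _ => rfl)
      (fun _ v h => ⟨eval_nodeExpr h _, eval_nodeExpr_setReg h v _⟩)
      ⟨t', ht', t, ht, _, _, h2, rfl, nodeVal_tgt hr (hL t' ht' t ht _ _ h1)⟩ τ hτ
    have he : (check (.sub (.load (b + 9 + enum r.lbl) (nodeExpr b r.src)) (.const 1))
        (nodeExpr b (r.tgt φ))).run τ = (check (.const d) (nodeExpr b (r.tgt φ))).run τ := by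
      simp [check, run_ite, eval_nodeExpr hτ, hd]
    rw [he]
    refine ⟨key.1, key.2.1, key.2.2.imp id fun h' => ?_⟩
    rw [key.2.1.act _ _ h, hd, ← h']

/-- No violation is found over the prefix of length `t`. -/
structure ScanDone (φ : ∀ i, A →* PresentedGroup (R i)) (b : ℕ) (hs : List (List (Letter X)))
    (L : ℕ → ℕ) (t : ℕ) (τ : Store) : Prop where
  base_eq : ∀ a, labOf R L t ⟨0, φ 0 a⟩ = labOf R L t ⟨1, φ 1 a⟩
  letter_eq : ∀ ht : t < hs.flatten.length,
    labOf R L t (letterElt R hs.flatten[t]) = labOf R L (t + 1) ⟨0, 1⟩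
  boundary_eq : IsBoundary hs t → labOf R L t ⟨0, 1⟩ = labOf R L 0 ⟨0, 1⟩
  act : ∀ r : Pattern R A,
    τ.arr (b + 9 + enum r.lbl) (labOf R L t r.src) = labOf R L t (r.tgt φ) + 1

omit [∀ i, Finite (X i)] in
theorem ScanDone.mono {τ υ : Store} (h : ScanDone φ b hs L t τ) (hE : ScanExt R A b τ υ) :
    ScanDone φ b hs L t υ :=
  ⟨h.1, h.2, h.3, fun r => by rw [hE.act _ _ (by rw [h.act r]; simp), h.act r]⟩

theorem scanPiece_scanPieces (hcode : Function.Injective code) (hb : 3 ≤ b)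
    (ht : t ≤ hs.flatten.length) (hL : IsSound φ hs (labOf R L)) :
    ScanPiece φ b code hs L t (scanPieces φ b code) (ScanDone φ b hs L t) := by
  have := (ScanPiece.seqL (l := elems A) (fun a _ => scanPiece_base (φ := φ) (b := b)
    (code := code) (L := L) ht a) fun _ _ _ _ h => h).seq ((scanPiece_letter (R := R) hcode).seq
      ((scanPiece_boundary ht).seq (ScanPiece.seqL (l := elems (Pattern R A))
        (fun r _ => scanPiece_pattern hb ht hL r) fun r τ υ hE h => by
          rw [hE.act _ _ (by rw [h]; simp), h]) fun _ _ _ h => h)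
        fun _ _ _ h => h) fun _ _ _ h => h
  intro τ hτ
  obtain ⟨h1, h2, h3⟩ := this τ hτ
  exact ⟨h1, h2, h3.imp id fun h => ⟨fun a => h.1 a (by simp), h.2.1, h.2.2.1,
    fun r => h.2.2.2 r (by simp)⟩⟩

end Fold

end AmalgamMembership

namespace AmalgamMembership

open Prog

/-! ### Rounds of the folding algorithm and their termination -/

section Fold

variable {X : Fin 2 → Type*} [∀ i, Finite (X i)] {R : ∀ i, Set (FreeGroup (X i))}
  [∀ i, Finite (PresentedGroup (R i))] {A : Type*} [Group A] [Finite A]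
  (φ : ∀ i, A →* PresentedGroup (R i)) (b : ℕ) (code : Letter X → ℕ)

theorem loopFree_scanPieces : (scanPieces φ b code).LoopFree := by
  simp [scanPieces, letterProg, bdProg, patternProg, check]

theorem keepsReg_scanPieces {r : ℕ} (h8 : r ≠ 8) (h9 : r ≠ 9) :
    (scanPieces φ b code).KeepsReg r := by
  simp [scanPieces, letterProg, bdProg, patternProg, check, h8.symm, h9.symm]

theorem keepsArr_scanPieces {a : ℕ} (ha : a < b + 9) :
    (scanPieces φ b code).KeepsArr a := by
  have : ∀ k, ¬ b + 9 + k = a := fun k => by omega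
  simp [scanPieces, letterProg, bdProg, patternProg, check, this]

/-- The part of the scan for one prefix. -/
noncomputable def scanBody : Prog :=
  .seq (scanPieces φ b code)
    (.assign 7 (.add (.reg 7) (.const (Nat.card (Σ i, PresentedGroup (R i))))))

theorem loopFree_scanBody : (scanBody φ b code).LoopFree := ⟨loopFree_scanPieces φ b code, trivial⟩

theorem keepsReg_scanBody {r : ℕ} (h7 : r ≠ 7) (h8 : r ≠ 8) (h9 : r ≠ 9) :
    (scanBody φ b code).KeepsReg r :=
  ⟨keepsReg_scanPieces φ b code h8 h9, .inl h7.symm⟩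

theorem keepsArr_scanBody {a : ℕ} (ha : a < b + 9) :
    (scanBody φ b code).KeepsArr a :=
  ⟨keepsArr_scanPieces φ b code ha, trivial⟩

variable (hs : List (List (Letter X))) {φ b code}

theorem scan_runs (hcode : Function.Injective code) (hb : 3 ≤ b) {L : ℕ → ℕ} {σ : Store}
    (hL : IsSound φ hs (labOf R L)) (h11 : σ.reg 11 = hs.flatten.length + 1)
    (hσ : ScanInv φ b code hs L 0 (σ.setReg 5 0)) :
    Runs (forLoop 5 11 (scanBody φ b code)) σ
      ((hs.flatten.length + 2) * ((scanBody φ b code).bound + 10)) fun τ =>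
        ScanInv φ b code hs L (hs.flatten.length + 1) (τ.setReg 5 (hs.flatten.length + 1)) ∧
        (τ.reg 8 ≠ τ.reg 9 ∨ ∀ t ≤ hs.flatten.length, ScanDone φ b hs L t τ) := by
  refine (Runs.forLoop (n := hs.flatten.length + 1) (loopFree_scanBody φ b code)
    (keepsReg_scanBody φ b code (by simp) (by simp) (by simp))
    (keepsReg_scanBody φ b code (by simp) (by simp) (by simp)) (by simp) h11
    (fun k τ => ScanInv φ b code hs L k (τ.setReg 5 k) ∧
      (τ.reg 8 ≠ τ.reg 9 ∨ ∀ t < k, ScanDone φ b hs L t τ)) ⟨by simpa [Store.setReg] using hσ,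
        .inr (by simp)⟩ ?_).imp le_rfl ?_
  · rintro k hk τ - h5 ⟨h1, h2⟩
    have hτ : τ.setReg 5 k = τ := by
      obtain ⟨r, a⟩ := τ
      simp only [Store.setReg, Store.mk.injEq, and_true] at h5 ⊢
      rw [← h5, Function.update_eq_self]
    rw [hτ] at h1
    obtain ⟨h3, h4, h5⟩ := scanPiece_scanPieces hcode hb (Nat.lt_succ_iff.1 hk) hL τ h1
    refine ⟨⟨h3.1, h3.2, h3.3, h3.4, ?_, ?_, ?_, ?_, h3.9⟩, ?_⟩
    · simpa [scanBody] using h3.5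
    · simp
    · simp [scanBody, h3.7, add_mul]
    · simpa [scanBody] using h3.8
    · simp only [scanBody, run_seq, run_assign, Store.reg_setReg]
      simp only [Nat.reduceEqDiff, reduceIte]
      rcases h2 with h2 | h2
      · exact .inl (h4.viol h2)
      · refine h5.imp id fun h5 t ht => ?_
        have : ScanDone φ b hs L t ((scanPieces φ b code).run τ) := by
          rcases Nat.lt_succ_iff_lt_or_eq.1 ht with ht | rfl
          exacts [(h2 t ht).mono h4, h5]
        exact ⟨this.1, this.2, this.3, this.4⟩
  · rintro τ - ⟨h1, h2⟩
    exact ⟨h1, h2.imp id fun h t ht => h t (Nat.lt_succ_of_le ht)⟩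

variable (φ b code) in
/-- One round of the folding algorithm. -/
noncomputable def foldBody : Prog :=
  .seq (clearProg R A b) (.seq (.seq (.assign 8 (.const 0)) (.seq (.assign 9 (.const 0))
    (.assign 7 (.const 0)))) (.seq (forLoop 5 11 (scanBody φ b code))
      (.seq (relabelProg b) (.assign 10 (neq (.reg 8) (.reg 9))))))

variable (φ b code) in
/-- The folding algorithm. -/
noncomputable def foldProg : Prog :=
  .seq (.assign 10 (.const 1)) (.while (.reg 10) (foldBody φ b code))

/-- The data of the folding algorithm that are not changed. -/
structure FoldCtx (R : ∀ i, Set (FreeGroup (X i))) [∀ i, Finite (PresentedGroup (R i))]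
    (b : ℕ) (code : Letter X → ℕ) (hs : List (List (Letter X))) (τ : Store) : Prop where
  arr_word : τ.arr 2 = cells (hs.flatten.map code)
  boundary : ∀ t, τ.arr (b + 1) t ≠ 0 → IsBoundary hs t
  boundary' : ∀ t, IsBoundary hs t → t = 0 ∨ τ.arr (b + 1) t ≠ 0
  reg_len : τ.reg 3 = hs.flatten.length
  reg_nodes : τ.reg 4 = (hs.flatten.length + 1) * Nat.card (Σ i, PresentedGroup (R i))
  reg_succ : τ.reg 11 = hs.flatten.length + 1

variable (φ b) in
/-- The data of the folding algorithm that are changed, but always sound. -/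
structure FoldInv (τ : Store) : Prop where
  lab_lt : ∀ p < (hs.flatten.length + 1) * Nat.card (Σ i, PresentedGroup (R i)),
    τ.arr b p < (hs.flatten.length + 1) * Nat.card (Σ i, PresentedGroup (R i))
  sound : IsSound φ hs (labOf R (τ.arr b))
  act_lt : ∀ (l : FoldLabel R A) c,
    (hs.flatten.length + 1) * Nat.card (Σ i, PresentedGroup (R i)) ≤ c →
      τ.arr (b + 9 + enum l) c = 0

variable (φ b) in
/-- The store holds a folded graph. -/
structure HoldsFolded (τ : Store) : Prop where
  folded : IsFolded φ hs (labOf R (τ.arr b))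
  act : ∀ (l : FoldLabel R A) c d, τ.arr (b + 9 + enum l) c = d + 1 ↔
    ∃ t ≤ hs.flatten.length, ∃ r : Pattern R A, r.lbl = l ∧ labOf R (τ.arr b) t r.src = c ∧
      labOf R (τ.arr b) t (r.tgt φ) = d

variable {hs}

omit [∀ i, Finite (X i)] in
theorem FoldCtx.frame {P : Prog} {σ τ : Store} (h : FoldCtx R b code hs σ) (hF : P.Frame σ τ)
    (h2 : P.KeepsArr 2) (hb : P.KeepsArr (b + 1)) (h3 : P.KeepsReg 3) (h4 : P.KeepsReg 4)
    (h11 : P.KeepsReg 11) : FoldCtx R b code hs τ := by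
  refine ⟨?_, ?_, ?_, ?_, ?_, ?_⟩
  · rw [hF.arr 2 h2, h.arr_word]
  · rw [hF.arr _ hb]; exact h.boundary
  · rw [hF.arr _ hb]; exact h.boundary'
  · rw [hF.reg 3 h3, h.reg_len]
  · rw [hF.reg 4 h4, h.reg_nodes]
  · rw [hF.reg 11 h11, h.reg_succ]

variable (φ b code) in
/-- A constant in the bound for the running time of the folding algorithm. -/
noncomputable def foldConst : ℕ :=
  (seqL ((elems (FoldLabel R A)).map fun l =>
    Prog.store (b + 9 + enum l) (.reg 5) (.const 0))).bound + (scanBody φ b code).bound + 100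

theorem keepsReg_foldBody {r : ℕ} (h5 : r ≠ 5) (h7 : r ≠ 7) (h8 : r ≠ 8) (h9 : r ≠ 9)
    (h10 : r ≠ 10) : (foldBody φ b code).KeepsReg r := by
  simp [foldBody, clearProg, relabelProg, keepsReg_scanBody, *, Ne.symm h5, Ne.symm h7,
    Ne.symm h8, Ne.symm h9, Ne.symm h10]

theorem keepsArr_foldBody {a : ℕ} (ha : a < b + 9) (hab : a ≠ b) :
    (foldBody φ b code).KeepsArr a := by
  have : ∀ k, ¬ b + 9 + k = a := fun k => by omega
  simp [foldBody, clearProg, relabelProg, keepsArr_scanBody, ha, hab.symm, this]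

/-- A round rebuilds the edges for the current labels. Either no conflict shows up, and then the
scan has verified all conditions of a folded graph, or the last conflict found is resolved by one
sound merge. -/
theorem foldBody_runs (hcode : Function.Injective code) (hb : 3 ≤ b) {σ : Store}
    (hctx : FoldCtx R b code hs σ) (hσ : FoldInv φ b hs σ) :
    Runs (foldBody φ b code) σ (((hs.flatten.length + 1) * Nat.card (Σ i, PresentedGroup (R i)) +
        hs.flatten.length + 2) * foldConst φ b code) fun τ => FoldInv φ b hs τ ∧
      (τ.reg 10 = 0 → HoldsFolded φ b hs τ ∧ τ.arr b = σ.arr b) ∧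
      (τ.reg 10 ≠ 0 → ∃ x y, x ≠ y ∧ Mergeable φ hs (labOf R (σ.arr b)) x y ∧
        ∀ p < (hs.flatten.length + 1) * Nat.card (Σ i, PresentedGroup (R i)),
          τ.arr b p = if σ.arr b p = x then y else σ.arr b p) := by
  set m := hs.flatten.length with hm
  set N := (m + 1) * Nat.card (Σ i, PresentedGroup (R i)) with hN
  have hne : ∀ k, b + 9 + k ≠ b := fun k => by omega
  have hne1 : ∀ k, b + 9 + k ≠ b + 1 := fun k => by omega
  have hne2 : ∀ k, b + 9 + k ≠ 2 := fun k => by omega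
  have hb2 : b ≠ 2 := by omega
  obtain ⟨τ₁, t₁, e₁, l₁, q₁⟩ := clearProg_runs (R := R) (A := A) (b := b) hctx.reg_nodes hσ.act_lt
  have c₁ : FoldCtx R b code hs τ₁ := hctx.frame e₁.frame (by simp [clearProg, hne2])
    (by simp [clearProg, hne1]) (by simp [clearProg]) (by simp [clearProg]) (by simp [clearProg])
  have L₁ : τ₁.arr b = σ.arr b := e₁.frame.arr b (by simp [clearProg, hne])
  obtain ⟨τ₂, t₂, e₂, l₂, q₂⟩ := Runs.of_run (P := .seq (.assign 8 (.const 0))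
    (.seq (.assign 9 (.const 0)) (.assign 7 (.const 0)))) (σ := τ₁)
    (Q := fun τ => τ.arr = τ₁.arr ∧ τ.reg 8 = 0 ∧ τ.reg 9 = 0 ∧ τ.reg 7 = 0) (by simp) (by simp)
  have c₂ : FoldCtx R b code hs τ₂ := c₁.frame e₂.frame (by simp)
    (by simp) (by simp) (by simp) (by simp)
  have hlab : ∀ t ≤ m, ∀ s : Σ i, PresentedGroup (R i), labOf R (σ.arr b) t s < N :=
    fun t ht s => hσ.lab_lt _ (node_lt ht s)
  obtain ⟨τ₃, t₃, e₃, l₃, q₃, q₃'⟩ := scan_runs hs hcode hb hσ.sound c₂.reg_succ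
    ⟨by simp [q₂.1, L₁], c₂.arr_word, c₂.boundary, c₂.boundary', by simpa using c₂.reg_len,
      by simp, by simp [q₂.2.2.2], .inl (by simp [q₂.2.1, q₂.2.2.1]), by simp [q₂.1, q₁]⟩
  have c₃ : FoldCtx R b code hs τ₃ := c₂.frame e₃.frame
    (by simp [keepsArr_scanBody φ b code (a := 2) (by omega)])
    (by simp [keepsArr_scanBody]) (by simp [keepsReg_scanBody]) (by simp [keepsReg_scanBody])
    (by simp [keepsReg_scanBody])
  have L₃ : τ₃.arr b = σ.arr b := q₃.arr_lab
  obtain ⟨τ₄, t₄, e₄, l₄, q₄, q₄'⟩ := relabelProg_runs (b := b) c₃.reg_nodes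
  obtain ⟨τ₅, t₅, e₅, l₅, q₅⟩ := Runs.of_run (P := .assign 10 (neq (.reg 8) (.reg 9))) (σ := τ₄)
    (Q := fun τ => τ.arr = τ₄.arr ∧ (τ.reg 10 = 0 ↔ τ₄.reg 8 = τ₄.reg 9)) (by simp) (by
      refine ⟨rfl, ?_⟩
      rw [← Expr.eval.eq_2 τ₄ 8, ← Expr.eval.eq_2 τ₄ 9, ← eval_neq]
      simp)
  have h48 : τ₄.reg 8 = τ₃.reg 8 := e₄.frame.reg 8 (by simp [relabelProg])
  have h49 : τ₄.reg 9 = τ₃.reg 9 := e₄.frame.reg 9 (by simp [relabelProg])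
  have hact : ∀ l : FoldLabel R A, τ₅.arr (b + 9 + enum l) = τ₃.arr (b + 9 + enum l) := by
    intro l
    rw [q₅.1, e₄.frame.arr _ (by simp [relabelProg]; omega)]
  have hL5 : τ₅.arr b = τ₄.arr b := by rw [q₅.1]
  -- Without a violation registers 8 and 9 agree and the relabelling is the identity; hence it can
  -- be run unconditionally.
  have hsame : τ₃.reg 8 = τ₃.reg 9 → τ₅.arr b = σ.arr b := by
    intro h
    rw [hL5]
    funext p
    rcases Nat.lt_or_ge p N with hp | hp
    · rw [q₄ p hp, ← h, L₃]
      split_ifs with h'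
      exacts [h'.symm, rfl]
    · rw [q₄' p hp, L₃]
  have hmerge : τ₃.reg 8 ≠ τ₃.reg 9 →
      Mergeable φ hs (labOf R (σ.arr b)) (τ₃.reg 8) (τ₃.reg 9) := by
    intro h
    simpa [h] using q₃.pair
  have hactlt : ∀ (l : FoldLabel R A) c, N ≤ c → τ₅.arr (b + 9 + enum l) c = 0 := by
    intro l c hc
    rw [hact]
    by_contra h
    obtain ⟨d, hd⟩ := Nat.exists_eq_succ_of_ne_zero h
    obtain ⟨t, ht, r, -, rfl, -⟩ := q₃.act l c d hd
    exact absurd hc (not_le.2 (hlab t ht _))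
  refine ⟨τ₅, _, e₁.seq (e₂.seq (e₃.seq (e₄.seq e₅))), ?_, ?_, ?_, ?_⟩
  · simp only [bound, Expr.cost, neq] at l₂ l₅
    simp only [foldConst]
    rw [← hm, ← hN] at *
    nlinarith
  · by_cases h : τ₃.reg 8 = τ₃.reg 9
    · refine ⟨?_, ?_, hactlt⟩
      · rw [hsame h]; exact hσ.lab_lt
      · rw [hsame h]; exact hσ.sound
    · have hmg := hmerge h
      refine ⟨?_, ?_, hactlt⟩
      · intro p hp
        rw [hL5, q₄ p hp, L₃]
        split_ifs
        · obtain ⟨t, ht, t', ht', s, s', -, h', -⟩ := hmg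
          rw [← h']
          exact hlab t' ht' s'
        · exact hσ.lab_lt p hp
      · have := hσ.sound.merge hmg
        intro t ht t' ht' s s' hss
        refine this t ht t' ht' s s' ?_
        simp only [labOf, hL5] at hss ⊢
        rwa [q₄ _ (node_lt ht s), q₄ _ (node_lt ht' s'), L₃] at hss
  · intro h
    rw [q₅.2, h48, h49] at h
    refine ⟨?_, hsame h⟩
    have hdone := q₃'.resolve_left (not_not_intro h)
    have hL := hsame h
    refine ⟨⟨?_, ?_, ?_, ?_, ?_⟩, ?_⟩
    · rw [hL]; exact hσ.sound
    · rw [hL]; exact fun t ht => (hdone t ht).base_eq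
    · rw [hL]; exact fun t ht => (hdone t ht.le).letter_eq ht
    · rw [hL]
      rintro t ht
      have ht' : t ≤ m := by
        obtain ⟨pre, post, h', rfl⟩ := ht
        rw [hm, h', List.flatten_append, List.length_append]
        exact Nat.le_add_right _ _
      exact (hdone t ht').boundary_eq ht
    · rw [hL]
      intro t ht t' ht' r r' hr hrr
      -- Equal labels and equal sources address the same cell, which records both targets.
      have h1 := (hdone t ht).act r
      have h2 := (hdone t' ht').act r'
      rw [← hr, ← hrr, h1] at h2
      omega
    · rw [hL]
      intro l c d
      rw [hact]
      constructor
      · exact q₃.act l c d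
      · rintro ⟨t, ht, r, rfl, rfl, rfl⟩
        exact (hdone t ht).act r
  · intro h
    rw [ne_eq, q₅.2, h48, h49] at h
    refine ⟨_, _, h, hmerge h, fun p hp => ?_⟩
    rw [hL5, q₄ p hp, L₃]

/-- The label x disappears and no new label arises, because y was already in use. -/
theorem card_relabel_lt {L L' : ℕ → ℕ} {N x y : ℕ} (hxy : x ≠ y)
    (hx : ∃ p < N, L p = x) (hy : ∃ p < N, L p = y)
    (hL : ∀ p < N, L' p = if L p = x then y else L p) :
    ((Finset.range N).image L').card < ((Finset.range N).image L).card := by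
  refine Finset.card_lt_card ⟨?_, fun h => ?_⟩
  · intro z hz
    simp only [Finset.mem_image, Finset.mem_range] at hz ⊢
    obtain ⟨p, hp, rfl⟩ := hz
    rw [hL p hp]
    split_ifs
    exacts [hy, ⟨p, hp, rfl⟩]
  · have hx' : x ∈ (Finset.range N).image L' := by
      apply h
      simpa using hx
    simp only [Finset.mem_image, Finset.mem_range] at hx'
    obtain ⟨p, hp, h'⟩ := hx'
    rw [hL p hp] at h'
    split_ifs at h' with h''
    exacts [hxy h'.symm, h'' h']

-- Every round but the last destroys a label, and there are as many labels as nodes at most. So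
-- linearly many rounds of linear cost suffice.
variable (φ b code) in
theorem foldProg_runs (hcode : Function.Injective code) (hb : 3 ≤ b) :
    ∃ K, ∀ (hs : List (List (Letter X))) (σ : Store), FoldCtx R b code hs σ →
      FoldInv φ b hs σ → Runs (foldProg φ b code) σ (K * (hs.flatten.length + 1) ^ 2) fun τ =>
        FoldCtx R b code hs τ ∧ FoldInv φ b hs τ ∧ HoldsFolded φ b hs τ := by
  set S := Nat.card (Σ i, PresentedGroup (R i)) with hS
  refine ⟨(S + 3) * ((S + 2) * foldConst φ b code + 2) + 2, fun hs σ hctx hσ => ?_⟩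
  set m := hs.flatten.length with hm
  obtain ⟨τ₁, t₁, e₁, l₁, q₁⟩ := Runs.of_run (P := .assign 10 (.const 1)) (σ := σ)
    (Q := fun τ => τ.arr = σ.arr ∧ τ.reg 10 = 1) (by simp) (by simp)
  have c₁ := hctx.frame e₁.frame (by simp) (by simp) (by simp) (by simp) (by simp)
  have i₁ : FoldInv φ b hs τ₁ :=
    ⟨by rw [q₁.1]; exact hσ.1, by rw [q₁.1]; exact hσ.2, by rw [q₁.1]; exact hσ.3⟩
  let card (τ : Store) : ℕ := ((Finset.range ((m + 1) * S)).image (τ.arr b)).card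
  -- The measure is the number of labels in use, plus one as long as the flag is set. The final
  -- round merges nothing but resets the flag.
  let I : ℕ → Store → Prop := fun k τ => FoldInv φ b hs τ ∧
    (τ.reg 10 = 0 → HoldsFolded φ b hs τ) ∧ k = card τ + if τ.reg 10 = 0 then 0 else 1
  have hkeep : ∀ {r}, r ≠ 5 → r ≠ 7 → r ≠ 8 → r ≠ 9 → r ≠ 10 →
      (Prog.while (.reg 10) (foldBody φ b code)).KeepsReg r := fun h5 h7 h8 h9 h10 =>
    keepsReg_foldBody (φ := φ) (code := code) h5 h7 h8 h9 h10
  have hkeepA : ∀ {a}, a < b + 9 → a ≠ b →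
      (Prog.while (.reg 10) (foldBody φ b code)).KeepsArr a := fun h h' =>
    keepsArr_foldBody (φ := φ) (code := code) h h'
  have hframe : ∀ τ, (Prog.while (.reg 10) (foldBody φ b code)).Frame τ₁ τ →
      FoldCtx R b code hs τ := fun τ hF =>
    c₁.frame hF (hkeepA (by omega) (by omega)) (hkeepA (by omega) (by omega))
      (hkeep (by simp) (by simp) (by simp) (by simp) (by simp))
      (hkeep (by simp) (by simp) (by simp) (by simp) (by simp))
      (hkeep (by simp) (by simp) (by simp) (by simp) (by simp))
  obtain ⟨τ₂, t₂, e₂, l₂, h10, k, q₂, q₂', -⟩ := Runs.whileLoop (P := foldBody φ b code)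
    (c := .reg 10) (σ := τ₁) (k := card τ₁ + 1)
    (T := ((m + 1) * S + m + 2) * foldConst φ b code) I
    ⟨i₁, by simp [q₁.2], by simp [q₁.2]⟩ (by
      rintro k τ hF ⟨h1, h2, h3⟩ hc
      refine (foldBody_runs hcode hb (hframe τ hF) h1).imp le_rfl ?_
      rintro υ - ⟨h4, h5, h6⟩
      refine ⟨_, ?_, h4, fun h => (h5 h).1, rfl⟩
      rw [h3, if_neg (show τ.reg 10 ≠ 0 from hc)]
      split_ifs with h
      · simp only [card, (h5 h).2]
        omega
      · obtain ⟨x, y, hxy, ⟨t, ht, t', ht', s, s', hx, hy, -⟩, hL⟩ := h6 h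
        exact Nat.add_lt_add_right (card_relabel_lt hxy ⟨_, node_lt ht s, hx⟩
          ⟨_, node_lt ht' s', hy⟩ hL) 1)
  refine ⟨τ₂, _, e₁.seq e₂, ?_, hframe _ e₂.frame, q₂, q₂' (by simpa using h10)⟩
  have hcard : card τ₁ ≤ (m + 1) * S := by
    refine Finset.card_image_le.trans ?_
    simp
  simp only [bound, Expr.cost] at l₁ l₂
  have h1 : card τ₁ + 1 + 1 ≤ (S + 2) * (m + 1) := by nlinarith
  have h2 : ((m + 1) * S + m + 2) * foldConst φ b code + 1 + 1 ≤
      ((S + 2) * foldConst φ b code + 2) * (m + 1) := by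
    have : (m + 1) * S + m + 2 ≤ (S + 2) * (m + 1) := by nlinarith
    nlinarith [Nat.mul_le_mul_right (foldConst φ b code) this]
  calc t₁ + t₂ ≤ 2 + ((S + 2) * (m + 1)) * (((S + 2) * foldConst φ b code + 2) * (m + 1)) :=
        Nat.add_le_add l₁ (l₂.trans (Nat.mul_le_mul h1 h2))
    _ = 2 + (S + 2) * ((S + 2) * foldConst φ b code + 2) * (m + 1) ^ 2 := by ring
    _ ≤ _ := by
      have : 1 ≤ (m + 1) ^ 2 := Nat.one_le_pow _ _ (Nat.succ_pos _)
      nlinarith [Nat.zero_le (((S + 2) * foldConst φ b code + 2) * (m + 1) ^ 2)]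

end Fold

end AmalgamMembership

namespace AmalgamMembership

open Prog

/-! ### The vertices that are reached by reduced paths -/

/-- A test for equality. -/
def isEq (e f : Expr) : Expr := .sub (.const 1) (neq e f)

@[simp] theorem eval_isEq (σ : Store) (e f : Expr) :
    (isEq e f).eval σ = 0 ↔ e.eval σ ≠ f.eval σ := by
  simp only [isEq, neq, Expr.eval]
  omega

/-- A test for two conditions. -/
def andE (e f : Expr) : Expr :=
  .sub (.const 1) (.add (.sub (.const 1) e) (.sub (.const 1) f))

@[simp] theorem eval_andE (σ : Store) (e f : Expr) :
    (andE e f).eval σ = 0 ↔ e.eval σ = 0 ∨ f.eval σ = 0 := by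
  simp only [andE, Expr.eval]
  omega

section Reach

variable {X : Fin 2 → Type*} {R : ∀ i, Set (FreeGroup (X i))}
  [∀ i, Finite (PresentedGroup (R i))] {A : Type*} [Group A] [Finite A]

/-- The number of the array that holds the edges with label `s`. -/
noncomputable def actArr (A : Type*) [Finite A] (b : ℕ) (s : Σ i, PresentedGroup (R i)) : ℕ :=
  b + 9 + enum (Sum.inl s : FoldLabel R A)

omit [Group A] in
theorem le_actArr (b : ℕ) (s : Σ i, PresentedGroup (R i)) : b + 9 ≤ actArr A b s :=
  Nat.le_add_right _ _

/-- The store holds a partial action on the vertices below `N`, with basepoint in register `12`. -/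
structure HoldsStep (A : Type*) [Finite A] (b N : ℕ)
    (Step : ℕ → (Σ i, PresentedGroup (R i)) → ℕ → Prop) (base : ℕ) (τ : Store) : Prop where
  reg_nodes : τ.reg 4 = N
  reg_base : τ.reg 12 = base
  step : ∀ s c d, τ.arr (actArr A b s) c = d + 1 ↔ Step c s d

variable {b N : ℕ} {Step : ℕ → (Σ i, PresentedGroup (R i)) → ℕ → Prop} {base : ℕ}

omit [Group A] in
theorem HoldsStep.frame {P : Prog} {σ τ : Store} (h : HoldsStep A b N Step base σ)
    (hF : P.Frame σ τ) (h4 : P.KeepsReg 4) (h12 : P.KeepsReg 12)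
    (ha : ∀ a, b + 9 ≤ a → P.KeepsArr a) : HoldsStep A b N Step base τ := by
  refine ⟨?_, ?_, fun s c d => ?_⟩
  · rw [hF.reg 4 h4, h.reg_nodes]
  · rw [hF.reg 12 h12, h.reg_base]
  · rw [hF.arr _ (ha _ (le_actArr b s)), h.step]

/-- The path ends in the vertex `e`, and can be continued in the factor `j`. -/
def entersExpr (b : ℕ) (j : Fin 2) (e : Expr) : Expr :=
  .add (.load (b + 2 + (j + 1 : Fin 2).val) e) (isEq e (.reg 12))

variable (A) in
open Classical in
/-- The continuation of the paths that end in the vertex in register `5` by `s`. -/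
noncomputable def enterProg (b : ℕ) (s : Σ i, PresentedGroup (R i)) : Prog :=
  .ite (andE (.load (actArr A b s) (.reg 5)) (entersExpr b s.1 (.reg 5)))
    (.ite (.load (b + 2 + s.1.val) (.sub (.load (actArr A b s) (.reg 5)) (.const 1))) skip
      (.seq (.assign 10 (.const 1))
        (.store (b + 2 + s.1.val) (.sub (.load (actArr A b s) (.reg 5)) (.const 1)) (.const 1))))
    skip

open Classical in
/-- The elements of the factors that are not in the amalgamated subgroup. -/
noncomputable def outer (φ : ∀ i, A →* PresentedGroup (R i)) :
    List (Σ i, PresentedGroup (R i)) :=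
  (elems (Σ i, PresentedGroup (R i))).filter fun s => s.2 ∉ (φ s.1).range

omit [Finite A] in
@[simp] theorem mem_outer {φ : ∀ i, A →* PresentedGroup (R i)} {s : Σ i, PresentedGroup (R i)} :
    s ∈ outer φ ↔ s.2 ∉ (φ s.1).range := by
  simp [outer]

/-- The part of a round for one vertex. -/
noncomputable def reachBody (φ : ∀ i, A →* PresentedGroup (R i)) (b : ℕ) : Prog :=
  seqL ((outer φ).map (enterProg A b))

/-- The computation of the vertices that are reached by reduced paths. -/
noncomputable def reachProg (φ : ∀ i, A →* PresentedGroup (R i)) (b : ℕ) : Prog :=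
  .seq (.assign 10 (.const 1)) (.while (.reg 10)
    (.seq (.assign 10 (.const 0)) (forLoop 5 4 (reachBody φ b))))

theorem loopFree_reachBody (φ : ∀ i, A →* PresentedGroup (R i)) (b : ℕ) :
    (reachBody φ b).LoopFree := by
  simp [reachBody, enterProg]

theorem keepsReg_reachBody (φ : ∀ i, A →* PresentedGroup (R i)) (b : ℕ) {r : ℕ} (hr : r ≠ 10) :
    (reachBody φ b).KeepsReg r := by
  simp [reachBody, enterProg, hr.symm]

theorem keepsArr_reachBody (φ : ∀ i, A →* PresentedGroup (R i)) {b a : ℕ} (h2 : a ≠ b + 2)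
    (h3 : a ≠ b + 3) : (reachBody φ b).KeepsArr a := by
  have : ∀ j : Fin 2, b + 2 + j.val ≠ a := fun j => by omega
  simp [reachBody, enterProg, this]

/-- The vertex `c` is entered, according to the arrays. -/
def EntersArr (b base : ℕ) (τ : Store) (j : Fin 2) (c : ℕ) : Prop :=
  τ.arr (b + 2 + (j + 1 : Fin 2).val) c ≠ 0 ∨ c = base

theorem eval_entersExpr {τ : Store} (h : τ.reg 12 = base) (j : Fin 2) (e : Expr) :
    (entersExpr b j e).eval τ = 0 ↔ ¬ EntersArr b base τ j (e.eval τ) := by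
  have : (entersExpr b j e).eval τ = τ.arr (b + 2 + (j + 1 : Fin 2).val) (e.eval τ) +
    (isEq e (.reg 12)).eval τ := rfl
  rw [this, Nat.add_eq_zero_iff, eval_isEq, EntersArr, not_or, not_not]
  simp [h]

/-- Nothing remains to be done for the vertex `c` and the element `s`. -/
def ClosedAt (b : ℕ) (Step : ℕ → (Σ i, PresentedGroup (R i)) → ℕ → Prop) (base : ℕ) (τ : Store)
    (c : ℕ) (s : Σ i, PresentedGroup (R i)) : Prop :=
  ∀ d, Step c s d → EntersArr b base τ s.1 c → τ.arr (b + 2 + s.1.val) d ≠ 0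

omit [Group A] in
theorem enterProg_run {τ : Store} (h : HoldsStep A b N Step base τ)
    (s : Σ i, PresentedGroup (R i)) :
    ((enterProg A b s).run τ = τ ∧ ClosedAt b Step base τ (τ.reg 5) s) ∨
    ∃ d, Step (τ.reg 5) s d ∧ EntersArr b base τ s.1 (τ.reg 5) ∧
      τ.arr (b + 2 + s.1.val) d = 0 ∧
      (enterProg A b s).run τ = (τ.setReg 10 1).setArr (b + 2 + s.1.val) d 1 := by
  rw [enterProg, run_ite]
  classical
  simp only [eval_andE, eval_entersExpr h.reg_base, Expr.eval]
  split_ifs with h1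
  · refine .inl ⟨run_skip τ, fun d hd he => ?_⟩
    rw [(h.step s _ d).2 hd] at h1
    rcases h1 with h1 | h1
    exacts [absurd h1 (Nat.succ_ne_zero d), absurd he h1]
  · rw [not_or, not_not] at h1
    obtain ⟨d, hd⟩ := Nat.exists_eq_succ_of_ne_zero h1.1
    have hs := (h.step s _ d).1 hd
    rw [run_ite]
    simp only [Expr.eval, hd, Nat.succ_eq_add_one, Nat.add_sub_cancel]
    split_ifs with h2
    · exact .inr ⟨d, hs, h1.2, h2, by simp [hd]⟩
    · refine .inl ⟨run_skip τ, fun d' hd' _ => ?_⟩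
      have : d' = d := by
        have := (h.step s _ d').2 hd'
        omega
      rwa [this]

variable {φ : ∀ i, A →* PresentedGroup (R i)}

/-- Only vertices that are reached are marked as such. -/
def ReachSound (φ : ∀ i, A →* PresentedGroup (R i)) (b : ℕ)
    (Step : ℕ → (Σ i, PresentedGroup (R i)) → ℕ → Prop) (base : ℕ) (τ : Store) : Prop :=
  ∀ (j : Fin 2) c, τ.arr (b + 2 + j.val) c ≠ 0 → FromBase φ Step base j c

/-- The state of a round that was started in `σ`. -/
structure ReachInv (φ : ∀ i, A →* PresentedGroup (R i)) (b N : ℕ)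
    (Step : ℕ → (Σ i, PresentedGroup (R i)) → ℕ → Prop) (base : ℕ) (σ τ : Store) : Prop where
  holds : HoldsStep A b N Step base τ
  sound : ReachSound φ b Step base τ
  mono : ∀ (j : Fin 2) c, σ.arr (b + 2 + j.val) c ≠ 0 → τ.arr (b + 2 + j.val) c ≠ 0
  same : τ.reg 10 = 0 → ∀ j : Fin 2, τ.arr (b + 2 + j.val) = σ.arr (b + 2 + j.val)
  change : τ.reg 10 ≠ 0 → ∃ (j : Fin 2) (c : ℕ), c < N ∧ σ.arr (b + 2 + j.val) c = 0 ∧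
    τ.arr (b + 2 + j.val) c ≠ 0

omit [Finite A] [∀ i, Finite (PresentedGroup (R i))] in
theorem EntersArr.enters {τ : Store} (h : ReachSound φ b Step base τ) {j : Fin 2} {c : ℕ}
    (he : EntersArr b base τ j c) : Enters φ Step base j c := by
  rcases he with he | rfl
  exacts [.inr (h _ _ he), .inl rfl]

theorem ReachInv.enterProg (hlt : ∀ {c s d}, Step c s d → c < N ∧ d < N) {σ τ : Store}
    (h : ReachInv φ b N Step base σ τ) {s : Σ i, PresentedGroup (R i)}
    (hs : s.2 ∉ (φ s.1).range) :
    ReachInv φ b N Step base σ ((enterProg A b s).run τ) ∧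
      (((AmalgamMembership.enterProg A b s).run τ).reg 10 = 0 →
        τ.reg 10 = 0 ∧ ClosedAt b Step base τ (τ.reg 5) s) := by
  rcases enterProg_run h.holds s with ⟨h1, h2⟩ | ⟨d, h1, h2, h3, h4⟩
  · rw [h1]
    exact ⟨h, fun h0 => ⟨h0, h2⟩⟩
  · rw [h4]
    refine ⟨⟨?_, ?_, ?_, by simp, fun _ => ?_⟩, by simp⟩
    · rw [← h4]
      refine h.holds.frame (frame_run _ τ) (by simp [AmalgamMembership.enterProg])
        (by simp [AmalgamMembership.enterProg]) fun a ha => ?_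
      have : ∀ j : Fin 2, b + 2 + j.val ≠ a := fun j => by omega
      simp [AmalgamMembership.enterProg, this]
    · intro j c
      rw [Store.arr_setArr_apply]
      split_ifs with hc
      · rintro -
        have : j = s.1 := Fin.ext (by omega)
        subst this
        rw [hc.2]
        exact .of_enters (h2.enters h.sound) h1 hs
      · exact h.sound j c
    · intro j c hc
      rw [Store.arr_setArr_apply]
      split_ifs
      exacts [one_ne_zero, h.mono j c hc]
    · refine ⟨s.1, d, (hlt h1).2, ?_, by simp⟩
      by_contra h0
      exact h.mono _ _ h0 h3

/-- As long as the flag in register 10 is 0, the arrays are those at the start of the round. What is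
verified in the course of an unchanged round thus holds for one and the same state. -/
theorem reachBody_run (hlt : ∀ {c s d}, Step c s d → c < N ∧ d < N) {σ τ : Store}
    (h : ReachInv φ b N Step base σ τ) :
    ReachInv φ b N Step base σ ((reachBody φ b).run τ) ∧
      (((reachBody φ b).run τ).reg 10 = 0 → τ.reg 10 = 0 ∧
        ∀ s : Σ i, PresentedGroup (R i), s.2 ∉ (φ s.1).range →
          ClosedAt b Step base σ (τ.reg 5) s) := by
  have hclosed : ∀ {υ : Store} {s c}, ReachInv φ b N Step base σ υ → υ.reg 10 = 0 →
      ClosedAt b Step base υ c s → ClosedAt b Step base σ c s := by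
    intro υ s c hυ h0 hc d hd he
    rw [← hυ.same h0]
    refine hc d hd ?_
    simpa only [EntersArr, hυ.same h0] using he
  obtain ⟨⟨h1, -, h3⟩, h4⟩ := run_seqL_map (l := outer φ) (f := enterProg A b) (σ := τ)
    (fun υ => ReachInv φ b N Step base σ υ ∧ υ.reg 5 = τ.reg 5 ∧ (υ.reg 10 = 0 → τ.reg 10 = 0))
    (fun s υ => υ.reg 10 = 0 → ClosedAt b Step base σ (τ.reg 5) s) ⟨h, rfl, id⟩
    (by
      rintro s hs υ ⟨h1, h2, h3⟩
      obtain ⟨h4, h5⟩ := h1.enterProg hlt (mem_outer.1 hs)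
      refine ⟨⟨h4, ?_, fun h0 => h3 (h5 h0).1⟩, fun h0 => ?_⟩
      · rw [run_reg (by simp [enterProg]), h2]
      · rw [← h2]
        exact hclosed h1 (h5 h0).1 (h5 h0).2)
    (by
      rintro s hs s' - υ ⟨h1, -, -⟩ h h0
      exact h ((h1.enterProg hlt (mem_outer.1 hs)).2 h0).1)
  exact ⟨h1, fun h0 => ⟨h3 h0, fun s hs => h4 s (mem_outer.2 hs) h0⟩⟩

/-- The number of vertices that are not yet marked. -/
noncomputable def unmarked (b N : ℕ) (τ : Store) : ℕ :=
  ((Finset.univ ×ˢ Finset.range N : Finset (Fin 2 × ℕ)).filter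
    fun p => τ.arr (b + 2 + p.1.val) p.2 = 0).card

/-- A least fixed point: a round either adds one of the at most 2N marks or certifies that the marks
are closed under reduced continuations. Each round is linear in N + 1. -/
theorem reachProg_runs (φ : ∀ i, A →* PresentedGroup (R i)) (b : ℕ) :
    ∃ K, ∀ (N : ℕ) (Step : ℕ → (Σ i, PresentedGroup (R i)) → ℕ → Prop) (base : ℕ) (σ : Store),
      (∀ c s d, Step c s d → c < N ∧ d < N) → HoldsStep A b N Step base σ →
      (∀ (j : Fin 2) c, σ.arr (b + 2 + j.val) c = 0) →
      Runs (reachProg φ b) σ (K * (N + 1) ^ 2) fun τ =>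
        ∀ (j : Fin 2) c, τ.arr (b + 2 + j.val) c ≠ 0 ↔ FromBase φ Step base j c := by
  refine ⟨2 * ((reachBody φ b).bound + 14) + 2, fun N Step base σ hlt hσ h0 => ?_⟩
  have hlt' : ∀ {c s d}, Step c s d → c < N ∧ d < N := fun h => hlt _ _ _ h
  obtain ⟨τ₁, t₁, e₁, l₁, q₁, q₁'⟩ := Runs.of_run (P := .assign 10 (.const 1)) (σ := σ)
    (Q := fun τ => τ.arr = σ.arr ∧ τ.reg 10 = 1) (by simp) (by simp)
  let I : ℕ → Store → Prop := fun k τ => HoldsStep A b N Step base τ ∧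
    ReachSound φ b Step base τ ∧
    (τ.reg 10 = 0 → ∀ c < N, ∀ s : Σ i, PresentedGroup (R i), s.2 ∉ (φ s.1).range →
      ClosedAt b Step base τ c s) ∧ k = unmarked b N τ + if τ.reg 10 = 0 then 0 else 1
  obtain ⟨τ₂, t₂, e₂, l₂, h10, k, h1, h2, h3, -⟩ := Runs.whileLoop
    (P := .seq (.assign 10 (.const 0)) (Prog.forLoop 5 4 (reachBody φ b))) (c := .reg 10)
    (σ := τ₁) (k := unmarked b N τ₁ + 1) (T := 2 + (N + 1) * ((reachBody φ b).bound + 10)) I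
    ⟨hσ.frame e₁.frame (by simp) (by simp) (by simp), by simp [ReachSound, q₁, h0],
      by simp [q₁'], by simp [q₁']⟩ (by
      rintro k τ - ⟨h1, h2, h3, h4⟩ hc
      obtain ⟨υ₁, s₁, f₁, m₁, p₁, p₁'⟩ := Runs.of_run (P := .assign 10 (.const 0)) (σ := τ)
        (Q := fun υ => υ.arr = τ.arr ∧ υ.reg 10 = 0) (by simp) (by simp)
      have i₁ : ReachInv φ b N Step base τ υ₁ := ⟨h1.frame f₁.frame (by simp) (by simp)
        (by simp), by simpa only [ReachSound, p₁] using h2, by simp [p₁], by simp [p₁],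
        by simp [p₁']⟩
      obtain ⟨υ₂, s₂, f₂, m₂, p₂, p₂'⟩ := Runs.forLoop (P := reachBody φ b) (r := 5) (lim := 4)
        (σ := υ₁) (loopFree_reachBody φ b) (keepsReg_reachBody φ b (by simp))
        (keepsReg_reachBody φ b (by simp)) (by simp) i₁.holds.reg_nodes
        (fun k υ => ReachInv φ b N Step base τ υ ∧ (υ.reg 10 = 0 → ∀ c < k,
          ∀ s : Σ i, PresentedGroup (R i), s.2 ∉ (φ s.1).range → ClosedAt b Step base τ c s))
        ⟨⟨⟨by simpa using i₁.1.1, by simpa using i₁.1.2, i₁.1.3⟩, i₁.2, i₁.3, by simpa using i₁.4,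
          by simpa using i₁.5⟩, by simp⟩ (by
          rintro k hk υ - h5 ⟨g1, g2⟩
          obtain ⟨g3, g4⟩ := reachBody_run hlt' g1
          refine ⟨⟨⟨by simpa using g3.1.1, by simpa using g3.1.2, g3.1.3⟩, g3.2, g3.3,
            by simpa using g3.4, by simpa using g3.5⟩, fun g0 c hc => ?_⟩
          have := g4 (by simpa using g0)
          rcases Nat.lt_succ_iff_lt_or_eq.1 hc with hc | rfl
          · exact g2 this.1 c hc
          · rw [← h5]; exact this.2)
      refine ⟨υ₂, _, f₁.seq f₂, Nat.add_le_add m₁ m₂, _, ?_, p₂.holds, p₂.sound, ?_, rfl⟩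
      · rw [h4, if_neg (show τ.reg 10 ≠ 0 from hc)]
        have hsub : (Finset.univ ×ˢ Finset.range N : Finset (Fin 2 × ℕ)).filter
            (fun p => υ₂.arr (b + 2 + p.1.val) p.2 = 0) ⊆
            (Finset.univ ×ˢ Finset.range N).filter
            (fun p => τ.arr (b + 2 + p.1.val) p.2 = 0) := by
          intro p hp
          rw [Finset.mem_filter] at hp ⊢
          refine ⟨hp.1, ?_⟩
          by_contra hne
          exact p₂.mono _ _ hne hp.2
        split_ifs with hz
        · have := Finset.card_le_card hsub
          simp only [unmarked]
          omega
        · obtain ⟨j, c, hc, g1, g2⟩ := p₂.change hz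
          have := Finset.card_lt_card ⟨hsub, fun hsub' => g2 (Finset.mem_filter.1
            (hsub' (Finset.mem_filter.2 ⟨by simpa using hc, g1⟩ :
              (j, c) ∈ _))).2⟩
          simp only [unmarked]
          omega
      · intro hz c hc s hs d hd he
        rw [p₂.same hz]
        refine p₂' hz c hc s hs d hd ?_
        simpa only [EntersArr, p₂.same hz] using he)
  refine ⟨τ₂, _, e₁.seq e₂, ?_, fun j c => ⟨h2 j c, fun h => ?_⟩⟩
  · have hcard : unmarked b N τ₁ ≤ 2 * N := by
      refine (Finset.card_filter_le _ _).trans ?_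
      simp
    simp only [bound, Expr.cost] at l₁ l₂
    have g1 : unmarked b N τ₁ + 1 + 1 ≤ 2 * (N + 1) := by omega
    have g2 : 2 + (N + 1) * ((reachBody φ b).bound + 10) + 1 + 1 ≤
        ((reachBody φ b).bound + 14) * (N + 1) := by nlinarith
    calc t₁ + t₂ ≤ 2 + (2 * (N + 1)) * (((reachBody φ b).bound + 14) * (N + 1)) :=
          Nat.add_le_add l₁ (l₂.trans (Nat.mul_le_mul g1 g2))
      _ = 2 + 2 * ((reachBody φ b).bound + 14) * (N + 1) ^ 2 := by ring
      _ ≤ _ := by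
        have : 1 ≤ (N + 1) ^ 2 := Nat.one_le_pow _ _ (Nat.succ_pos _)
        nlinarith
  · have h3 := h3 h10
    -- The final marks are closed, so they contain the inductively defined set.
    induction h with
    | start hs hg => exact h3 _ (hlt' hs).1 ⟨_, _⟩ hg _ hs (.inr rfl)
    | step _ hs hg ih => exact h3 _ (hlt' hs).1 ⟨_, _⟩ hg _ hs (.inl ih)

end Reach

end AmalgamMembership

namespace AmalgamMembership

open Prog

/-! ### The orbits of the normal core and the numbering of its vertices -/

section Mark

variable {X : Fin 2 → Type*} {R : ∀ i, Set (FreeGroup (X i))}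
  [∀ i, Finite (PresentedGroup (R i))] {A : Type*} [Group A] [Finite A]

open Classical in
/-- The condition for the orbit of the vertex in register `5` that belongs to a pair of elements. -/
noncomputable def markExpr (φ : ∀ i, A →* PresentedGroup (R i)) (b : ℕ)
    (p : Σ i, PresentedGroup (R i) × PresentedGroup (R i)) : Expr :=
  let e : Expr := .load (actArr A b ⟨p.1, p.2.1⟩) (.reg 5)
  let d : Expr := .sub e (.const 1)
  let d' : Expr := .sub (.load (actArr A b ⟨p.1, p.2.2⟩) d) (.const 1)
  if p.2.2 ∈ (φ p.1).range then
    if p.2.2 = 1 then .const 0 else andE e (andE (isEq d (.reg 12)) (isEq d' (.reg 12)))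
  else andE e (andE (entersExpr b p.1 d) (entersExpr b p.1 d'))

/-- The orbits of the vertex in register `5` are marked if they lie in the normal core. -/
noncomputable def markBody (φ : ∀ i, A →* PresentedGroup (R i)) (b : ℕ) : Prog :=
  seqL ((elems (Σ i, PresentedGroup (R i) × PresentedGroup (R i))).map fun p =>
    .ite (markExpr φ b p) (.store (b + 4 + p.1.val) (.reg 5) (.const 1)) skip)

variable {φ : ∀ i, A →* PresentedGroup (R i)} {b N : ℕ}
  {Step : ℕ → (Σ i, PresentedGroup (R i)) → ℕ → Prop} {base : ℕ}

theorem markExpr_sound (hS : IsPrecover φ Step) {τ : Store} (h : HoldsStep A b N Step base τ)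
    (hR : ∀ (j : Fin 2) c, τ.arr (b + 2 + j.val) c ≠ 0 ↔ FromBase φ Step base j c)
    {p : Σ i, PresentedGroup (R i) × PresentedGroup (R i)}
    (hp : (markExpr φ b p).eval τ ≠ 0) : Marked φ Step base p.1 (τ.reg 5) := by
  obtain ⟨j, k, g⟩ := p
  have hE : ∀ c, EntersArr b base τ j c → Enters φ Step base j c := fun c hc =>
    hc.enters fun j c => (hR j c).1
  -- If the cell for k is non-zero, then the factor j acts at d, and by totality the cell for g is
  -- non-zero as well. This is why the test examines only the first cell before it subtracts one
  -- from both.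
  have key : (Expr.load (actArr A b ⟨j, k⟩) (.reg 5)).eval τ ≠ 0 →
      ∃ d d', Step (τ.reg 5) ⟨j, k⟩ d ∧ Step d ⟨j, g⟩ d' ∧
        τ.arr (actArr A b ⟨j, k⟩) (τ.reg 5) = d + 1 ∧ τ.arr (actArr A b ⟨j, g⟩) d = d' + 1 := by
    intro h0
    obtain ⟨d, hd⟩ := Nat.exists_eq_succ_of_ne_zero h0
    have h1 := (h.step _ _ _).1 hd
    obtain ⟨d', hd'⟩ := hS.total (hS.inv h1) g
    exact ⟨d, d', h1, hd', hd, (h.step _ _ _).2 hd'⟩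
  dsimp only [markExpr] at hp
  split_ifs at hp with h1 h2
  · exact absurd rfl hp
  · rw [ne_eq, eval_andE, eval_andE, not_or, not_or] at hp
    obtain ⟨d, d', s1, s2, a1, a2⟩ := key hp.1
    have h3 := hp.2.1
    have h4 := hp.2.2
    rw [eval_isEq, not_not] at h3 h4
    simp only [Expr.eval, a1, Nat.add_sub_cancel, a2, h.reg_base] at h3 h4
    subst h3 h4
    exact .inr ⟨k, g, s1, s2, h2⟩
  · rw [ne_eq, eval_andE, eval_andE, not_or, not_or] at hp
    obtain ⟨d, d', s1, s2, a1, a2⟩ := key hp.1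
    have h3 := hp.2.1
    have h4 := hp.2.2
    rw [eval_entersExpr h.reg_base, not_not] at h3 h4
    simp only [Expr.eval, a1, Nat.add_sub_cancel, a2] at h3 h4
    exact .inl ⟨k, g, d, d', s1, s2, h1, hE d h3, hE d' h4⟩

theorem markExpr_complete {τ : Store}
    (h : HoldsStep A b N Step base τ)
    (hR : ∀ (j : Fin 2) c, τ.arr (b + 2 + j.val) c ≠ 0 ↔ FromBase φ Step base j c) {j : Fin 2}
    (hM : Marked φ Step base j (τ.reg 5)) : ∃ k g, (markExpr φ b ⟨j, k, g⟩).eval τ ≠ 0 := by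
  have hE : ∀ c, Enters φ Step base j c → EntersArr b base τ j c := by
    rintro c (rfl | hc)
    exacts [.inr rfl, .inl ((hR _ _).2 hc)]
  -- Both kinds of marks are brought into one form. An element g in A can only come from the second
  -- kind, where both ends are the basepoint; for g outside A a loop at the basepoint also passes
  -- the test of the first kind.
  obtain ⟨k, g, d, d', s1, s2, hg, h1, h2, h3⟩ : ∃ k g d d', Step (τ.reg 5) ⟨j, k⟩ d ∧
      Step d ⟨j, g⟩ d' ∧ g ≠ 1 ∧ EntersArr b base τ j d ∧ EntersArr b base τ j d' ∧
      (g ∈ (φ j).range → d = base ∧ d' = base) := by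
    rcases hM with ⟨k, g, d, d', s1, s2, hg, h1, h2⟩ | ⟨k, g, s1, s2, hg⟩
    · exact ⟨k, g, d, d', s1, s2, fun h => hg (h ▸ one_mem _), hE _ h1, hE _ h2,
        fun h => absurd h hg⟩
    · exact ⟨k, g, base, base, s1, s2, hg, .inr rfl, .inr rfl, fun _ => ⟨rfl, rfl⟩⟩
  have a1 := (h.step _ _ _).2 s1
  have a2 := (h.step _ _ _).2 s2
  refine ⟨k, g, ?_⟩
  dsimp only [markExpr]
  split_ifs with h4
  · obtain ⟨rfl, rfl⟩ := h3 h4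
    rw [ne_eq, eval_andE, eval_andE, eval_isEq, eval_isEq, not_or, not_or, not_not, not_not]
    simp only [Expr.eval, a1, Nat.add_sub_cancel, a2, h.reg_base]
    exact ⟨Nat.succ_ne_zero _, trivial, trivial⟩
  · rw [ne_eq, eval_andE, eval_andE, eval_entersExpr h.reg_base, eval_entersExpr h.reg_base,
      not_or, not_or, not_not, not_not]
    simp only [Expr.eval, a1, Nat.add_sub_cancel, a2]
    exact ⟨Nat.succ_ne_zero d, h1, h2⟩

/-- The orbits of the normal core are marked. -/
noncomputable def markProg (φ : ∀ i, A →* PresentedGroup (R i)) (b : ℕ) : Prog :=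
  forLoop 5 4 (markBody φ b)

theorem keepsReg_markBody (φ : ∀ i, A →* PresentedGroup (R i)) (b r : ℕ) :
    (markBody φ b).KeepsReg r := by
  simp [markBody]

theorem keepsArr_markBody (φ : ∀ i, A →* PresentedGroup (R i)) {b a : ℕ} (h4 : a ≠ b + 4)
    (h5 : a ≠ b + 5) : (markBody φ b).KeepsArr a := by
  have : ∀ j : Fin 2, b + 4 + j.val ≠ a := fun j => by omega
  simp [markBody, this]

theorem markProg_runs (hS : IsPrecover φ Step) {σ : Store} (h : HoldsStep A b N Step base σ)
    (hR : ∀ (j : Fin 2) c, σ.arr (b + 2 + j.val) c ≠ 0 ↔ FromBase φ Step base j c)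
    (h0 : ∀ (j : Fin 2) c, σ.arr (b + 4 + j.val) c = 0) :
    Runs (markProg φ b) σ ((N + 1) * ((markBody φ b).bound + 10)) fun τ =>
      ∀ (j : Fin 2) c, τ.arr (b + 4 + j.val) c ≠ 0 ↔ c < N ∧ Marked φ Step base j c := by
  refine Runs.forLoop (by simp [markBody]) (keepsReg_markBody φ b 5) (keepsReg_markBody φ b 4)
    (by simp) h.reg_nodes
    (fun k τ => ∀ (j : Fin 2) c, τ.arr (b + 4 + j.val) c ≠ 0 ↔ c < k ∧ Marked φ Step base j c)
    (by simp [h0]) ?_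
  intro k hk τ hF h5 hτ
  have hk4 : ∀ a, (a ≠ b + 4 ∧ a ≠ b + 5) → (markBody φ b).KeepsArr a := fun a ha =>
    keepsArr_markBody φ ha.1 ha.2
  have hτS : HoldsStep A b N Step base τ := h.frame hF
    (by simp [keepsReg_markBody]) (by simp [keepsReg_markBody])
    (fun a ha => by simp [hk4 a (by omega)])
  have hτR : ∀ (j : Fin 2) c, τ.arr (b + 2 + j.val) c ≠ 0 ↔ FromBase φ Step base j c := by
    intro j c
    rw [hF.arr _ (by simp [hk4 (b + 2 + j.val) (by omega)]), hR]
  let J : Store → Prop := fun υ => HoldsStep A b N Step base υ ∧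
    (∀ (j : Fin 2) c, υ.arr (b + 2 + j.val) c ≠ 0 ↔ FromBase φ Step base j c) ∧ υ.reg 5 = k ∧
    (∀ (j : Fin 2) c, c ≠ k → (υ.arr (b + 4 + j.val) c ≠ 0 ↔ c < k ∧ Marked φ Step base j c)) ∧
    ∀ (j : Fin 2), υ.arr (b + 4 + j.val) k ≠ 0 → Marked φ Step base j k
  obtain ⟨⟨-, -, -, h1, h2⟩, h3⟩ := run_seqL_map (σ := τ)
    (l := elems (Σ i, PresentedGroup (R i) × PresentedGroup (R i)))
    (f := fun p => .ite (markExpr φ b p) (.store (b + 4 + p.1.val) (.reg 5) (.const 1)) skip) J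
    (fun p υ => (markExpr φ b p).eval τ ≠ 0 → υ.arr (b + 4 + p.1.val) k ≠ 0)
    ⟨hτS, hτR, h5, fun j c _ => hτ j c, fun j hj => ((hτ j k).1 hj).2⟩
    (by
      rintro p - υ ⟨g1, g2, g3, g4, g5⟩
      -- The test does not depend on the arrays that are written here, so its truth is that at the
      -- start of the body.
      have heq : (markExpr φ b p).eval υ ≠ 0 ↔ (markExpr φ b p).eval τ ≠ 0 := by
        have e1 : ∀ (s : Σ i, PresentedGroup (R i)) c, υ.arr (actArr A b s) c = τ.arr (actArr A b s) c := by
          intro s c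
          have : ∀ d, υ.arr (actArr A b s) c = d + 1 ↔ τ.arr (actArr A b s) c = d + 1 :=
            fun d => (g1.step s c d).trans (hτS.step s c d).symm
          rcases h : τ.arr (actArr A b s) c with _ | d
          · by_contra hne
            obtain ⟨d, hd⟩ := Nat.exists_eq_succ_of_ne_zero hne
            rw [(this d).1 hd] at h
            simp at h
          · exact (this d).2 h
        have e2 : ∀ (j : Fin 2) c, EntersArr b base υ j c ↔ EntersArr b base τ j c := by
          intro j c
          simp only [EntersArr, g2, hτR]
        have e3 : ∀ e : Expr, (isEq e (.reg 12)).eval υ = 0 ↔ e.eval υ ≠ base := by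
          intro e; rw [eval_isEq]; simp [g1.reg_base]
        have e4 : ∀ e : Expr, (isEq e (.reg 12)).eval τ = 0 ↔ e.eval τ ≠ base := by
          intro e; rw [eval_isEq]; simp [hτS.reg_base]
        dsimp only [markExpr]
        split_ifs <;> simp only [ne_eq, eval_andE, eval_entersExpr g1.reg_base,
          eval_entersExpr hτS.reg_base, e2, e3, e4, Expr.eval, e1, g3, h5]
      rw [run_ite]
      split_ifs with hp
      · rw [run_skip]
        exact ⟨⟨g1, g2, g3, g4, g5⟩, fun h => absurd hp (heq.2 h)⟩
      · have hM := markExpr_sound hS g1 g2 hp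
        rw [g3] at hM
        simp only [run_store, Expr.eval, g3]
        refine ⟨⟨⟨g1.1, g1.2, fun s c d => ?_⟩, fun j c => ?_, g3, fun j c hc => ?_,
          fun j => ?_⟩, fun _ => by simp⟩
        · have := le_actArr (A := A) b s
          rw [Store.arr_setArr_of_ne _ (by omega), g1.step]
        · rw [Store.arr_setArr_of_ne _ (by omega), g2]
        · rw [Store.arr_setArr_apply, if_neg fun h => hc h.2, g4 j c hc]
        · rw [Store.arr_setArr_apply]
          split_ifs with hj
          · rintro -
            obtain rfl : j = p.1 := Fin.ext (by omega)
            exact hM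
          · exact g5 j)
    (by
      rintro p - q - υ - hq hq'
      have := hq hq'
      rw [run_ite]
      split_ifs
      · rwa [run_skip]
      · rw [run_store, Store.arr_setArr_apply]
        split_ifs
        exacts [one_ne_zero, this])
  intro j c
  rw [Store.arr_setReg]
  by_cases hc : c = k
  · subst hc
    refine ⟨fun h => ⟨Nat.lt_succ_self _, h2 j h⟩, fun h => ?_⟩
    obtain ⟨k', g, h'⟩ := markExpr_complete hτS hτR (by rw [h5]; exact h.2)
    exact h3 ⟨j, k', g⟩ (by simp) h'
  · exact (h1 j c hc).trans ⟨fun h => ⟨by omega, h.2⟩, fun h => ⟨by omega, h.2⟩⟩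

/-- The part of the numbering for one vertex. -/
def numBody (b : ℕ) : Prog :=
  .ite (andE (neq (.reg 5) (.reg 12)) (.add (.load (b + 4) (.reg 5)) (.load (b + 5) (.reg 5))))
    (.seq (.store (b + 7) (.reg 13) (.reg 5)) (.seq (.assign 13 (.add (.reg 13) (.const 1)))
      (.store (b + 6) (.reg 5) (.reg 13)))) skip

/-- The numbering of the vertices of the normal core. -/
def numProg (b : ℕ) : Prog :=
  .seq (.seq (.store (b + 6) (.reg 12) (.const 1)) (.seq (.store (b + 7) (.const 0) (.reg 12))
    (.assign 13 (.const 1)))) (forLoop 5 4 (numBody b))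

/-- The numbering of the vertices with property `p`: register `13` holds their number, array
`b + 7` the vertices, and array `b + 6` their numbers, increased by `1`. -/
structure Numbered (b base : ℕ) (p : ℕ → Prop) (τ : Store) : Prop where
  pos : 0 < τ.reg 13
  zero : τ.arr (b + 7) 0 = base
  vtx : ∀ i < τ.reg 13, p (τ.arr (b + 7) i) ∧ τ.arr (b + 6) (τ.arr (b + 7) i) = i + 1
  num : ∀ c, p c → ∃ i < τ.reg 13, τ.arr (b + 7) i = c

/-- The basepoint gets the number 0 before the loop and is skipped in it. The bound N + 1 needs no
assumption that the basepoint is below N. -/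
theorem numProg_runs {b N base : ℕ} {σ : Store} (h4 : σ.reg 4 = N) (h12 : σ.reg 12 = base) :
    Runs (numProg b) σ ((N + 2) * 100) fun τ => τ.reg 13 ≤ N + 1 ∧ Numbered b base (fun c =>
      c = base ∨ c < N ∧ (σ.arr (b + 4) c ≠ 0 ∨ σ.arr (b + 5) c ≠ 0)) τ := by
  obtain ⟨τ₁, t₁, e₁, l₁, q₁, q₂, q₃⟩ := Runs.of_run
    (P := .seq (.store (b + 6) (.reg 12) (.const 1)) (.seq (.store (b + 7) (.const 0) (.reg 12))
      (.assign 13 (.const 1)))) (σ := σ)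
    (Q := fun τ => τ.reg 13 = 1 ∧ τ.arr (b + 7) 0 = base ∧ τ.arr (b + 6) base = 1) (by simp)
    (by simp [h12, Store.arr_setArr_apply])
  have r4 : τ₁.reg 4 = N := by rw [e₁.frame.reg 4 (by simp), h4]
  have r12 : τ₁.reg 12 = base := by rw [e₁.frame.reg 12 (by simp), h12]
  have m4 : τ₁.arr (b + 4) = σ.arr (b + 4) := e₁.frame.arr _ (by simp)
  have m5 : τ₁.arr (b + 5) = σ.arr (b + 5) := e₁.frame.arr _ (by simp)
  obtain ⟨τ₂, t₂, e₂, l₂, q₄⟩ := Runs.forLoop (P := numBody b) (r := 5) (lim := 4) (σ := τ₁)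
    (by simp [numBody]) (by simp [numBody]) (by simp [numBody]) (by simp) r4
    (fun k τ => τ.reg 13 ≤ k + 1 ∧ Numbered b base (fun c =>
      c = base ∨ c < k ∧ (σ.arr (b + 4) c ≠ 0 ∨ σ.arr (b + 5) c ≠ 0)) τ)
    (by
      refine ⟨by simp [q₁], ⟨by simp [q₁], by simpa using q₂, ?_, ?_⟩⟩
      · intro i hi
        have : i = 0 := by simpa [q₁] using hi
        subst this
        simp [q₂, q₃]
      · rintro c (rfl | ⟨h, -⟩)
        · exact ⟨0, by simp [q₁], by simpa using q₂⟩
        · simp at h)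
    (by
      rintro k hk τ hF h5 ⟨h1, h2⟩
      have g12 : τ.reg 12 = base := by rw [hF.reg 12 (by simp [numBody]), r12]
      have g4 : τ.arr (b + 4) = σ.arr (b + 4) := by rw [hF.arr _ (by simp [numBody]), m4]
      have g5 : τ.arr (b + 5) = σ.arr (b + 5) := by rw [hF.arr _ (by simp [numBody]), m5]
      rw [numBody, run_ite]
      simp only [eval_andE, eval_neq, Expr.eval, h5, g12, g4, g5, Nat.add_eq_zero_iff]
      split_ifs with hc
      · rw [run_skip]
        refine ⟨by simp; omega, ⟨by simpa using h2.1, by simpa using h2.2, fun i hi => ?_,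
          fun c hc' => ?_⟩⟩
        · obtain ⟨h3, h4⟩ := h2.vtx i (by simpa using hi)
          refine ⟨?_, h4⟩
          rcases h3 with h3 | h3
          exacts [.inl h3, .inr ⟨by simpa using h3.1.trans (Nat.lt_succ_self k), h3.2⟩]
        · refine (h2.num c ?_).imp fun i hi => ⟨by simpa using hi.1, hi.2⟩
          rcases hc' with hc' | ⟨h3, h4⟩
          · exact .inl hc'
          · rcases Nat.lt_succ_iff_lt_or_eq.1 h3 with h3 | rfl
            · exact .inr ⟨h3, h4⟩
            · rcases hc with hc | hc
              · exact .inl hc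
              · rcases h4 with h4 | h4
                exacts [absurd hc.1 h4, absurd hc.2 h4]
      · rw [not_or, not_and_or] at hc
        have hnew : ∀ i < τ.reg 13, τ.arr (b + 7) i ≠ k := by
          intro i hi hik
          rcases (h2.vtx i hi).1 with h3 | h3
          · exact hc.1 (hik ▸ h3)
          · omega
        simp only [run_seq, run_store, run_assign, Expr.eval]
        refine ⟨by simp; omega, ⟨by simp, ?_, fun i hi => ?_, fun c hc' => ?_⟩⟩
        · simp only [Store.arr_setReg, Store.arr_setArr_apply]
          rw [if_neg (by simp), if_neg (by have := h2.pos; omega), h2.zero]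
        · simp only [Store.reg_setReg, Store.reg_setArr, Nat.reduceEqDiff, reduceIte] at hi
          simp only [Store.arr_setReg, Store.arr_setArr_apply, Nat.add_left_cancel_iff,
            Nat.reduceEqDiff, false_and, true_and, reduceIte, Store.reg_setReg,
            Store.reg_setArr, h5]
          rcases Nat.lt_succ_iff_lt_or_eq.1 hi with hi | rfl
          · rw [if_neg (by omega), if_neg (hnew i hi)]
            obtain ⟨h3, h4⟩ := h2.vtx i hi
            exact ⟨h3.imp id fun h3 => ⟨by omega, h3.2⟩, h4⟩
          · simp only [reduceIte, and_true]
            exact .inr ⟨by omega, hc.2⟩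
        · simp only [Store.arr_setReg, Store.arr_setArr_apply, Nat.add_left_cancel_iff,
            Nat.reduceEqDiff, false_and, true_and, reduceIte, Store.reg_setReg,
            Store.reg_setArr, h5]
          by_cases hck : c = k
          · exact ⟨τ.reg 13, by omega, by simp [hck]⟩
          · obtain ⟨i, hi, hic⟩ := h2.num c (hc'.imp id fun h => ⟨by omega, h.2⟩)
            exact ⟨i, by omega, by rw [if_neg (by omega), hic]⟩)
  refine ⟨τ₂, _, e₁.seq e₂, ?_, q₄⟩
  simp only [bound, Expr.cost, numBody, andE, neq, skip] at l₁ l₂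
  omega

end Mark

end AmalgamMembership

namespace AmalgamMembership

open Prog

/-! ### The graph -/

section Graph

variable {X : Fin 2 → Type*} [∀ i, Finite (X i)] {R : ∀ i, Set (FreeGroup (X i))}
  [∀ i, Finite (PresentedGroup (R i))] {A : Type*} [Group A] [Finite A]

variable (R A) in
/-- The edges with label `x` of the vertex whose number is in register `5`. -/
noncomputable def outLetter (b : ℕ) (code : Letter X → ℕ) (x : Letter X) : Prog :=
  .ite (.load (b + 4 + x.1.1.val) (.load (b + 7) (.reg 5)))
    (.store (3 + code x) (.reg 5) (.load (b + 6)
      (.sub (.load (actArr A b (letterElt R x)) (.load (b + 7) (.reg 5))) (.const 1))))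
    (.store (3 + code x) (.reg 5) (.const 0))

variable (R A) in
/-- The output of the graph. -/
noncomputable def outProg (b : ℕ) (code : Letter X → ℕ) : Prog :=
  forLoop 5 13 (seqL ((elems (Letter X)).map (outLetter R A b code)))

omit [∀ i, Finite (X i)] in
/-- The entry of the table for the vertex with number `i` and the letter `x`. -/
noncomputable def outVal (R : ∀ i, Set (FreeGroup (X i))) [∀ i, Finite (PresentedGroup (R i))]
    (A : Type*) [Finite A] (b : ℕ) (σ : Store) (i : ℕ) (x : Letter X) : ℕ :=
  if σ.arr (b + 4 + x.1.1.val) (σ.arr (b + 7) i) = 0 then 0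
  else σ.arr (b + 6) (σ.arr (actArr A b (letterElt R x)) (σ.arr (b + 7) i) - 1)

variable {b : ℕ} {code : Letter X → ℕ}

-- The tables that are read lie in the arrays from b on and the output below b, so writing does not
-- disturb reading.
omit [Group A] in
theorem outProg_runs (hcode : Function.Injective code) (hb : ∀ x, 3 + code x < b) (σ : Store) :
    Runs (outProg R A b code) σ ((σ.reg 13 + 1) *
      ((seqL ((elems (Letter X)).map (outLetter R A b code))).bound + 10)) fun τ =>
        ∀ i < σ.reg 13, ∀ x, τ.arr (3 + code x) i = outVal R A b σ i x := by
  have hk : ∀ a, b ≤ a → (seqL ((elems (Letter X)).map (outLetter R A b code))).KeepsArr a := by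
    intro a ha
    have : ∀ x, 3 + code x ≠ a := fun x => by have := hb x; omega
    simp [outLetter, this]
  refine Runs.forLoop (by simp [outLetter]) (by simp [outLetter]) (by simp [outLetter]) (by simp)
    rfl (fun k τ => ∀ i < k, ∀ x, τ.arr (3 + code x) i = outVal R A b σ i x) (by simp) ?_
  intro k hk' τ hF h5 hτ
  have hgt : ∀ a, b ≤ a → τ.arr a = σ.arr a := fun a ha => hF.arr a (by
    rw [keepsArr_forLoop]; exact hk a ha)
  obtain ⟨⟨h1, -, h2⟩, h3⟩ := run_seqL_map (σ := τ) (l := elems (Letter X))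
    (f := outLetter R A b code)
    (fun υ => (∀ a, b ≤ a → υ.arr a = σ.arr a) ∧ υ.reg 5 = k ∧
      ∀ i < k, ∀ x, υ.arr (3 + code x) i = outVal R A b σ i x)
    (fun x υ => υ.arr (3 + code x) k = outVal R A b σ k x) ⟨hgt, h5, hτ⟩
    (by
      rintro x - υ ⟨g1, g2, g3⟩
      have hrun : (outLetter R A b code x).run υ =
          υ.setArr (3 + code x) k (outVal R A b σ k x) := by
        have := le_actArr (A := A) b (letterElt R x)
        rw [outLetter, run_ite]
        simp only [Expr.eval, g2, g1 (b + 7) (by omega), g1 (b + 4 + x.1.1.val) (by omega),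
          outVal, run_store, g1 (b + 6) (by omega), g1 (actArr A b (letterElt R x)) (by omega)]
        split_ifs <;> rfl
      rw [hrun]
      refine ⟨⟨fun a ha => ?_, g2, fun i hi y => ?_⟩, by simp⟩
      · have := hb x
        rw [Store.arr_setArr_of_ne _ (by omega), g1 a ha]
      · rw [Store.arr_setArr_apply, if_neg (by omega), g3 i hi])
    (by
      rintro x - y - υ ⟨g1, g2, g3⟩ h
      by_cases hxy : y = x
      · subst hxy
        rw [outLetter, run_ite]
        have := le_actArr (A := A) b (letterElt R y)
        simp only [Expr.eval, g2, g1 (b + 7) (by omega), g1 (b + 4 + y.1.1.val) (by omega),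
          outVal, run_store, g1 (b + 6) (by omega), g1 (actArr A b (letterElt R y)) (by omega)]
        split_ifs <;> simp
      · have hne : ¬ code x = code y := fun h => hxy (hcode h.symm)
        rw [run_arr (by simp [outLetter, hne]), h])
  intro i hi x
  rw [Store.arr_setReg]
  rcases Nat.lt_succ_iff_lt_or_eq.1 hi with hi | rfl
  exacts [h2 i hi x, h3 x (by simp)]

omit [∀ i, Finite (X i)] [∀ i, Finite (PresentedGroup (R i))] [Finite A] in
theorem Marked.live {φ : ∀ i, A →* PresentedGroup (R i)}
    {Step : ℕ → (Σ i, PresentedGroup (R i)) → ℕ → Prop} {base c : ℕ} {j : Fin 2}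
    (h : Marked φ Step base j c) : ∃ k d, Step c ⟨j, k⟩ d := by
  rcases h with ⟨k, g, d, d', h, -⟩ | ⟨k, g, h, -⟩
  exacts [⟨k, d, h⟩, ⟨k, base, h⟩]

-- The basepoint and all marked vertices carry an action, hence are determined by their cosets,
-- which makes the numbering of vertices a numbering of the core. The cells for x are to be used
-- only at vertices marked for the factor of x, since the model may have further edges outside the
-- core.
omit [∀ i, Finite (X i)] in
theorem holdsGraph_of_numbered {φ : ∀ i, A →* PresentedGroup (R i)}
    (hφ : ∀ i, Function.Injective (φ i)) {hs : List (List (Letter X))}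
    {Step : ℕ → (Σ i, PresentedGroup (R i)) → ℕ → Prop} {base N : ℕ}
    {cos : ℕ → Quotient (QuotientGroup.rightRel (generated φ hs))}
    (M : IsCoreModel φ hs Step base cos) {σ τ : Store} (hσ : HoldsStep A b N Step base σ)
    (hM : ∀ (j : Fin 2) c, σ.arr (b + 4 + j.val) c ≠ 0 ↔ Marked φ Step base j c)
    (hN : Numbered b base (fun c => c = base ∨ ∃ j, Marked φ Step base j c) σ)
    (h1 : τ.reg 1 = σ.reg 13)
    (hτ : ∀ i < σ.reg 13, ∀ x, τ.arr (3 + code x) i = outVal R A b σ i x) :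
    τ.HoldsGraph code (normalCore φ (generated φ hs)) := by
  set v : ℕ → ℕ := σ.arr (b + 7) with hv
  have hlive : ∀ c, (c = base ∨ ∃ j, Marked φ Step base j c) → ∃ s d, Step c s d := by
    rintro c (rfl | ⟨j, h⟩)
    · exact ⟨_, _, M.base_live 0⟩
    · obtain ⟨k, d, h⟩ := h.live
      exact ⟨_, _, h⟩
  have hinj : ∀ c d, (c = base ∨ ∃ j, Marked φ Step base j c) →
      (d = base ∨ ∃ j, Marked φ Step base j d) → cos c = cos d → c = d := by
    intro c d hc hd h
    obtain ⟨_, _, h1⟩ := hlive c hc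
    obtain ⟨_, _, h2⟩ := hlive d hd
    exact M.cos_injective hφ h1 h2 h
  have hnum : ∀ i < σ.reg 13, ∀ i' < σ.reg 13, v i = v i' → i = i' := by
    intro i hi i' hi' h
    have h1 := (hN.vtx i hi).2
    have h2 := (hN.vtx i' hi').2
    rw [← hv, h] at h1
    rw [← hv, h1] at h2
    omega
  refine ⟨fun i => cos (v i), ⟨?_, ?_, ?_⟩, ?_, ?_⟩
  · intro i hi
    exact (M.mem_verts_iff hφ).2 ⟨v i, rfl, (hN.vtx i (h1 ▸ hi)).1⟩
  · intro i hi i' hi' h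
    rw [h1, Set.mem_Iio] at hi hi'
    exact hnum i hi i' hi' (hinj _ _ (hN.vtx i hi).1 (hN.vtx i' hi').1 h)
  · intro w hw
    obtain ⟨c, rfl, hc⟩ := (M.mem_verts_iff hφ).1 hw
    obtain ⟨i, hi, rfl⟩ := hN.num c hc
    exact ⟨i, h1 ▸ hi, rfl⟩
  · show cos (v 0) = _
    rw [hv, hN.zero, M.cos_base]
    rfl
  · rw [h1]
    intro i hi x
    rw [hτ i hi x, outVal, ← hv]
    have hi' := hN.vtx i hi
    split_ifs with hm
    · refine ⟨Nat.zero_le _, fun j hj => ⟨fun h => by simp at h,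
        fun h => ?_⟩⟩
      obtain ⟨c, d, hc, -, h2, h3⟩ := (M.edge_iff hφ).1 h
      obtain rfl := hinj _ _ hi'.1 (.inr ⟨_, h3⟩) hc
      exact absurd hm ((hM _ _).2 h3)
    · have hmk := (hM _ _).1 hm
      obtain ⟨k, d', hd'⟩ := hmk.live
      obtain ⟨d, hd⟩ := M.total hd' (letterG R x)
      have hdm := M.marked_step hmk hd
      obtain ⟨i', hi1, hi2⟩ := hN.num d (.inr ⟨_, hdm⟩)
      have hval := (hN.vtx i' hi1).2
      rw [hi2] at hval
      rw [(hσ.step _ _ _).2 hd, Nat.add_sub_cancel, hval]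
      refine ⟨hi1, fun j hj => ?_⟩
      rw [Nat.add_right_cancel_iff]
      constructor
      · rintro rfl
        refine (M.edge_iff hφ).2 ⟨v i, v i', rfl, rfl, ?_, hmk⟩
        rw [hv, hi2]
        exact hd
      · intro h
        obtain ⟨c, e, hc, he, h2, h3⟩ := (M.edge_iff hφ).1 h
        obtain rfl := hinj _ _ hi'.1 (.inr ⟨_, h3⟩) hc
        obtain rfl := M.det hd h2
        have := hinj _ _ (hN.vtx j hj).1 (.inr ⟨_, hdm⟩) he
        exact hnum i' hi1 j hj (hi2.trans this.symm)

end Graph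

end AmalgamMembership

namespace AmalgamMembership

open Prog

/-! ### Normal forms -/

section NormalForm

variable {X : Fin 2 → Type*} {R : ∀ i, Set (FreeGroup (X i))}
  [∀ i, Finite (PresentedGroup (R i))] {A : Type*} [Group A] [Finite A]

/-- The store holds a stack of elements of the factors. -/
structure HoldsStack (b : ℕ) (l : List (Σ i, PresentedGroup (R i))) (τ : Store) : Prop where
  reg : τ.reg 14 = l.length
  arr : ∀ i (hi : i < l.length), τ.arr (b + 8) i = enum l[i]

/-- The program that puts an element on the stack. -/
noncomputable def pushProg (b : ℕ) (s : Σ i, PresentedGroup (R i)) : Prog :=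
  .seq (.store (b + 8) (.reg 14) (.const (enum s))) (.assign 14 (.add (.reg 14) (.const 1)))

variable {b : ℕ} {l : List (Σ i, PresentedGroup (R i))} {s : Σ i, PresentedGroup (R i)}
  {τ υ : Store}

theorem HoldsStack.congr (h : HoldsStack b l τ) (hr : υ.reg 14 = τ.reg 14)
    (ha : υ.arr (b + 8) = τ.arr (b + 8)) : HoldsStack b l υ :=
  ⟨by rw [hr, h.reg], by rw [ha]; exact h.arr⟩

theorem HoldsStack.push (h : HoldsStack b l τ) :
    HoldsStack b (l ++ [s]) ((pushProg b s).run τ) := by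
  refine ⟨by simp [pushProg, h.reg], fun i hi => ?_⟩
  simp only [pushProg, run_seq, run_store, run_assign, Expr.eval, Store.arr_setReg,
    Store.arr_setArr_self, h.reg, Function.update_apply]
  split_ifs with hl
  · simp [hl]
  · have : i < l.length := by simp at hi; omega
    rw [h.arr i this, List.getElem_append_left this]

theorem HoldsStack.top (h : HoldsStack b (l ++ [s]) τ) : τ.arr (b + 8) l.length = enum s := by
  have := h.arr l.length (by simp)
  simpa using this

theorem HoldsStack.pop (h : HoldsStack b (l ++ [s]) τ) :
    HoldsStack b l (τ.setReg 14 l.length) := by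
  refine ⟨by simp, fun i hi => ?_⟩
  have := h.arr i (by simp; omega)
  simpa [hi] using this

variable (φ : ∀ i, A →* PresentedGroup (R i))

/-- Multiplication of the element of `A` in register `15` by the element `s`, with the product
in register `10`. -/
noncomputable def mulProg (s : Σ i, PresentedGroup (R i)) : Prog :=
  switch (.reg 15) enum (fun a : A =>
    .assign 10 (.const (enum (⟨s.1, φ s.1 a * s.2⟩ : Σ i, PresentedGroup (R i))))) (elems A)

open Classical in
/-- If the top of the stack is in the factor of the element in register `10`, it is removed, and
the element is multiplied by it. -/
noncomputable def mergeProg (R : ∀ i, Set (FreeGroup (X i))) [∀ i, Finite (PresentedGroup (R i))]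
    (b : ℕ) : Prog :=
  .ite (.reg 14)
    (switch (.load (b + 8) (.sub (.reg 14) (.const 1))) enum
      (fun s : Σ i, PresentedGroup (R i) => switch (.reg 10) enum
        (fun t : Σ i, PresentedGroup (R i) => if h : t.1 = s.1 then
          .seq (.assign 14 (.sub (.reg 14) (.const 1)))
            (.assign 10 (.const (enum (⟨s.1, s.2 * h ▸ t.2⟩ : Σ i, PresentedGroup (R i)))))
          else skip) (elems _)) (elems _))
    skip

open Classical in
/-- The element in register `10` is put on the stack, or into register `15` if it is in `A`. -/
noncomputable def absorbProg (b : ℕ) : Prog :=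
  switch (.reg 10) enum (fun s : Σ i, PresentedGroup (R i) =>
    if h : s.2 ∈ (φ s.1).range then .assign 15 (.const (enum h.choose))
    else .seq (pushProg b s) (.assign 15 (.const (enum (1 : A))))) (elems _)

/-- Multiplication of the element on the stack by `s`. -/
noncomputable def syllableProg (b : ℕ) (s : Σ i, PresentedGroup (R i)) : Prog :=
  .seq (mulProg φ s) (.seq (mergeProg R b) (absorbProg φ b))

-- One comparison with the top is enough: the stack is reduced, so below a top in the factor of s
-- comes an element of the other factor.
omit [Finite A] in
theorem mergeProg_run (hl : IsRed φ l) (hτ : HoldsStack b l τ) (h10 : τ.reg 10 = enum s) :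
    ∃ (l' : _) (t : Σ i, PresentedGroup (R i)), IsRed φ l' ∧ (∀ u ∈ l'.getLast?, u.1 ≠ t.1) ∧
      lval φ l' * Monoid.PushoutI.of t.1 t.2 = lval φ l * Monoid.PushoutI.of s.1 s.2 ∧
      l'.length ≤ l.length ∧ HoldsStack b l' ((mergeProg R b).run τ) ∧
      ((mergeProg R b).run τ).reg 10 = enum t := by
  rw [mergeProg, run_ite]
  rcases List.eq_nil_or_concat l with rfl | ⟨l', t, h⟩
  · have h14 : τ.reg 14 = 0 := hτ.reg
    refine ⟨[], s, hl, by simp, rfl, le_rfl, ?_⟩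
    simp [h14, hτ, h10]
  · rw [List.concat_eq_append] at h
    subst h
    have h14 : τ.reg 14 = l'.length + 1 := by simpa using hτ.reg
    have htop := hτ.top
    rw [isRed_append] at hl
    rw [if_neg (by simp [h14]), run_switch enum_injective (mem_elems t) (by simp [h14, htop]),
      run_switch enum_injective (mem_elems s) (by simp [h10])]
    split_ifs with h
    · obtain ⟨i, g⟩ := s
      obtain ⟨j, k⟩ := t
      obtain rfl : i = j := h
      refine ⟨l', ⟨i, k * g⟩, hl.1, fun u hu => by simpa using hl.2.2 u hu, by simp [mul_assoc], by simp,
        ?_, by simp⟩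
      refine hτ.pop.congr (by simp [h14]) (by simp)
    · refine ⟨l' ++ [t], s, isRed_append.2 hl, ?_, rfl, le_rfl, by rwa [run_skip],
        by rwa [run_skip]⟩
      simpa using fun h' => h h'.symm

theorem absorbProg_run (hl : IsRed φ l) (hls : ∀ u ∈ l.getLast?, u.1 ≠ s.1)
    (hτ : HoldsStack b l τ) (h10 : τ.reg 10 = enum s) :
    ∃ (l' : _) (a : A), IsRed φ l' ∧
      lval φ l' * Monoid.PushoutI.base φ a = lval φ l * Monoid.PushoutI.of s.1 s.2 ∧
      l'.length ≤ l.length + 1 ∧ HoldsStack b l' ((absorbProg φ b).run τ) ∧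
      ((absorbProg φ b).run τ).reg 15 = enum a := by
  rw [absorbProg, run_switch enum_injective (mem_elems s) (by simp [h10])]
  split_ifs with h
  · refine ⟨l, h.choose, hl, ?_, by simp, hτ.congr (by simp) (by simp), by simp⟩
    rw [← Monoid.PushoutI.of_apply_eq_base φ s.1, h.choose_spec]
  · refine ⟨l ++ [s], 1, isRed_append.2 ⟨hl, isRed_singleton h, ?_⟩, by simp, by simp,
      hτ.push.congr (by simp) (by simp), by simp⟩
    simpa using hls

/-- The state stands for a reduced word times an element of A. This element is moved across A into
the factor of s and multiplied by s, after which at most one merge is possible, so a letter takes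
bounded time. -/
theorem syllableProg_run {a : A} (hl : IsRed φ l) (hτ : HoldsStack b l τ)
    (h15 : τ.reg 15 = enum a) :
    ∃ (l' : _) (a' : A), IsRed φ l' ∧ lval φ l' * Monoid.PushoutI.base φ a' =
        lval φ l * Monoid.PushoutI.base φ a * Monoid.PushoutI.of s.1 s.2 ∧
      l'.length ≤ l.length + 1 ∧ HoldsStack b l' ((syllableProg φ b s).run τ) ∧
      ((syllableProg φ b s).run τ).reg 15 = enum a' := by
  have hmul : (mulProg φ s).run τ =
      τ.setReg 10 (enum (⟨s.1, φ s.1 a * s.2⟩ : Σ i, PresentedGroup (R i))) := by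
    rw [mulProg, run_switch enum_injective (mem_elems a) (by simp [h15])]
    rfl
  obtain ⟨l₁, t, h1, h2, h3, h4, h5, h6⟩ := mergeProg_run φ
    (s := ⟨s.1, φ s.1 a * s.2⟩) hl (hτ.congr (υ := (mulProg φ s).run τ) (by simp [hmul]) (by simp [hmul])) (by rw [hmul]; simp)
  obtain ⟨l₂, a', h7, h8, h9, h10, h11⟩ := absorbProg_run φ h1 h2 h5 h6
  refine ⟨l₂, a', h7, ?_, by omega, h10, h11⟩
  rw [h8, h3, map_mul, Monoid.PushoutI.of_apply_eq_base, mul_assoc]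

@[simp] theorem loopFree_syllableProg : (syllableProg φ b s).LoopFree := by
  simp only [syllableProg, mulProg, mergeProg, absorbProg, pushProg, LoopFree, loopFree_switch]
  refine ⟨fun _ _ => trivial, ⟨fun s _ t _ => ?_, trivial⟩, fun s _ => ?_⟩
  all_goals split_ifs <;> simp

theorem keepsReg_syllableProg {r : ℕ} (h10 : r ≠ 10) (h14 : r ≠ 14) (h15 : r ≠ 15) :
    (syllableProg φ b s).KeepsReg r := by
  simp only [syllableProg, mulProg, mergeProg, absorbProg, pushProg, KeepsReg, keepsReg_switch]
  refine ⟨fun _ _ => .inl h10.symm, ⟨fun s _ t _ => ?_, keepsReg_skip r⟩, fun s _ => ?_⟩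
  all_goals split_ifs <;> simp [h10.symm, h14.symm, h15.symm]

theorem keepsArr_syllableProg {a : ℕ} (h8 : a ≠ b + 8) :
    (syllableProg φ b s).KeepsArr a := by
  simp only [syllableProg, mulProg, mergeProg, absorbProg, pushProg, KeepsArr, keepsArr_switch]
  refine ⟨fun _ _ => trivial, ⟨fun s _ t _ => ?_, trivial⟩, fun s _ => ?_⟩
  all_goals split_ifs <;> simp [h8.symm]

open Classical in
/-- The element of `A` in register `15` is multiplied into the stack. -/
noncomputable def finishProg (b : ℕ) : Prog :=
  switch (.reg 15) enum (fun a : A => .ite (.reg 14)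
    (switch (.load (b + 8) (.sub (.reg 14) (.const 1))) enum
      (fun s : Σ i, PresentedGroup (R i) => .store (b + 8) (.sub (.reg 14) (.const 1))
        (.const (enum (⟨s.1, s.2 * φ s.1 a⟩ : Σ i, PresentedGroup (R i))))) (elems _))
    (if a = 1 then skip else pushProg b ⟨0, φ 0 a⟩)) (elems A)

/-- Multiplying the top by an element of A keeps it outside A. Only over an empty stack does a
non-trivial element of A become a syllable of its own, as is allowed for one-syllable normal words.
-/
theorem finishProg_run (hφ : ∀ i, Function.Injective (φ i)) {a : A} (hl : IsRed φ l)
    (hτ : HoldsStack b l τ) (h15 : τ.reg 15 = enum a) :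
    ∃ l', (IsRed φ l' ∨ ∃ s, l' = [s] ∧ s.2 ≠ 1) ∧
      lval φ l' = lval φ l * Monoid.PushoutI.base φ a ∧ l'.length ≤ l.length + 1 ∧
      HoldsStack b l' ((finishProg φ b).run τ) := by
  rw [finishProg, run_switch enum_injective (mem_elems a) (by simp [h15]), run_ite]
  rcases List.eq_nil_or_concat l with rfl | ⟨l', t, h⟩
  · have h14 : τ.reg 14 = 0 := hτ.reg
    rw [if_pos (by simp [h14])]
    split_ifs with ha
    · exact ⟨[], .inl hl, by simp [ha], by simp, by simpa using hτ⟩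
    · refine ⟨[⟨0, φ 0 a⟩], .inr ⟨_, rfl, ?_⟩, ?_, by simp, hτ.push⟩
      · exact fun h => ha (hφ 0 (by rw [map_one]; exact h))
      · simp [Monoid.PushoutI.of_apply_eq_base]
  · rw [List.concat_eq_append] at h
    subst h
    have h14 : τ.reg 14 = l'.length + 1 := by simpa using hτ.reg
    have htop := hτ.top
    rw [isRed_append] at hl
    rw [if_neg (by simp [h14]), run_switch enum_injective (mem_elems t) (by simp [h14, htop])]
    refine ⟨l' ++ [⟨t.1, t.2 * φ t.1 a⟩], .inl (isRed_append.2 ⟨hl.1, isRed_singleton ?_, ?_⟩),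
      ?_, by simp, by simpa using h14, fun i hi => ?_⟩
    · rw [Subgroup.mul_mem_cancel_right _ (MonoidHom.mem_range.2 ⟨a, rfl⟩)]
      exact hl.2.1.2 t (by simp)
    · simpa using hl.2.2
    · simp [Monoid.PushoutI.of_apply_eq_base, mul_assoc]
    · simp only [run_store, Expr.eval, h14, Nat.add_sub_cancel, Store.arr_setArr_self,
        Function.update_apply]
      split_ifs with h
      · simp [h]
      · have h' : i < l'.length := by simp at hi; omega
        have := hτ.arr i (by simp; omega)
        rw [this]
        simp [List.getElem_append_left h']

@[simp] theorem loopFree_finishProg : (finishProg φ b).LoopFree := by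
  simp only [finishProg, pushProg, LoopFree, loopFree_switch]
  refine fun a _ => ⟨fun _ _ => trivial, ?_⟩
  split_ifs <;> simp

theorem keepsReg_finishProg {r : ℕ} (h14 : r ≠ 14) : (finishProg φ b).KeepsReg r := by
  simp only [finishProg, pushProg, KeepsReg, keepsReg_switch]
  refine fun a _ => ⟨fun _ _ => trivial, ?_⟩
  split_ifs <;> simp [h14.symm]

theorem keepsArr_finishProg {a : ℕ} (h8 : a ≠ b + 8) : (finishProg φ b).KeepsArr a := by
  simp only [finishProg, pushProg, KeepsArr, keepsArr_switch]
  refine fun a _ => ⟨fun _ _ => h8.symm, ?_⟩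
  split_ifs <;> simp [h8.symm]

variable [∀ i, Finite (X i)]

/-- The stack for the word in array `0`. -/
noncomputable def stackProg (b : ℕ) (code : Letter X → ℕ) : Prog :=
  .seq (.seq (.assign 14 (.const 0)) (.assign 15 (.const (enum (1 : A)))))
    (.seq (forLoop 5 0 (switch (.load 0 (.reg 5)) code
      (fun x => syllableProg φ b (letterElt R x)) (elems _))) (finishProg φ b))

theorem keepsReg_stackProg {code : Letter X → ℕ} {r : ℕ} (h5 : r ≠ 5) (h10 : r ≠ 10)
    (h14 : r ≠ 14) (h15 : r ≠ 15) : (stackProg φ b code).KeepsReg r := by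
  simp [stackProg, keepsReg_syllableProg φ h10 h14 h15, keepsReg_finishProg φ h14, h5.symm,
    h14.symm, h15.symm]

theorem keepsArr_stackProg {code : Letter X → ℕ} {a : ℕ} (h8 : a ≠ b + 8) :
    (stackProg φ b code).KeepsArr a := by
  simp [stackProg, keepsArr_syllableProg φ h8, keepsArr_finishProg φ h8]

theorem stackProg_runs (hφ : ∀ i, Function.Injective (φ i)) {code : Letter X → ℕ}
    (hcode : Function.Injective code) :
    ∃ K, ∀ (g : List (Letter X)) σ, σ.reg 0 = g.length → σ.arr 0 = cells (g.map code) →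
      Runs (stackProg φ b code) σ (K * (g.length + 1)) fun τ =>
        ∃ l, (IsRed φ l ∨ ∃ s, l = [s] ∧ s.2 ≠ 1) ∧ lval φ l = wordVal φ g ∧
          l.length ≤ g.length + 1 ∧ HoldsStack b l τ := by
  set P := switch (.load 0 (.reg 5)) code
      (fun x => syllableProg φ b (letterElt R x)) (elems _) with hP
  refine ⟨10 + (P.bound + 10) + (finishProg φ b).bound, fun g σ h0 ha => ?_⟩
  have hinit : Runs (.seq (.assign 14 (.const 0)) (.assign 15 (.const (enum (1 : A))))) σ 10
      fun τ => HoldsStack b ([] : List (Σ i, PresentedGroup (R i))) τ ∧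
        τ.reg 15 = enum (1 : A) :=
    (Runs.of_run (by simp) (by exact ⟨⟨by simp, by simp⟩, by simp⟩)).imp
      (by simp [bound, Expr.cost]) fun _ _ h => h
  have hloop : ∀ τ, τ.reg 0 = g.length → τ.arr 0 = cells (g.map code) →
      HoldsStack b ([] : List (Σ i, PresentedGroup (R i))) τ → τ.reg 15 = enum (1 : A) →
      Runs (forLoop 5 0 P) τ ((g.length + 1) * (P.bound + 10)) fun τ =>
        ∃ (l : _) (a : A), IsRed φ l ∧ lval φ l * Monoid.PushoutI.base φ a = wordVal φ g ∧
          l.length ≤ g.length ∧ HoldsStack b l τ ∧ τ.reg 15 = enum a := by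
    intro τ h0 ha hτ h15
    have hk : ∀ r, r ≠ 10 → r ≠ 14 → r ≠ 15 → P.KeepsReg r := fun r h1 h2 h3 => by
      simp [hP, keepsReg_syllableProg φ h1 h2 h3]
    refine (Runs.forLoop (by simp [hP]) (hk 5 (by simp) (by simp) (by simp))
      (hk 0 (by simp) (by simp) (by simp)) (by simp) h0
      (fun k τ => ∃ (l : _) (a : A), IsRed φ l ∧
        lval φ l * Monoid.PushoutI.base φ a = wordVal φ (g.take k) ∧
          l.length ≤ k ∧ HoldsStack b l τ ∧ τ.reg 15 = enum a) ?_ ?_).imp le_rfl ?_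
    · exact ⟨[], 1, IsRed.nil, by simp, le_rfl, hτ.congr (by simp) (by simp), by simpa using h15⟩
    · rintro k hk' υ hF h5 ⟨l, a, h1, h2, h3, h4, h6⟩
      have hx : υ.arr 0 k = code g[k] := by
        rw [hF.arr 0 (by simp [hP, keepsArr_syllableProg]), ha]
        simp [cells, hk']
      have hrun : P.run υ = (syllableProg φ b (letterElt R g[k])).run υ :=
        run_switch hcode (mem_elems _) (by simp [h5, hx])
      obtain ⟨l', a', g1, g2, g3, g4, g5⟩ := syllableProg_run φ (s := letterElt R g[k]) h1 h4 h6
      refine ⟨l', a', g1, ?_, by omega, ?_, by simpa [hrun] using g5⟩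
      · rw [g2, h2, List.take_succ_eq_append_getElem hk', wordVal_append, wordVal_cons,
          wordVal_nil, mul_one, letterVal_eq]
      · exact (hrun ▸ g4).congr (by simp) (by simp)
    · rintro υ - ⟨l, a, h⟩
      exact ⟨l, a, by simpa using h⟩
  refine (hinit.seq fun τ hF ⟨h1, h2⟩ => (hloop τ ?_ ?_ h1 h2).seq
    fun υ _ ⟨l, a, h1, h2, h3, h4, h5⟩ => Runs.of_run (by simp) ?_).imp ?_ fun _ _ h => h
  · rw [hF.reg 0 (by simp), h0]
  · rw [hF.arr 0 (by simp), ha]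
  · obtain ⟨l', g1, g2, g3, g4⟩ := finishProg_run φ hφ h1 h4 h5
    exact ⟨l', g1, g2.trans h2, by omega, g4⟩
  · nlinarith [Nat.zero_le (g.length * (finishProg φ b).bound)]

end NormalForm

end AmalgamMembership

namespace AmalgamMembership

open Prog

/-! ### Reading words in the output graph -/

section Reading

variable {X : Fin 2 → Type*} {code : Letter X → ℕ}

/-- One step of the reading of a word in the graph that is held by the store: the current vertex
is `v - 1`, and `v = 0` if the word cannot be read. -/
def move (code : Letter X → ℕ) (σ : Store) (v : ℕ) (x : Letter X) : ℕ :=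
  if v = 0 then 0 else σ.arr (3 + code x) (v - 1)

theorem foldl_move_zero (σ : Store) (u : List (Letter X)) : u.foldl (move code σ) 0 = 0 := by
  induction u with
  | nil => rfl
  | cons x u ih => simpa [move] using ih

theorem Store.holdsGraph_congr {V : Type*} {Γ : LabGraph (Σ i, X i) V} {σ τ : Store}
    (h1 : τ.reg 1 = σ.reg 1) (ha : ∀ x, τ.arr (3 + code x) = σ.arr (3 + code x)) :
    τ.HoldsGraph code Γ ↔ σ.HoldsGraph code Γ := by
  simp only [Store.HoldsGraph, h1, ha]

/-- Every cell names at most one target, so reading is a table lookup. Vertices are shifted by one,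
the basepoint being 1 and failure being the absorbing value 0. -/
theorem Store.HoldsGraph.labelsLoop_iff {V : Type*} {Γ : LabGraph (Σ i, X i) V} {σ : Store}
    (h : σ.HoldsGraph code Γ) (u : List (Letter X)) :
    Γ.LabelsLoop u ↔ u.foldl (move code σ) 1 = 1 := by
  obtain ⟨ν, hν, h0, h⟩ := h
  have hread : ∀ (u : List (Letter X)), ∀ i < σ.reg 1, ∀ j < σ.reg 1,
      (Γ.Reads (ν i) u (ν j) ↔ u.foldl (move code σ) (i + 1) = j + 1) := by
    intro u
    induction u with
    | nil =>
      intro i hi j hj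
      simp only [LabGraph.Reads, List.foldl_nil, Nat.add_right_cancel_iff]
      exact ⟨fun h => hν.injOn hi hj h.2, fun h => ⟨hν.mapsTo hi, by rw [h]⟩⟩
    | cons x u ih =>
      intro i hi j hj
      obtain ⟨hle, he⟩ := h i hi x
      have hmove : move code σ (i + 1) x = σ.arr (3 + code x) i := by simp [move]
      simp only [LabGraph.Reads, List.foldl_cons, hmove]
      constructor
      · rintro ⟨v, hv, hr⟩
        obtain ⟨k, hk, rfl⟩ := hν.surjOn (Γ.edge_mem (Γ.edge_inv hv))
        rw [(he k hk).2 hv]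
        exact (ih k hk j hj).1 hr
      · intro hr
        rcases Nat.eq_zero_or_pos (σ.arr (3 + code x) i) with hz | hz
        · rw [hz, foldl_move_zero] at hr
          simp at hr
        · obtain ⟨k, hk⟩ := Nat.exists_eq_add_of_lt hz
          rw [zero_add] at hk
          rw [hk] at hr
          have hk' : k < σ.reg 1 := by omega
          exact ⟨ν k, (he k hk').1 hk, (ih k hk' j hj).2 hr⟩
  obtain ⟨i, hi, hi'⟩ := hν.surjOn Γ.base_mem
  have hpos : 0 < σ.reg 1 := Nat.zero_lt_of_lt hi
  rw [LabGraph.LabelsLoop, ← h0]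
  exact hread u 0 hpos 0 hpos

/-- The output of a letter, followed by a step of the reading with the current vertex in
register `6`. -/
def emitLetter (code : Letter X → ℕ) (x : Letter X) : Prog :=
  .seq (.seq (.store 0 (.reg 2) (.const (code x))) (.assign 2 (.add (.reg 2) (.const 1))))
    (.ite (.reg 6) (.assign 6 (.load (3 + code x) (.sub (.reg 6) (.const 1)))) skip)

/-- The word `u` has been written and read. -/
structure Emitted (code : Letter X → ℕ) (σ : Store) (u : List (Letter X)) (τ : Store) : Prop where
  word : τ.HoldsWord code u
  vertex : τ.reg 6 = u.foldl (move code σ) 1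
  arr : ∀ a, 0 < a → τ.arr a = σ.arr a

variable {σ τ : Store} {u : List (Letter X)}

theorem Emitted.letter (h : Emitted code σ u τ) (x : Letter X) :
    Emitted code σ (u ++ [x]) ((emitLetter code x).run τ) := by
  obtain ⟨⟨h2, h0⟩, h6, ha⟩ := h
  have hrun : (emitLetter code x).run τ = ((τ.setArr 0 u.length (code x)).setReg 2
      (u.length + 1)).setReg 6 (move code σ (τ.reg 6) x) := by
    have hs : ∀ υ : Store, υ.reg 6 = 0 → υ.setReg 6 0 = υ := fun υ h => by
      obtain ⟨r, a⟩ := υ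
      simp only [Store.setReg, ← h, Function.update_eq_self]
    rw [emitLetter, run_seq, run_ite]
    simp only [run_seq, run_store, run_assign, Expr.eval, h2, Store.reg_setReg,
      Store.reg_setArr, Store.arr_setReg, move]
    rw [Store.arr_setArr_of_ne _ (by omega), ha _ (by omega)]
    by_cases h : τ.reg 6 = 0
    · simp [h, hs]
    · simp [h]
  rw [hrun]
  refine ⟨⟨by simp, fun i hi => ?_⟩, by simp [h6], fun a ha' => ?_⟩
  · simp only [Store.arr_setReg, Store.arr_setArr_self, Function.update_apply]
    split_ifs with h
    · simp [h]
    · have : i < u.length := by simp at hi; omega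
      rw [h0 i this, List.getElem_append_left this]
  · simp only [Store.arr_setReg]
    rw [Store.arr_setArr_of_ne _ (by omega), ha a ha']

theorem Emitted.letters (h : Emitted code σ u τ) (v : List (Letter X)) :
    Emitted code σ (u ++ v) ((seqL (v.map (emitLetter code))).run τ) := by
  induction v generalizing u τ with
  | nil => simpa [seqL] using h
  | cons x v ih =>
    have := ih (h.letter x)
    simpa [seqL] using this

variable {R : ∀ i, Set (FreeGroup (X i))} [∀ i, Finite (PresentedGroup (R i))]
  {A : Type*} [Group A] (φ : ∀ i, A →* PresentedGroup (R i))

/-- The output and the reading of the word that spells the stack, and the answer. -/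
noncomputable def emitProg (b : ℕ) (code : Letter X → ℕ) : Prog :=
  .seq (.seq (.assign 2 (.const 0)) (.assign 6 (.const 1)))
    (.seq (forLoop 5 14 (switch (.load (b + 8) (.reg 5)) enum
      (fun s => seqL ((spell φ s).map (emitLetter code))) (elems _)))
      (.assign 0 (isEq (.reg 6) (.const 1))))

/-- The spellings of the finitely many possible entries are part of the program text, so each entry
takes bounded time. Writing affects array 0 only, whereas the graph is read from other arrays, so
both can be done at once. -/
theorem emitProg_runs (b : ℕ) (code : Letter X → ℕ) :
    ∃ K, ∀ (l : List (Σ i, PresentedGroup (R i))) σ, HoldsStack b l σ →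
      Runs (emitProg φ b code) σ (K * (l.length + 1)) fun τ =>
        τ.HoldsWord code (l.map (spell φ)).flatten ∧ (τ.reg 0 = 0 ∨ τ.reg 0 = 1) ∧
        (τ.reg 0 = 1 ↔ (l.map (spell φ)).flatten.foldl (move code σ) 1 = 1) := by
  set P := switch (.load (b + 8) (.reg 5)) enum
      (fun s => seqL ((spell φ s).map (emitLetter code))) (elems _) with hP
  refine ⟨10 + (P.bound + 10) + 20, fun l σ hσ => ?_⟩
  have hk : ∀ r, r ≠ 2 → r ≠ 6 → P.KeepsReg r := fun r h1 h2 => by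
    simp [hP, emitLetter, h1.symm, h2.symm]
  have hinit : Runs (.seq (.assign 2 (.const 0)) (.assign 6 (.const 1))) σ 10
      (Emitted code σ []) :=
    (Runs.of_run (Q := Emitted code σ []) (by simp)
      ⟨⟨by simp, by simp⟩, by simp, by simp⟩).imp (by simp [bound, Expr.cost]) fun _ _ h => h
  have hloop : ∀ τ, HoldsStack b l τ → Emitted code σ [] τ →
      Runs (forLoop 5 14 P) τ ((l.length + 1) * (P.bound + 10))
        (Emitted code σ (l.map (spell φ)).flatten) := by
    intro τ hτ hE
    refine (Runs.forLoop (by simp [hP, emitLetter]) (hk 5 (by simp) (by simp))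
      (hk 14 (by simp) (by simp)) (by simp) hτ.reg
      (fun k => Emitted code σ ((l.take k).map (spell φ)).flatten) ?_ ?_).imp le_rfl ?_
    · exact ⟨⟨by simpa using hE.word.1, by simp⟩, by simpa using hE.vertex, hE.arr⟩
    · rintro k hk' υ hF h5 hυ
      have hs : υ.arr (b + 8) k = enum l[k] := by
        rw [hυ.arr _ (by omega), ← hE.arr _ (by omega), hτ.arr k hk']
      have hrun : P.run υ = (seqL ((spell φ l[k]).map (emitLetter code))).run υ :=
        run_switch enum_injective (mem_elems _) (by simp [h5, hs])
      have := hυ.letters (spell φ l[k])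
      rw [← hrun] at this
      rw [List.take_succ_eq_append_getElem hk', List.map_append, List.flatten_append,
        List.map_singleton, List.flatten_singleton]
      exact ⟨⟨by simpa using this.word.1, by simpa using this.word.2⟩, by simpa using this.vertex,
        this.arr⟩
    · intro υ _ h
      simpa only [List.take_length] using h
  refine (hinit.seq fun τ hF h => (hloop τ (hσ.congr ?_ ?_) h).seq
    fun υ _ hυ => Runs.of_run (by simp) ?_).imp ?_ fun _ _ h => h
  · rw [hF.reg 14 (by simp)]
  · rw [hF.arr _ (by simp)]
  · refine ⟨⟨by simpa using hυ.word.1, by simpa using hυ.word.2⟩, ?_⟩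
    have h6 := hυ.vertex
    rw [← h6]
    simp only [run_assign, Store.reg_setReg, if_true, isEq, neq, Expr.eval]
    omega
  · simp only [bound]
    have : (Expr.cost (isEq (.reg 6) (.const 1))) + 1 ≤ 20 := by simp [isEq, neq, Expr.cost]
    nlinarith

end Reading

end AmalgamMembership

namespace AmalgamMembership

open Prog

/-! ### The computation of the normal core -/

section Core

variable {X : Fin 2 → Type*} [∀ i, Finite (X i)] {R : ∀ i, Set (FreeGroup (X i))}
  [∀ i, Finite (PresentedGroup (R i))] {A : Type*} [Group A] [Finite A]
  (φ : ∀ i, A →* PresentedGroup (R i)) (b : ℕ) (code : Letter X → ℕ)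

/-- The computation of the folded graph of the words. -/
noncomputable def coverProg : Prog :=
  .seq (boundaryProg b) (.seq (nodesProg b (Nat.card (Σ i, PresentedGroup (R i))))
    (.seq (foldProg φ b code)
      (.assign 12 (.load b (.const (enum (⟨0, 1⟩ : Σ i, PresentedGroup (R i))))))))

theorem keepsReg_coverProg {r : ℕ} (h : r ∉ [3, 4, 5, 7, 8, 9, 10, 11, 12]) :
    (coverProg φ b code).KeepsReg r := by
  simp only [List.mem_cons, List.not_mem_nil, or_false, not_or] at h
  have : (foldBody φ b code).KeepsReg r := keepsReg_foldBody (by tauto) (by tauto) (by tauto)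
    (by tauto) (by tauto)
  simp only [coverProg, boundaryProg, nodesProg, foldProg, KeepsReg, keepsReg_forLoop, this]
  tauto

theorem keepsArr_coverProg {a : ℕ} (h : a < b + 9) (h0 : a ≠ b) (h1 : a ≠ b + 1) :
    (coverProg φ b code).KeepsArr a := by
  simp [coverProg, boundaryProg, nodesProg, foldProg, keepsArr_foldBody h h0, h0.symm, h1.symm]

variable {φ b}

omit [∀ i, Finite (X i)] in
theorem HoldsFolded.step_iff {hs : List (List (Letter X))} {τ : Store} (h : HoldsFolded φ b hs τ)
    (s : Σ i, PresentedGroup (R i)) (c d : ℕ) :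
    τ.arr (actArr A b s) c = d + 1 ↔ LabStep hs (labOf R (τ.arr b)) c s d := by
  rw [actArr, h.act]
  obtain ⟨i, k⟩ := s
  constructor
  · rintro ⟨t, ht, ⟨j, g, k' | a⟩, hr, rfl, rfl⟩
    · have hr' : (⟨j, k'⟩ : Σ i, PresentedGroup (R i)) = ⟨i, k⟩ := Sum.inl_injective hr
      obtain ⟨rfl, hk⟩ := Sigma.mk.inj hr'
      obtain rfl := eq_of_heq hk
      exact ⟨t, ht, g, rfl, rfl⟩
    · cases hr
  · rintro ⟨t, ht, g, rfl, rfl⟩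
    exact ⟨t, ht, ⟨i, g, .inl k⟩, rfl, rfl, rfl⟩

variable (φ b) {code}

theorem coverProg_runs (hcode : Function.Injective code) (hb : 3 ≤ b) :
    ∃ K, ∀ (hs : List (List (Letter X))) (σ : Store), σ.reg 1 = hs.length → σ.reg 3 = 0 →
      σ.reg 4 = 0 → σ.arr 1 = cells (hs.map List.length) →
      σ.arr 2 = cells (hs.flatten.map code) → (∀ a, b ≤ a → ∀ i, σ.arr a i = 0) →
      Runs (coverProg φ b code) σ (K * ((hs.flatten.length + 1) ^ 2 + hs.length)) fun τ =>
        ∃ Step base cos, IsCoreModel φ hs Step base cos ∧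
          HoldsStep A b ((hs.flatten.length + 1) * Nat.card (Σ i, PresentedGroup (R i))) Step
            base τ ∧
          ∀ c s d, Step c s d →
            c < (hs.flatten.length + 1) * Nat.card (Σ i, PresentedGroup (R i)) ∧
            d < (hs.flatten.length + 1) * Nat.card (Σ i, PresentedGroup (R i)) := by
  obtain ⟨K, hK⟩ := foldProg_runs φ b code hcode hb
  set S := Nat.card (Σ i, PresentedGroup (R i)) with hS
  refine ⟨20 + (S + 3) * 40 + K + 10, fun hs σ h1 h3 h4 ha1 ha2 h0 => ?_⟩
  set m := hs.flatten.length with hm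
  obtain ⟨τ₁, t₁, e₁, l₁, p₁, p₂, p₃⟩ := boundaryProg_runs hb hs h1 h3 ha1 (h0 _ (by omega))
  have q4 : τ₁.reg 4 = 0 := by rw [e₁.frame.reg 4 (by simp [boundaryProg]), h4]
  obtain ⟨τ₂, t₂, e₂, l₂, q11, q4, qL⟩ := nodesProg_runs (b := b) (S := S) p₁ q4
  have hctx : FoldCtx R b code hs τ₂ := by
    have hB : τ₂.arr (b + 1) = τ₁.arr (b + 1) := e₂.frame.arr _ (by simp [nodesProg])
    refine ⟨?_, ?_, ?_, ?_, q4, q11⟩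
    · rw [e₂.frame.arr 2 (by simp [nodesProg]; omega),
        e₁.frame.arr 2 (by simp [boundaryProg]; omega), ha2]
    · rw [hB]; exact p₂
    · rw [hB]; exact p₃
    · rw [e₂.frame.reg 3 (by simp [nodesProg]), p₁]
  have hinv : FoldInv φ b hs τ₂ := by
    refine ⟨fun p hp => by rw [qL p hp]; exact hp, ?_, ?_⟩
    · intro t ht t' ht' s s' h
      rw [labOf, labOf, qL _ (node_lt ht s), qL _ (node_lt ht' s')] at h
      have hs1 := enum_lt s
      have hs2 := enum_lt s'
      have hpos : 0 < S := Nat.zero_lt_of_lt hs1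
      -- Division by the block size recovers the prefix from the number of a node, so the initial
      -- labelling is injective on nodes and hence sound.
      have hd : ∀ (t : ℕ) (s : Σ i, PresentedGroup (R i)), (t * S + enum s) / S = t := by
        intro t s
        rw [mul_comm, Nat.mul_add_div hpos, Nat.div_eq_of_lt (enum_lt s), add_zero]
      obtain rfl : t = t' := by rw [← hd t s, ← hd t' s', h]
      rw [enum_injective (Nat.add_left_cancel h)]
    · intro l c _
      rw [e₂.frame.arr _ (by simp [nodesProg]; omega),
        e₁.frame.arr _ (by simp [boundaryProg]; omega), h0 _ (by omega)]
  obtain ⟨τ₃, t₃, e₃, l₃, hctx, hinv, hF⟩ := hK hs τ₂ hctx hinv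
  obtain ⟨τ₄, t₄, e₄, l₄, r12, ra, r4⟩ := Runs.of_run (σ := τ₃)
    (P := .assign 12 (.load b (.const (enum (⟨0, 1⟩ : Σ i, PresentedGroup (R i))))))
    (Q := fun τ => τ.reg 12 = labOf R (τ₃.arr b) 0 ⟨0, 1⟩ ∧ τ.arr = τ₃.arr ∧ τ.reg 4 = τ₃.reg 4)
    (by simp) (by simp [labOf])
  have hlt : ∀ t ≤ m, ∀ s, labOf R (τ₃.arr b) t s < (m + 1) * S :=
    fun t ht s => hinv.lab_lt _ (node_lt ht s)
  refine ⟨τ₄, _, e₁.seq (e₂.seq (e₃.seq e₄)), ?_, _, _, _, hF.folded.isCoreModel,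
    ⟨r4.trans hctx.reg_nodes, r12, fun s c d => ?_⟩, ?_⟩
  · simp only [bound, Expr.cost] at l₄
    have : (S + 3) * 40 * (m + 1) ≤ (S + 3) * 40 * (m + 1) ^ 2 :=
      Nat.mul_le_mul_left _ (Nat.le_self_pow (by simp) _)
    have : 1 ≤ (m + 1) ^ 2 := Nat.one_le_pow _ _ (by omega)
    nlinarith [Nat.zero_le (((S + 3) * 40 + K) * hs.length)]
  · rw [ra]; exact hF.step_iff s c d
  · rintro c s d ⟨t, ht, g, rfl, rfl⟩
    exact ⟨hlt t ht _, hlt t ht _⟩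

variable (code)

/-- The computation of the normal core from the folded graph. -/
noncomputable def coreProg : Prog :=
  .seq (reachProg φ b) (.seq (markProg φ b) (.seq (numProg b) (.seq (outProg R A b code)
    (.assign 1 (.reg 13)))))

theorem keepsReg_coreProg {r : ℕ} (h : r ∉ [1, 5, 10, 13]) : (coreProg φ b code).KeepsReg r := by
  simp only [List.mem_cons, List.not_mem_nil, or_false, not_or] at h
  have h1 : 1 ≠ r := Ne.symm h.1
  have h5 : 5 ≠ r := Ne.symm h.2.1
  have h10 : 10 ≠ r := Ne.symm h.2.2.1
  have h13 : 13 ≠ r := Ne.symm h.2.2.2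
  simp [coreProg, reachProg, markProg, numProg, outProg, numBody, outLetter, keepsReg_reachBody,
    keepsReg_markBody, *]

variable {b code}

theorem keepsArr_coreProg_zero (hb : 3 ≤ b) : (coreProg φ b code).KeepsArr 0 := by
  have h2 := keepsArr_reachBody φ (b := b) (a := 0) (by omega) (by omega)
  have h4 := keepsArr_markBody φ (b := b) (a := 0) (by omega) (by omega)
  simp [coreProg, reachProg, markProg, numProg, outProg, numBody, outLetter, h2, h4]

theorem coreProg_runs (hφ : ∀ i, Function.Injective (φ i)) (hcode : Function.Injective code)
    (hb : ∀ x, 3 + code x < b) :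
    ∃ K, ∀ (hs : List (List (Letter X))) N Step base cos σ, IsCoreModel φ hs Step base cos →
      HoldsStep A b N Step base σ → (∀ c s d, Step c s d → c < N ∧ d < N) →
      (∀ a, b + 2 ≤ a → a < b + 6 → ∀ i, σ.arr a i = 0) →
      Runs (coreProg φ b code) σ (K * (N + 1) ^ 2) fun τ =>
        τ.HoldsGraph code (normalCore φ (generated φ hs)) := by
  obtain ⟨K, hK⟩ := reachProg_runs φ b
  set Kout := (seqL ((elems (Letter X)).map (outLetter R A b code))).bound with hKout
  refine ⟨K + ((markBody φ b).bound + 10) + 200 + 2 * (Kout + 10) + 10,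
    fun hs N Step base cos σ M hσ hlt h0 => ?_⟩
  obtain ⟨τ₁, t₁, e₁, l₁, q₁⟩ := hK N Step base σ hlt hσ
    fun j c => h0 _ (by omega) (by omega) c
  have hσ₁ : HoldsStep A b N Step base τ₁ := hσ.frame e₁.frame
    (by simp [reachProg, keepsReg_reachBody]) (by simp [reachProg, keepsReg_reachBody])
    fun a ha => by
      simp [reachProg, keepsArr_reachBody φ (b := b) (a := a) (by omega) (by omega)]
  obtain ⟨τ₂, t₂, e₂, l₂, q₂⟩ := markProg_runs M.toIsPrecover hσ₁ q₁ fun j c => by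
    rw [e₁.frame.arr _ (by
      simp [reachProg, keepsArr_reachBody φ (b := b) (a := b + 4 + j.val) (by omega) (by omega)])]
    exact h0 _ (by omega) (by omega) c
  have hσ₂ : HoldsStep A b N Step base τ₂ := hσ₁.frame e₂.frame
    (by simp [markProg, keepsReg_markBody]) (by simp [markProg, keepsReg_markBody])
    fun a ha => by
      simp [markProg, keepsArr_markBody φ (b := b) (a := a) (by omega) (by omega)]
  have q₂' : ∀ (j : Fin 2) c, τ₂.arr (b + 4 + j.val) c ≠ 0 ↔ Marked φ Step base j c := by
    intro j c
    rw [q₂]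
    refine ⟨fun h => h.2, fun h => ⟨?_, h⟩⟩
    obtain ⟨k, d, hd⟩ := h.live
    exact (hlt _ _ _ hd).1
  obtain ⟨τ₃, t₃, e₃, l₃, hle, q₃⟩ := numProg_runs (b := b) hσ₂.reg_nodes hσ₂.reg_base
  have hσ₃ : HoldsStep A b N Step base τ₃ := hσ₂.frame e₃.frame
    (by simp [numProg, numBody]) (by simp [numProg, numBody])
    fun a ha => by
      simp [numProg, numBody]; omega
  have q₃' : Numbered b base (fun c => c = base ∨ ∃ j, Marked φ Step base j c) τ₃ := by
    have : (fun c => c = base ∨ c < N ∧ (τ₂.arr (b + 4) c ≠ 0 ∨ τ₂.arr (b + 5) c ≠ 0)) =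
        fun c => c = base ∨ ∃ j, Marked φ Step base j c := by
      funext c
      have h4 := q₂' 0 c
      have h5 := q₂' 1 c
      have g4 := q₂ 0 c
      have g5 := q₂ 1 c
      simp only [Fin.val_zero, Fin.val_one, add_zero] at h4 h5 g4 g5
      simp only [add_assoc, Nat.reduceAdd] at h5 g5
      rw [Fin.exists_fin_two, ← h4, ← h5]
      exact propext (or_congr_right ⟨fun h => h.2, fun h =>
        ⟨h.elim (fun h => (g4.1 h).1) fun h => (g5.1 h).1, h⟩⟩)
    rwa [this] at q₃
  have q₂₃ : ∀ (j : Fin 2) c, τ₃.arr (b + 4 + j.val) c ≠ 0 ↔ Marked φ Step base j c := by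
    intro j c
    rw [e₃.frame.arr _ (by simp [numProg, numBody]; omega), q₂']
  obtain ⟨τ₄, t₄, e₄, l₄, q₄⟩ := outProg_runs (R := R) (A := A) hcode hb τ₃
  have h13 : τ₄.reg 13 = τ₃.reg 13 := e₄.frame.reg 13 (by simp [outProg, outLetter])
  obtain ⟨τ₅, t₅, e₅, l₅, r1, ra⟩ := Runs.of_run (σ := τ₄) (P := .assign 1 (.reg 13))
    (Q := fun τ => τ.reg 1 = τ₄.reg 13 ∧ τ.arr = τ₄.arr) (by simp) (by simp)
  refine ⟨τ₅, _, e₁.seq (e₂.seq (e₃.seq (e₄.seq e₅))), ?_,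
    holdsGraph_of_numbered hφ M hσ₃ q₂₃ q₃' (r1.trans h13) (by rw [ra]; exact q₄)⟩
  simp only [bound, Expr.cost] at l₅
  have h1 : N + 1 ≤ (N + 1) ^ 2 := Nat.le_self_pow (by simp) _
  have h2 : (τ₃.reg 13 + 1) * (Kout + 10) ≤ (2 * (N + 1)) * (Kout + 10) :=
    Nat.mul_le_mul_right _ (by omega)
  have h3 := Nat.mul_le_mul_right ((markBody φ b).bound + 10) h1
  have h4 := Nat.mul_le_mul_right (2 * (Kout + 10)) h1
  nlinarith

end Core

end AmalgamMembership

/-! ### The complete algorithm -/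

open AmalgamMembership in
theorem mainTheorem4 {X : Fin 2 → Type*} [∀ i, Finite (X i)]
    (R : ∀ i, Set (FreeGroup (X i))) [∀ i, Finite (PresentedGroup (R i))]
    {A : Type*} [Group A] (φ : ∀ i, A →* PresentedGroup (R i))
    (hφ : ∀ i, Function.Injective (φ i))
    (code : Letter X → ℕ) (hcode : Function.Injective code) :
    ∃ (P : Prog) (C : ℕ), ∀ (g : List (Letter X)) (hs : List (List (Letter X))),
      ∃ (τ : Store) (t : ℕ), Exec P (inputStore code g hs) τ t ∧
        t ≤ C * ((hs.map List.length).sum ^ 2 + g.length ^ 2 + hs.length + 1) ∧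
        τ.HoldsGraph code (normalCore φ (generated φ hs)) ∧
        (∃ u, IsNormalWord φ u ∧ wordVal φ u = wordVal φ g ∧ τ.HoldsWord code u ∧
          (τ.reg 0 = 1 ↔ (normalCore φ (generated φ hs)).LabelsLoop u)) ∧
        (τ.reg 0 = 0 ∨ τ.reg 0 = 1) ∧
        (τ.reg 0 = 1 ↔ wordVal φ g ∈ generated φ hs) := by
  have : Finite A := .of_injective _ (hφ 0)
  obtain ⟨B, hB⟩ := (Set.finite_range code).bddAbove
  -- The working arrays start beyond the input arrays 0, 1, 2 and beyond the output arrays `3 + code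
  -- x`; such a b exists because there are finitely many letters.
  obtain ⟨b, hb, hb3⟩ : ∃ b, (∀ x, 3 + code x < b) ∧ 3 ≤ b :=
    ⟨B + 4, fun x => by have := hB ⟨x, rfl⟩; omega, by omega⟩
  obtain ⟨K₁, h₁⟩ := coverProg_runs φ b hcode hb3
  obtain ⟨K₂, h₂⟩ := coreProg_runs φ hφ hcode hb
  obtain ⟨K₃, h₃⟩ := stackProg_runs φ (b := b) hφ hcode
  obtain ⟨K₄, h₄⟩ := emitProg_runs φ b code
  set S := Nat.card (Σ i, PresentedGroup (R i)) with hS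
  refine ⟨.seq (coverProg φ b code) (.seq (coreProg φ b code) (.seq (stackProg φ b code)
    (emitProg φ b code))), 2 * K₁ + 2 * K₂ * (S + 1) ^ 2 + 2 * K₃ + 3 * K₄, fun g hs => ?_⟩
  obtain ⟨τ₁, t₁, e₁, l₁, Step, base, cos, M, hσ, hlt⟩ := h₁ hs (inputStore code g hs) (by
    simp [inputStore]) (by simp [inputStore]) (by simp [inputStore]) (by simp [inputStore])
    (by simp [inputStore]) fun a ha i => by
      simp [inputStore, show a ≠ 0 by omega, show a ≠ 1 by omega, show a ≠ 2 by omega]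
  obtain ⟨τ₂, t₂, e₂, l₂, hG⟩ := h₂ hs _ Step base cos τ₁ M hσ hlt fun a ha ha' i => by
    rw [e₁.frame.arr a (keepsArr_coverProg φ b code (by omega) (by omega) (by omega))]
    simp [inputStore, show a ≠ 0 by omega, show a ≠ 1 by omega, show a ≠ 2 by omega]
  obtain ⟨τ₃, t₃, e₃, l₃, l, hl, hval, hlen, hst⟩ := h₃ g τ₂ (by
    rw [e₂.frame.reg 0 (keepsReg_coreProg φ b code (by simp)),
      e₁.frame.reg 0 (keepsReg_coverProg φ b code (by simp))]
    simp [inputStore]) (by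
    rw [e₂.frame.arr 0 (keepsArr_coreProg_zero φ hb3),
      e₁.frame.arr 0 (keepsArr_coverProg φ b code (by omega) (by omega) (by omega))]
    simp [inputStore])
  obtain ⟨τ₄, t₄, e₄, l₄, hW, h01, hread⟩ := h₄ l τ₃ hst
  -- The normal form is computed and written outside the arrays of the graph, and register 1 keeps
  -- the number of vertices.
  have hG₃ : τ₃.HoldsGraph code (normalCore φ (generated φ hs)) := by
    rw [Store.holdsGraph_congr (e₃.frame.reg 1 (keepsReg_stackProg φ (by simp) (by simp) (by simp)
      (by simp))) fun x => e₃.frame.arr _ (keepsArr_stackProg φ (by have := hb x; omega))]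
    exact hG
  have hG₄ : τ₄.HoldsGraph code (normalCore φ (generated φ hs)) := by
    rw [Store.holdsGraph_congr (e₄.frame.reg 1 (by simp [emitProg, emitLetter]))
      fun x => e₄.frame.arr _ (by
        have h0 : ¬ 0 = 3 + code x := by omega
        simp [emitProg, emitLetter, h0])]
    exact hG₃
  have hu := isNormalWord_flatten hφ hl
  have hloop := (hread.trans (hG₃.labelsLoop_iff _).symm)
  have hvu : wordVal φ (l.map (spell φ)).flatten = wordVal φ g := by
    rw [wordVal_flatten_spell, hval]
  refine ⟨τ₄, _, e₁.seq (e₂.seq (e₃.seq e₄)), ?_, hG₄, ⟨_, hu, hvu, hW, hloop⟩, h01, ?_⟩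
  · have hm : hs.flatten.length = (hs.map List.length).sum := List.length_flatten
    rw [hm] at l₁ l₂
    generalize (hs.map List.length).sum = m at l₁ l₂ ⊢
    set T := m ^ 2 + g.length ^ 2 + hs.length + 1 with hT
    have hm2 : (m + 1) ^ 2 ≤ 2 * (m ^ 2 + 1) := by
      have := two_mul_le_add_sq (m : ℤ) 1
      zify
      linarith
    -- The running time of each phase is compared with a multiple of T. The factor 3 in the last
    -- comparison arises because the stack may have one entry more than g has letters.
    have i₁ : (m + 1) ^ 2 + hs.length ≤ 2 * T := by omega
    have i₂ : ((m + 1) * S + 1) ^ 2 ≤ (S + 1) ^ 2 * (2 * T) := by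
      calc ((m + 1) * S + 1) ^ 2 ≤ ((S + 1) * (m + 1)) ^ 2 :=
            Nat.pow_le_pow_left (by nlinarith) 2
        _ = (S + 1) ^ 2 * (m + 1) ^ 2 := mul_pow _ _ _
        _ ≤ _ := Nat.mul_le_mul_left _ (by omega)
    have hg : g.length ≤ g.length ^ 2 := Nat.le_self_pow (by simp) _
    have j₁ := l₁.trans (Nat.mul_le_mul_left K₁ i₁)
    have j₂ := l₂.trans (Nat.mul_le_mul_left K₂ i₂)
    have j₃ := l₃.trans (Nat.mul_le_mul_left K₃ (show g.length + 1 ≤ 2 * T by omega))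
    have j₄ := l₄.trans (Nat.mul_le_mul_left K₄ (show l.length + 1 ≤ 3 * T by omega))
    calc t₁ + (t₂ + (t₃ + t₄)) ≤ K₁ * (2 * T) + (K₂ * ((S + 1) ^ 2 * (2 * T)) +
          (K₃ * (2 * T) + K₄ * (3 * T))) := by omega
      _ = _ := by ring
  · rw [hloop, normalCore_labelsLoop_iff hu, hvu]
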